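/- **Setting.** Let $q_0=(\frac1{\sqrt3},1)$, $q_1=(0,0)$, $q_2=(\frac2{\sqrt3},0)$ and let $\mathcal{SG}_3$ be the level-3 Sierpinski gasket, the unique nonempty compact $K\subset\mathbb R^2$ with $K=\bigcup_{i=0}^5F_iK$, where $F_i(z)=\frac13z+\frac23q_i$ for $i=0,1,2$ and $F_3(z)=\frac13(z+q_1+q_2)$, $F_4(z)=\frac13(z+q_0+q_2)$, $F_5(z)=\frac13(z+q_0+q_1)$. Write $F_v=F_{v_1}\circ\cdots\circ F_{v_m}$ for a word $v\in\{0,\dots,5\}^m$ and call $F_v\mathcal{SG}_3$ an $m$-cell; write $x\sim_my$ if $x\ne y$ are vertices (images of $q_0,q_1,q_2$) of a common $m$-cell. For $0<\lambda\le1$ let $\Omega_\lambda=\{(x,y)\in\mathcal{SG}_3\setminus\{q_0,q_1,q_2\}: y>1-\lambda\}$ and $X=X_\lambda=\{(x,y)\in\mathcal{SG}_3:y=1-\lambda\}$, so that $\partial\Omega_\lambda=\{q_0\}\cup X_\lambda$. A function $u$ is harmonic in $\Omega_\lambda$ if $\sum_{y\sim_mx}(u(x)-u(y))=0$ for every $m$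 and every vertex $x\in\Omega_\lambda$ of an $m$-cell such that all $m$-cells containing $x$ lie in $\Omega_\lambda$. Its energy $\mathcal E_{\Omega_\lambda}(u)\in[0,\infty]$ is the increasing limit, as $m\to\infty$, of $(\frac{15}7)^m\sum(u(x)-u(y))^2$ over the edges $x\sim_my$ of the $m$-cells contained in $\Omega_\lambda$. Write $\lambda=\sum_{k\ge1}\iota_k3^{-m_k}$ with integers $0<m_1<m_2<\cdots$ and $\iota_k\in\{1,2\}$ (this representation is unique), put $m_0=0$, $\lambda_n=\sum_{k>n}\iota_k3^{-(m_k-m_n)}$, $R\lambda=\lambda_1$, $S_1=\{4,5\}$, $S_2=\{1,2,3\}$, $W_n^\lambda=\prod_{k=1}^nS_{\iota_k}$, and for $w\in W^\lambda_n$ let $F_w^\lambda=F_0^{m_1-m_0-1}F_{w_1}\cdots F_0^{m_n-m_{n-1}-1}F_{w_n}$ and $X_w=F_w^\lambda\mathcal{SG}_3\cap X$. Let $h_0^\lambda$ be the continuous function on $\Omega_\lambda\cup\partial\Omega_\lambda$ that is harmonic in $\Omega_\lambda$, equal to $1$ at $q_0$ and to $0$ on $X_\lambda$, and let $$\eta(\lambda)=\lim_{m\to\infty}(\tfrac{15}7)^m\big(2h^\lambda_0(q_0)-h^\lambda_0(F_0^mq_1)-h^\lambda_0(F_0^mq_2)\big).$$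 Put $\mu^\lambda_4=\mu^\lambda_5=\frac12$ if $\iota_1=1$, and $\mu^\lambda_1=\mu^\lambda_2=\frac{6+\eta(R\lambda)}{18+4\eta(R\lambda)}$, $\mu_3^\lambda=\frac{3+\eta(R\lambda)}{9+2\eta(R\lambda)}$ if $\iota_1=2$. Let $\mu^\lambda$ be the probability measure on $X$ with $\mu^\lambda(X_w)=\prod_{k=1}^{n}\mu^{\lambda_{k-1}}_{w_k}$ for all $n$ and $w\in W^\lambda_n$. For $w\in W_n^\lambda$ and $1\le j\le\iota_{n+1}$ let $\psi_w^{(j)}$ be the function that vanishes off $X_w$ and has the following constant values on the sets $X_{wi}$, $i\in S_{\iota_{n+1}}$ ($\mu^\lambda$-null overlaps being ignored). If $\iota_{n+1}=1$: $\psi_w^{(1)}=1$ on $X_{w5}$ and $-1$ on $X_{w4}$. If $\iota_{n+1}=2$: $\psi_w^{(1)}=1,-1,0$ on $X_{w1},X_{w2},X_{w3}$, and $\psi_w^{(2)}=\mu_3^{\lambda_n},\ \mu_3^{\lambda_n},\ -2\mu_1^{\lambda_n}$ on $X_{w1},X_{w2},X_{w3}$. For $f\in L^2(X,\mu^\lambda)$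 put $$b=\int_Xf\,d\mu^\lambda,\qquad c_w^{(j)}=\Big(\int_X(\psi_w^{(j)})^2d\mu^\lambda\Big)^{-1}\int_Xf\psi_w^{(j)}d\mu^\lambda .$$ **Theorem 3.10.** There are constants $C_1,C_2>0$ such that the following holds for all $0<\lambda\le1$ and all $a\in\mathbb R$. Let $u$ be the harmonic function in $\Omega_\lambda$ with boundary values $a$ at $q_0$ and $f$ on $X$. This means either that $f$ is continuous, $u$ is continuous on $\Omega_\lambda\cup\partial\Omega_\lambda$, $u(q_0)=a$ and $u|_X=f$; or, more generally, that $f\in L^2(X,\mu^\lambda)$, $u(x)\to a$ as $x\to q_0$ in $\Omega_\lambda$, and $\sum_{w\in W^\lambda_n}u(F_w^\lambda q_0)\chi_{X_w}\to f$ in $L^2(X,\mu^\lambda)$ as $n\to\infty$. Then $$f=b+\sum_{n=0}^\infty\sum_{w\in W_n^\lambda}\sum_{j=1}^{\iota_{n+1}}c_w^{(j)}\psi_w^{(j)}\quad\text{in }L^2(X,\mu^\lambda),$$ and with $$Q=(\tfrac{15}7)^{m_1}(a-b)^2+\sum_{n=0}^\infty\sum_{w\in W_n^\lambda}\sum_{j=1}^{\iota_{n+1}}(\tfrac{15}7)^{m_{n+1}}|c_w^{(j)}|^2\in[0,\infty]$$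 we have $$C_1\,Q\le\mathcal E_{\Omega_\lambda}(u)\le C_2\,Q .$$ In particular, $u$ has finite energy if and only if $Q<\infty$. -/

import Mathlib

open Filter Topology MeasureTheory
open scoped ENNReal NNReal

namespace SG3

/-! ### The level-3 Sierpinski gasket -/

/-- The plane. Only its affine structure and its topology are used. -/
abbrev Plane : Type := ℝ × ℝ

/-- The boundary vertices `q₀`, `q₁`, `q₂`. -/
noncomputable def q : Fin 3 → Plane :=
  ![(1 / √3, 1), (0, 0), (2 / √3, 0)]

/-- The translation parts of the six contractions. -/
noncomputable def shift : Fin 6 → Plane :=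
  ![(2 / 3 : ℝ) • q 0, (2 / 3 : ℝ) • q 1, (2 / 3 : ℝ) • q 2,
    (1 / 3 : ℝ) • (q 1 + q 2), (1 / 3 : ℝ) • (q 0 + q 2), (1 / 3 : ℝ) • (q 0 + q 1)]

/-- The six contractions `F₀, …, F₅` of ratio `1/3`; `F₀, F₁, F₂` fix `q₀, q₁, q₂`. -/
noncomputable def F (i : Fin 6) (z : Plane) : Plane := (1 / 3 : ℝ) • z + shift i

theorem F_lipschitz (i : Fin 6) : LipschitzWith (1 / 3) (F i) := by
  refine LipschitzWith.of_dist_le_mul fun x y => ?_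
  have h : F i x - F i y = (1 / 3 : ℝ) • (x - y) := by
    simp only [F, smul_sub]; abel
  rw [dist_eq_norm, h, norm_smul, dist_eq_norm]
  norm_num

/-- The map `K ↦ ⋃ i, F i K` on nonempty compact sets. -/
noncomputable def hutchinson (K : TopologicalSpace.NonemptyCompacts Plane) :
    TopologicalSpace.NonemptyCompacts Plane where
  carrier := ⋃ i, F i '' K
  isCompact' := isCompact_iUnion fun i => K.isCompact.image (F_lipschitz i).continuous
  nonempty' := by
    obtain ⟨x, hx⟩ := K.nonempty
    exact ⟨F 0 x, Set.mem_iUnion.2 ⟨0, x, hx, rfl⟩⟩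

theorem hutchinson_contracting : ContractingWith (1 / 3) hutchinson := by
  refine ⟨by rw [← NNReal.coe_lt_coe]; norm_num, fun K L => ?_⟩
  have key : ∀ (A B : TopologicalSpace.NonemptyCompacts Plane) (i : Fin 6),
      ∀ x ∈ F i '' (A : Set Plane),
        Metric.infEDist x (F i '' (B : Set Plane)) ≤ ((1 / 3 : ℝ≥0) : ℝ≥0∞) * edist A B := by
    rintro A B i _ ⟨x, hx, rfl⟩
    obtain ⟨y, hy, hxy⟩ := B.isCompact.exists_infEDist_eq_edist B.nonempty x
    calc Metric.infEDist (F i x) (F i '' (B : Set Plane))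
        ≤ edist (F i x) (F i y) := Metric.infEDist_le_edist_of_mem ⟨y, hy, rfl⟩
      _ ≤ ((1 / 3 : ℝ≥0) : ℝ≥0∞) * edist x y := F_lipschitz i x y
      _ ≤ ((1 / 3 : ℝ≥0) : ℝ≥0∞) * edist A B := by
          gcongr
          rw [← hxy]
          exact Metric.infEDist_le_hausdorffEDist_of_mem hx
  have hKL : edist (hutchinson K) (hutchinson L)
      = Metric.hausdorffEDist (⋃ i, F i '' (K : Set Plane)) (⋃ i, F i '' (L : Set Plane)) := rfl
  rw [hKL]
  refine Metric.hausdorffEDist_iUnion_le.trans (iSup_le fun i => ?_)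
  refine Metric.hausdorffEDist_le_of_infEDist (key K L i) fun x hx => ?_
  rw [edist_comm]
  exact key L K i x hx

theorem existsUnique_gasket :
    ∃! K : TopologicalSpace.NonemptyCompacts Plane, (K : Set Plane) = ⋃ i, F i '' (K : Set Plane) := by
  have : Nonempty (TopologicalSpace.NonemptyCompacts Plane) := ⟨{(0 : Plane)}⟩
  refine ⟨ContractingWith.fixedPoint hutchinson hutchinson_contracting, ?_, fun K hK => ?_⟩
  · exact congrArg (fun K : TopologicalSpace.NonemptyCompacts Plane => (K : Set Plane))
      (hutchinson_contracting.fixedPoint_isFixedPt).symm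
  · exact hutchinson_contracting.fixedPoint_unique (SetLike.coe_injective hK.symm)

/-- The gasket: the unique nonempty compact set with `K = ⋃ i, F i K`. -/
noncomputable def gasket : Set Plane := (existsUnique_gasket.choose : Set Plane)

/-- `F_w = F_{w₁} ∘ ⋯ ∘ F_{w_m}` for a word `w = w₁ ⋯ w_m`. -/
noncomputable def Fword (w : List (Fin 6)) : Plane → Plane := w.foldr (fun i g => F i ∘ g) id

/-- The cell `F_w (gasket)`. -/
def cell (w : List (Fin 6)) : Set Plane := Fword w '' gasket

/-! ### Harmonic functions and energy -/

open Classical in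
/-- `u` is harmonic in the (relatively open) set `Ω`: for every level `m` and every `x ∈ Ω` all of
whose `m`-cells lie in `Ω`, the mean value property `∑_{y ∼ₘ x} (u x - u y) = 0` holds (two distinct
`m`-cells share at most one point, so every edge `x ∼ₘ y` belongs to exactly one `m`-cell, and the
sum over edges may be taken cell by cell; it is empty unless `x` is a vertex of level `m`).
Equivalently, `E(u, v) = 0` for all `v` of finite energy that are supported in a finite union of
cells contained in `Ω` and vanish on the boundary of that union. -/
def IsHarmonicOn (Ω : Set Plane) (u : Plane → ℝ) : Prop :=
  ∀ (m : ℕ), ∀ x ∈ Ω, (∀ w : Fin m → Fin 6, x ∈ cell (List.ofFn w) → cell (List.ofFn w) ⊆ Ω) →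
    ∑ w : Fin m → Fin 6, ∑ i : Fin 3,
      (if Fword (List.ofFn w) (q i) = x then
        ∑ j : Fin 3, (u x - u (Fword (List.ofFn w) (q j))) else 0) = 0

/-- The energy, renormalized by `(15/7)^{|w|}`, on the three edges of the cell `F_w (gasket)`. -/
noncomputable def cellEnergy (u : Plane → ℝ) (w : List (Fin 6)) : ℝ :=
  (15 / 7 : ℝ) ^ w.length *
    ((u (Fword w (q 0)) - u (Fword w (q 1))) ^ 2 + (u (Fword w (q 1)) - u (Fword w (q 2))) ^ 2 +
      (u (Fword w (q 2)) - u (Fword w (q 0))) ^ 2)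

open Classical in
/-- The energy of `u` on `Ω`: the limit of the (nondecreasing in `m`) renormalized graph energies
over the `m`-cells contained in `Ω`, with value `∞` allowed. -/
noncomputable def energy (Ω : Set Plane) (u : Plane → ℝ) : ℝ≥0∞ :=
  ⨆ m : ℕ, ∑ w : Fin m → Fin 6,
    if cell (List.ofFn w) ⊆ Ω then ENNReal.ofReal (cellEnergy u (List.ofFn w)) else 0

/-- The normal derivative at `q₀`. -/
noncomputable def normalDeriv (u : Plane → ℝ) : ℝ :=
  limUnder atTop fun m : ℕ =>
    (15 / 7 : ℝ) ^ m * (2 * u (q 0) - u ((F 0)^[m] (q 1)) - u ((F 0)^[m] (q 2)))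

/-! ### Upper domains -/

/-- The upper domain `Ω_λ`. -/
def Om (lam : ℝ) : Set Plane := {z | z ∈ gasket ∧ z ∉ Set.range q ∧ 1 - lam < z.2}

/-- The part `X_λ` of the boundary; the full boundary of `Ω_λ` is `{q₀} ∪ X_λ`. -/
def X (lam : ℝ) : Set Plane := {z | z ∈ gasket ∧ z.2 = 1 - lam}

/-- `u` is continuous on the closure `Ω_λ ∪ {q₀} ∪ X_λ`, harmonic in `Ω_λ`, equal to `a` at `q₀` and
to `f` on `X_λ`. -/
structure IsDirichletSolution (lam : ℝ) (a : ℝ) (f u : Plane → ℝ) : Prop where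
  continuousOn : ContinuousOn u (Om lam ∪ ({q 0} ∪ X lam))
  harmonic : IsHarmonicOn (Om lam) u
  apex : u (q 0) = a
  boundary : ∀ x ∈ X lam, u x = f x

/-- `h₀^λ`: the harmonic function in `Ω_λ` with value `1` at `q₀` and `0` on `X_λ`. -/
noncomputable def h0 (lam : ℝ) : Plane → ℝ :=
  Classical.epsilon fun u => IsDirichletSolution lam 1 (fun _ => 0) u

/-- `η(λ)`, the normal derivative of `h₀^λ` at `q₀`. -/
noncomputable def eta (lam : ℝ) : ℝ := normalDeriv (h0 lam)

/-! ### The ternary expansion of `λ` -/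

/-- `m₁`: the position of the first nonzero digit in the expansion of `λ ∈ (0, 1]` in base `3` with
infinitely many nonzero digits, that is, the `m` with `1 < 3 ^ m * λ ≤ 3`. -/
noncomputable def m1 (lam : ℝ) : ℕ := sInf {m : ℕ | 1 < 3 ^ m * lam}

open Classical in
/-- `ι₁`: the first nonzero digit in that expansion. -/
noncomputable def iota1 (lam : ℝ) : ℕ := if 3 ^ m1 lam * lam ≤ 2 then 1 else 2

/-- `Rλ`: remove the first nonzero digit and shift. -/
noncomputable def R (lam : ℝ) : ℝ := 3 ^ m1 lam * lam - iota1 lam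

/-- `λ_n = R^n λ`. -/
noncomputable def lamSeq (lam : ℝ) (n : ℕ) : ℝ := R^[n] lam

/-- `m_n`, with `m_0 = 0`. -/
noncomputable def mSeq (lam : ℝ) (n : ℕ) : ℕ := ∑ k ∈ Finset.range n, m1 (lamSeq lam k)

/-- `digit λ k` is `ι_{k+1}`. -/
noncomputable def digit (lam : ℝ) (k : ℕ) : ℕ := iota1 (lamSeq lam k)

theorem digit_eq (lam : ℝ) (k : ℕ) : digit lam k = 1 ∨ digit lam k = 2 := by
  unfold digit iota1; split_ifs <;> simp

theorem m1_spec {lam : ℝ} (h0 : 0 < lam) (h1 : lam ≤ 1) :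
    1 ≤ m1 lam ∧ 1 < 3 ^ m1 lam * lam ∧ 3 ^ m1 lam * lam ≤ 3 := by
  have hne : {m : ℕ | 1 < 3 ^ m * lam}.Nonempty := by
    obtain ⟨m, hm⟩ := pow_unbounded_of_one_lt (1 / lam) (by norm_num : (1 : ℝ) < 3)
    exact ⟨m, by rwa [div_lt_iff₀ h0] at hm⟩
  have hmem : 1 < 3 ^ m1 lam * lam := Nat.sInf_mem hne
  have hpos : 1 ≤ m1 lam := by
    by_contra hlt
    have hz : m1 lam = 0 := by omega
    rw [hz] at hmem
    simp at hmem
    linarith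
  refine ⟨hpos, hmem, ?_⟩
  have hnot : m1 lam - 1 ∉ {m : ℕ | 1 < 3 ^ m * lam} :=
    Nat.notMem_of_lt_sInf (show m1 lam - 1 < m1 lam by omega)
  have hle : 3 ^ (m1 lam - 1) * lam ≤ 1 := not_lt.1 hnot
  have hpow : (3 : ℝ) ^ m1 lam = 3 * 3 ^ (m1 lam - 1) := by
    rw [← pow_succ']; congr 1; omega
  rw [hpow]; linarith

theorem R_mem {lam : ℝ} (h0 : 0 < lam) (h1 : lam ≤ 1) : 0 < R lam ∧ R lam ≤ 1 := by
  obtain ⟨_, h2, h3⟩ := m1_spec h0 h1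
  unfold R iota1
  split_ifs with h <;> push_cast <;> constructor <;> linarith

theorem lamSeq_mem {lam : ℝ} (h0 : 0 < lam) (h1 : lam ≤ 1) (n : ℕ) :
    0 < lamSeq lam n ∧ lamSeq lam n ≤ 1 := by
  induction n with
  | zero => exact ⟨h0, h1⟩
  | succ n ih =>
    rw [lamSeq, Function.iterate_succ_apply']
    exact R_mem ih.1 ih.2

theorem mSeq_strictMono {lam : ℝ} (h0 : 0 < lam) (h1 : lam ≤ 1) : StrictMono (mSeq lam) := by
  refine strictMono_nat_of_lt_succ fun n => ?_
  have hn := lamSeq_mem h0 h1 n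
  have := (m1_spec hn.1 hn.2).1
  rw [mSeq, mSeq, Finset.sum_range_succ]
  omega

/-- The sequences `m` and `ι` are those of the representation `λ = ∑ ι_k 3^{-m_k}`. -/
theorem hasSum_expansion {lam : ℝ} (h0 : 0 < lam) (h1 : lam ≤ 1) :
    HasSum (fun k : ℕ => (digit lam k : ℝ) * (1 / 3) ^ mSeq lam (k + 1)) lam := by
  have hpart : ∀ n : ℕ, ∑ k ∈ Finset.range n, (digit lam k : ℝ) * (1 / 3) ^ mSeq lam (k + 1)
      = lam - (1 / 3) ^ mSeq lam n * lamSeq lam n := by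
    intro n
    induction n with
    | zero => simp [mSeq, lamSeq]
    | succ n ih =>
      have hm : mSeq lam (n + 1) = mSeq lam n + m1 (lamSeq lam n) := by
        simp only [mSeq, Finset.sum_range_succ]
      have hR : lamSeq lam (n + 1)
          = 3 ^ m1 (lamSeq lam n) * lamSeq lam n - digit lam n := by
        rw [lamSeq, Function.iterate_succ_apply']; rfl
      have hc : (1 / 3 : ℝ) ^ m1 (lamSeq lam n) * 3 ^ m1 (lamSeq lam n) = 1 := by
        rw [← mul_pow]; norm_num
      rw [Finset.sum_range_succ, ih, hR, hm, pow_add]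
      linear_combination ((1 / 3 : ℝ) ^ mSeq lam n * lamSeq lam n) * hc
  rw [hasSum_iff_tendsto_nat_of_nonneg (fun k => by positivity)]
  simp only [hpart]
  have hz : Tendsto (fun n => (1 / 3 : ℝ) ^ mSeq lam n * lamSeq lam n) atTop (𝓝 0) := by
    have hp : Tendsto (fun n => (1 / 3 : ℝ) ^ mSeq lam n) atTop (𝓝 0) :=
      (tendsto_pow_atTop_nhds_zero_of_lt_one (by norm_num) (by norm_num)).comp
        (mSeq_strictMono h0 h1).tendsto_atTop
    refine squeeze_zero (fun n => ?_) (fun n => ?_) hp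
    · have := (lamSeq_mem h0 h1 n).1; positivity
    · exact mul_le_of_le_one_right (by positivity) (lamSeq_mem h0 h1 n).2
  simpa using hz.const_sub lam

/-! ### Words along the boundary and the measure -/

/-- `S_1 = {4, 5}` and `S_2 = {1, 2, 3}`. -/
def S (k : ℕ) : Finset (Fin 6) := if k = 1 then {4, 5} else {1, 2, 3}

/-- `W^λ_n = S_{ι_1} × ⋯ × S_{ι_n}`. -/
noncomputable def W (lam : ℝ) (n : ℕ) : Finset (Fin n → Fin 6) :=
  Fintype.piFinset fun k : Fin n => S (digit lam k)

/-- The word `0^{m_1 - m_0 - 1} w_1 0^{m_2 - m_1 - 1} w_2 ⋯ 0^{m_n - m_{n-1} - 1} w_n`. -/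
noncomputable def fullWord (lam : ℝ) {n : ℕ} (w : Fin n → Fin 6) : List (Fin 6) :=
  (List.ofFn fun k : Fin n =>
    List.replicate (mSeq lam (k + 1) - mSeq lam k - 1) 0 ++ [w k]).flatten

/-- `F^λ_w = F_0^{m_1 - 1} F_{w_1} ⋯ F_0^{m_n - m_{n-1} - 1} F_{w_n}`. -/
noncomputable def Flam (lam : ℝ) {n : ℕ} (w : Fin n → Fin 6) : Plane → Plane :=
  Fword (fullWord lam w)

/-- `X_w = F^λ_w (gasket) ∩ X`. -/
def Xw (lam : ℝ) {n : ℕ} (w : Fin n → Fin 6) : Set Plane := Flam lam w '' gasket ∩ X lam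

/-- The weights `μ^λ_i`, `i ∈ S_{ι_1}`. -/
noncomputable def weight (lam : ℝ) (i : Fin 6) : ℝ :=
  if iota1 lam = 1 then 1 / 2
  else if i = 3 then (3 + eta (R lam)) / (9 + 2 * eta (R lam))
  else (6 + eta (R lam)) / (18 + 4 * eta (R lam))

/-- The probability measure on symbols that gives mass `μ^λ_i` to `i ∈ S_{ι_1}`. -/
noncomputable def symbolMeasure (lam : ℝ) : Measure (Fin 6) :=
  ∑ i ∈ S (iota1 lam), ENNReal.ofReal (weight lam i) • Measure.dirac i

/-- The point `lim_n F^λ_{s_1 ⋯ s_n} q_0` coded by an infinite word `s`. -/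
noncomputable def coding (lam : ℝ) (s : ℕ → Fin 6) : Plane :=
  limUnder atTop fun n : ℕ => Flam lam (fun k : Fin n => s k) (q 0)

/-- The probability measure `μ^λ` on `X_λ` with `μ^λ(X_w) = ∏_{k ≤ n} μ^{λ_{k-1}}_{w_k}` for
`w ∈ W^λ_n`: the image under the coding map of the corresponding product measure on words. -/
noncomputable def mu (lam : ℝ) : Measure Plane :=
  (Measure.infinitePi fun k : ℕ => symbolMeasure (lamSeq lam k)).map (coding lam)

/-! ### The Haar functions -/

/-- The value of `ψ^{(j),λ}` on `X_i`, for `1 ≤ j ≤ ι_1` and `i ∈ S_{ι_1}`. -/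
noncomputable def haarValue (lam : ℝ) (j : ℕ) (i : Fin 6) : ℝ :=
  if iota1 lam = 1 then (if i = 5 then 1 else -1)
  else if j = 1 then (if i = 1 then 1 else if i = 2 then -1 else 0)
  else (if i = 3 then -2 * weight lam 1 else weight lam 3)

/-- `ψ_w^{(j)} = ψ^{(j),λ_n} ∘ (F^λ_w)⁻¹`, supported in `X_w`, for `w ∈ W^λ_n`: the piecewise constant
function with value `ψ^{(j),λ_n}|_{X_i}` on `X_{wi}`, for `i ∈ S_{ι_{n+1}}`. (If `λ` is a triadic
rational then two of the sets `X_{wi}` can share an end point, a set of measure zero.) -/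
noncomputable def haar (lam : ℝ) {n : ℕ} (w : Fin n → Fin 6) (j : ℕ) (x : Plane) : ℝ :=
  ∑ i ∈ S (digit lam n), haarValue (lamSeq lam n) j i *
    (Xw lam (Fin.snoc (α := fun _ => Fin 6) w i)).indicator (fun _ => (1 : ℝ)) x

/-- The constant term of the Haar expansion. -/
noncomputable def constTerm (lam : ℝ) (f : Plane → ℝ) : ℝ := ∫ x, f x ∂(mu lam)

/-- The Haar coefficient `c_w^{(j)}`. -/
noncomputable def haarCoeff (lam : ℝ) (f : Plane → ℝ) {n : ℕ} (w : Fin n → Fin 6) (j : ℕ) : ℝ :=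
  (∫ x, haar lam w j x ^ 2 ∂(mu lam))⁻¹ * ∫ x, f x * haar lam w j x ∂(mu lam)

/-- The partial sums of the Haar expansion of `f` over words of length less than `N`. -/
noncomputable def haarPartialSum (lam : ℝ) (f : Plane → ℝ) (N : ℕ) (x : Plane) : ℝ :=
  constTerm lam f + ∑ n ∈ Finset.range N, ∑ w ∈ W lam n, ∑ j ∈ Finset.Icc 1 (digit lam n),
    haarCoeff lam f w j * haar lam w j x

/-- `(15/7)^{m_1} (a - b)² + ∑_n ∑_{w ∈ W^λ_n} ∑_{j ≤ ι_{n+1}} (15/7)^{m_{n+1}} |c_w^{(j)}|²`. -/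
noncomputable def haarEnergy (lam : ℝ) (a : ℝ) (f : Plane → ℝ) : ℝ≥0∞ :=
  ENNReal.ofReal ((15 / 7) ^ mSeq lam 1 * (a - constTerm lam f) ^ 2) +
    ∑' n : ℕ, ∑ w ∈ W lam n, ∑ j ∈ Finset.Icc 1 (digit lam n),
      ENNReal.ofReal ((15 / 7) ^ mSeq lam (n + 1) * |haarCoeff lam f w j| ^ 2)

/-- `u` is harmonic in `Ω_λ`, tends to `a` at `q₀`, and has the boundary values `f ∈ L²(X, μ^λ)` in
the `L²` sense: the functions `∑_{w ∈ W^λ_n} u(F^λ_w q₀) χ_{X_w}` (the points `F^λ_w q₀` of `Ω_λ`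
approach `X_w`) converge to `f` in `L²(X, μ^λ)`. -/
structure IsL2Solution (lam : ℝ) (a : ℝ) (f u : Plane → ℝ) : Prop where
  memLp : MemLp f 2 (mu lam)
  harmonic : IsHarmonicOn (Om lam) u
  apex : Tendsto u (𝓝[Om lam] (q 0)) (𝓝 a)
  boundary : Tendsto (fun n : ℕ => eLpNorm (fun x => f x - ∑ w ∈ W lam n,
    u (Flam lam w (q 0)) * (Xw lam w).indicator (fun _ => (1 : ℝ)) x) 2 (mu lam)) atTop (𝓝 0)

end SG3

/-!
# Energy of harmonic functions on upper domains of the level-3 gasket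

Below `q₀`, the domain `Ω_λ` consists of a small network of full cells (one cell if `ι₁ = 1`, three
cells if `ι₁ = 2`), followed by two or three copies of `Ω_{Rλ}`, the branches. By the harmonic
extension rule on a full cell (`FullHarm.ext`, with the renormalization factor `15 / 7`), a harmonic
function is determined by the values at the vertices of these networks, and its energy is the sum of
the energies of the networks (`energy_eq_stages`).

A branch acts on the network above it as a resistor: its conductance `etaT (R λ)` is found by
iterating the map `conduct` on conductances, and the flux of `u` at the top of the branch is the
conductance times the drop from the value `u q₀` to a mean `beta` of the boundary values. Solving the
network equations shows that `beta` is the weighted mean of the means over the branches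
(`Harm.beta_eq`), with the weights of the measure `μ^λ`. The differences of the means of the branches
are the Haar coefficients (`Harm.beta_branch`, `coef_eq`).

The energy estimate is local. For one network, Green's formula gives
`netE + η(Rλ) ∑ dropᵢ² ≤ θ drop² + 6 ∑ coef²` (`Harm.netE_upper`). In the sum over all stages the
terms with drops telescope (`Harm.sum_stageE_le`), which yields the upper bound. Conversely the
coefficients of a stage are controlled by the energies of the networks of this stage and the next
(`coef_sq_le`), and the first drop is controlled by the first network. All constants are universal
(`energy_comparison`).

It remains to identify the means `beta`, which are defined by fluxes, with integrals against `μ^λ`.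
The means below the points `F_w^λ q₀` form a martingale. The drops at these points are bounded by
the increments of the values of `u`, so if these values converge to `f` in `L²` then so does the
martingale, and its terms are the conditional means of `f` (`Harm.integral_step_mul_boundary`).
Hence the partial sums of the Haar expansion are the terms of the martingale
(`HasBoundaryValues.ae_haarPartialSum`). Null sets are dealt with by `ae_coding_mem_Xw`: two of the
sets `X_w` of the same stage meet in corners only.

Two points need a separate argument. The definition of harmonicity does not involve the cells at `q₀`;
a limit of `u` at `q₀` makes `u` harmonic there too, since the recursion for the values along the
sides below `q₀` has one growing mode, which a limit excludes (`IsHarmonicOn.harm`). And `η(λ)` is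
defined through a solution `h₀` of a Dirichlet problem, whose existence is proved by constructing it
from the conductances (`exists_dirichlet`); then `η(λ)` is the limit of conductances (`eta_eq`).
-/

namespace SG3

/-! ### Geometry of the gasket -/

/-- Barycentric coordinates of a point of the plane with respect to `q₀`, `q₁`, `q₂`. -/
noncomputable def bary (z : Plane) : Fin 3 → ℝ :=
  ![z.2, 1 - z.2 - (√3 * z.1 - z.2) / 2, (√3 * z.1 - z.2) / 2]

/-- Three times the barycentric coordinates of the image of the origin of coordinates under `F i`:
the coordinates of `F i z` are those of `z` plus `off i`, divided by three. -/
def off : Fin 6 → Fin 3 → ℝ :=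
  ![![2, 0, 0], ![0, 2, 0], ![0, 0, 2], ![0, 1, 1], ![1, 0, 1], ![1, 1, 0]]

theorem sqrt3_ne : (√3 : ℝ) ≠ 0 := by positivity

theorem bary_F (p : Fin 6) (z : Plane) (a : Fin 3) :
    bary (F p z) a = (bary z a + off p a) / 3 := by
  have h := sqrt3_ne
  fin_cases p <;> fin_cases a <;> simp [bary, F, shift, q, off] <;> field_simp <;> ring

theorem bary_q (a b : Fin 3) : bary (q a) b = if a = b then 1 else 0 := by
  have h := sqrt3_ne
  fin_cases a <;> fin_cases b <;> simp [bary, q] <;> field_simp <;> ring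

theorem bary_inj {z z' : Plane} (h : bary z = bary z') : z = z' := by
  have h0 : z.2 = z'.2 := by simpa [bary] using congrFun h 0
  have h2 : (√3 * z.1 - z.2) / 2 = (√3 * z'.1 - z'.2) / 2 := by simpa [bary] using congrFun h 2
  refine Prod.ext ?_ h0
  have : √3 * z.1 = √3 * z'.1 := by linarith
  exact mul_left_cancel₀ sqrt3_ne this

theorem bary_sum (z : Plane) : bary z 0 + bary z 1 + bary z 2 = 1 := by
  simp only [bary, Matrix.cons_val]; ring

theorem bary_continuous (a : Fin 3) : Continuous fun z => bary z a := by
  fin_cases a <;> simp [bary] <;> fun_prop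

theorem gasket_eq : gasket = ⋃ p, F p '' gasket := existsUnique_gasket.choose_spec.1

theorem gasket_isCompact : IsCompact gasket :=
  (existsUnique_gasket.choose : TopologicalSpace.NonemptyCompacts Plane).isCompact

theorem gasket_nonempty : gasket.Nonempty :=
  (existsUnique_gasket.choose : TopologicalSpace.NonemptyCompacts Plane).nonempty

theorem F_mem (p : Fin 6) {z : Plane} (hz : z ∈ gasket) : F p z ∈ gasket := by
  rw [gasket_eq]; exact Set.mem_iUnion.2 ⟨p, z, hz, rfl⟩

theorem exists_F {z : Plane} (hz : z ∈ gasket) : ∃ p, ∃ z' ∈ gasket, F p z' = z := by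
  rw [gasket_eq] at hz
  obtain ⟨p, z', h, e⟩ := Set.mem_iUnion.1 hz
  exact ⟨p, z', h, e⟩

theorem off_nonneg (p : Fin 6) (a : Fin 3) : 0 ≤ off p a := by
  fin_cases p <;> fin_cases a <;> simp [off]

theorem bary_nonneg {z : Plane} (hz : z ∈ gasket) (a : Fin 3) : 0 ≤ bary z a := by
  -- at a minimum of the coordinate, the preimage under `F p` gives `3 * min ≥ min`
  obtain ⟨y, hy, hmin⟩ :=
    gasket_isCompact.exists_isMinOn gasket_nonempty (bary_continuous a).continuousOn
  obtain ⟨p, y', hy', e⟩ := exists_F hy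
  have h1 : bary y a ≤ bary y' a := hmin hy'
  have h2 := bary_F p y' a
  rw [e] at h2
  have h3 := off_nonneg p a
  have h4 : bary y a ≤ bary z a := hmin hz
  linarith

theorem bary_le_one {z : Plane} (hz : z ∈ gasket) (a : Fin 3) : bary z a ≤ 1 := by
  have := bary_sum z
  have h0 := bary_nonneg hz 0
  have h1 := bary_nonneg hz 1
  have h2 := bary_nonneg hz 2
  fin_cases a <;> simp only [Fin.zero_eta, Fin.mk_one, Fin.reduceFinMk] <;> linarith

theorem eq_q_of_bary {z : Plane} (hz : z ∈ gasket) {a : Fin 3} (h : 1 ≤ bary z a) : z = q a := by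
  apply bary_inj
  have := bary_sum z
  have h0 := bary_nonneg hz 0
  have h1 := bary_nonneg hz 1
  have h2 := bary_nonneg hz 2
  funext b
  rw [bary_q]
  fin_cases a <;> fin_cases b <;>
    simp only [Fin.zero_eta, Fin.mk_one, Fin.reduceFinMk, Fin.isValue, Fin.reduceEq, if_true,
      if_false]
      at h ⊢ <;> linarith

/-- The index of the contraction that fixes `q a`. -/
def cr (a : Fin 3) : Fin 6 := Fin.castLE (by decide) a

@[simp] theorem cr_zero : cr 0 = 0 := rfl
@[simp] theorem cr_one : cr 1 = 1 := rfl
@[simp] theorem cr_two : cr 2 = 2 := rfl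

theorem cr_injective : Function.Injective cr := Fin.castLE_injective (by decide)

@[simp] theorem F_cr (a : Fin 3) : F (cr a) (q a) = q a := by
  apply bary_inj
  funext b
  rw [bary_F, bary_q]
  fin_cases a <;> fin_cases b <;> simp [off, cr] <;> norm_num

theorem q_mem (a : Fin 3) : q a ∈ gasket := by
  obtain ⟨y, hy, hmax⟩ :=
    gasket_isCompact.exists_isMaxOn gasket_nonempty (bary_continuous a).continuousOn
  have h1 : bary (F (cr a) y) a ≤ bary y a := hmax (F_mem (cr a) hy)
  -- at a maximum `y` of the coordinate, `F (cr a) y` has coordinate `(bary y a + 2) / 3`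
  rw [bary_F] at h1
  have h2 : off (cr a) a = 2 := by fin_cases a <;> simp [off, cr]
  rw [h2] at h1
  rw [← eq_q_of_bary hy (a := a) (by linarith)]
  exact hy

/-- The inverse of `F p`. -/
noncomputable def G (p : Fin 6) (z : Plane) : Plane := (3 : ℝ) • (z - shift p)

@[simp] theorem F_G (p : Fin 6) (z : Plane) : F p (G p z) = z := by
  simp [F, G, smul_smul]

@[simp] theorem G_F (p : Fin 6) (z : Plane) : G p (F p z) = z := by
  simp [F, G, smul_smul]

theorem F_eq_iff {p : Fin 6} {z x : Plane} : F p z = x ↔ z = G p x :=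
  ⟨fun h => by rw [← h, G_F], fun h => by rw [h, F_G]⟩

theorem F_injective (p : Fin 6) : Function.Injective (F p) := fun x y h => by
  rw [← G_F p x, h, G_F]

theorem bary_G (p : Fin 6) (z : Plane) (a : Fin 3) : bary (G p z) a = 3 * bary z a - off p a := by
  have := bary_F p (G p z) a
  rw [F_G] at this
  linarith

/-- A corner of the gasket lies in one cell of level one only, and is the same corner of that cell. -/
theorem eq_of_F_eq_q {p : Fin 6} {z : Plane} (hz : z ∈ gasket) {a : Fin 3} (h : F p z = q a) :
    p = cr a ∧ z = q a := by
  have h1 := bary_F p z a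
  rw [h, bary_q, if_pos rfl] at h1
  have h2 := bary_le_one hz a
  have h3 : off p a = 2 ∨ off p a ≤ 1 := by
    fin_cases p <;> fin_cases a <;> simp [off]
  have h4 : off p a = 2 := by
    rcases h3 with h3 | h3
    · exact h3
    · linarith
  refine ⟨?_, eq_q_of_bary hz (by linarith)⟩
  fin_cases p <;> fin_cases a <;> simp [off, cr] at h4 ⊢

/-- Two cells of level one can only meet in corners: two different vectors `off p`, `off p'` differ by
at least one in some coordinate in either direction, while barycentric coordinates range over
`[0, 1]`. -/
theorem exists_corner_of_F_eq {p p' : Fin 6} (hp : p ≠ p') {z z' : Plane} (hz : z ∈ gasket)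
    (hz' : z' ∈ gasket) (h : F p z = F p' z') : ∃ a b, z = q a ∧ z' = q b := by
  have key : ∀ p p' : Fin 6, p ≠ p' → ∃ a, off p a + 1 ≤ off p' a := by
    intro p p' h
    fin_cases p <;> fin_cases p' <;>
      first
      | exact absurd rfl h
      | (refine ⟨0, ?_⟩; (simp [off] <;> norm_num); done)
      | (refine ⟨1, ?_⟩; (simp [off] <;> norm_num); done)
      | (refine ⟨2, ?_⟩; simp [off] <;> norm_num)
  have hb : ∀ a, bary z a + off p a = bary z' a + off p' a := fun a => by
    have h1 := bary_F p z a
    have h2 := bary_F p' z' a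
    rw [h] at h1
    linarith
  obtain ⟨a, ha⟩ := key p p' hp
  obtain ⟨b, hb'⟩ := key p' p hp.symm
  refine ⟨a, b, eq_q_of_bary hz ?_, eq_q_of_bary hz' ?_⟩
  · have := hb a; have := bary_nonneg hz' a; linarith
  · have := hb b; have := bary_nonneg hz b; linarith

/-- The points of the gasket other than `q₀`, `q₁`, `q₂`. -/
def Inner (x : Plane) : Prop := x ∈ gasket ∧ x ∉ Set.range q

theorem Inner.F {x : Plane} (hx : Inner x) (p : Fin 6) : Inner (F p x) := by
  refine ⟨F_mem p hx.1, ?_⟩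
  rintro ⟨a, ha⟩
  exact hx.2 ⟨a, (eq_of_F_eq_q hx.1 ha.symm).2.symm⟩

theorem Inner.G_notMem {x : Plane} (hx : Inner x) {p p' : Fin 6} (h : p' ≠ p) :
    G p' (SG3.F p x) ∉ gasket := fun hm => by
  obtain ⟨a, -, ha, -⟩ := exists_corner_of_F_eq h.symm hx.1 hm (F_G p' _).symm
  exact hx.2 ⟨a, ha.symm⟩

theorem G_q_notMem {p : Fin 6} {a : Fin 3} (h : p ≠ cr a) : G p (q a) ∉ gasket := fun hm =>
  h (eq_of_F_eq_q hm (F_G p _)).1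

@[simp] theorem G_cr (a : Fin 3) : G (cr a) (q a) = q a := by
  rw [← F_eq_iff.1 (F_cr a)]

theorem notMem_of_bary_neg {z : Plane} {a : Fin 3} (h : bary z a < 0) : z ∉ gasket := fun hz =>
  absurd (bary_nonneg hz a) (not_le.2 h)

/-- `1 - y` is the depth below `q₀`; `F p` maps depth `d` to `(d + dp p) / 3`. -/
def dp : Fin 6 → ℝ := ![0, 2, 2, 2, 1, 1]

theorem depth_F (p : Fin 6) (z : Plane) : 1 - (F p z).2 = (1 - z.2 + dp p) / 3 := by
  have h : (F p z).2 = (z.2 + off p 0) / 3 := by simpa [bary] using bary_F p z 0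
  have h2 : dp p = 2 - off p 0 := by fin_cases p <;> simp [dp, off] <;> norm_num
  rw [h, h2]; ring

theorem depth_nonneg {z : Plane} (hz : z ∈ gasket) : 0 ≤ 1 - z.2 := by
  have := bary_le_one hz 0
  simp [bary] at this; linarith

theorem depth_le_one {z : Plane} (hz : z ∈ gasket) : 1 - z.2 ≤ 1 := by
  have := bary_nonneg hz 0
  simp [bary] at this; linarith

theorem dp_nonneg (p : Fin 6) : 0 ≤ dp p := by fin_cases p <;> simp [dp]

theorem dp_le_two (p : Fin 6) : dp p ≤ 2 := by fin_cases p <;> simp [dp]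

/-! ### Junctions of the first level -/

theorem junction_left : F 5 (q 0) = F 0 (q 1) := by
  apply bary_inj; funext b; simp only [bary_F, bary_q]; fin_cases b <;> simp [off] <;> norm_num
theorem junction_right : F 4 (q 0) = F 0 (q 2) := by
  apply bary_inj; funext b; simp only [bary_F, bary_q]; fin_cases b <;> simp [off] <;> norm_num
theorem junction_left' : F 1 (q 0) = F 5 (q 1) := by
  apply bary_inj; funext b; simp only [bary_F, bary_q]; fin_cases b <;> simp [off] <;> norm_num
theorem junction_right' : F 2 (q 0) = F 4 (q 2) := by
  apply bary_inj; funext b; simp only [bary_F, bary_q]; fin_cases b <;> simp [off] <;> norm_num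
theorem junction_bot_left : F 3 (q 1) = F 1 (q 2) := by
  apply bary_inj; funext b; simp only [bary_F, bary_q]; fin_cases b <;> simp [off] <;> norm_num
theorem junction_bot_right : F 3 (q 2) = F 2 (q 1) := by
  apply bary_inj; funext b; simp only [bary_F, bary_q]; fin_cases b <;> simp [off] <;> norm_num
theorem junction_center : F 5 (q 2) = F 3 (q 0) := by
  apply bary_inj; funext b; simp only [bary_F, bary_q]; fin_cases b <;> simp [off]
theorem junction_center' : F 4 (q 1) = F 3 (q 0) := by
  apply bary_inj; funext b; simp only [bary_F, bary_q]; fin_cases b <;> simp [off]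

/-- An inner point lies in the interior of a cell of level one, or is one of the seven junctions. -/
theorem Inner.cases {x : Plane} (hx : Inner x) :
    (∃ p x', Inner x' ∧ x = SG3.F p x') ∨ x = SG3.F 0 (q 1) ∨ x = SG3.F 0 (q 2) ∨
      x = SG3.F 5 (q 1) ∨ x = SG3.F 4 (q 2) ∨ x = SG3.F 1 (q 2) ∨ x = SG3.F 2 (q 1) ∨ x = SG3.F 3 (q 0) := by
  obtain ⟨p, x', hx', rfl⟩ := exists_F hx.1
  by_cases hc : x' ∈ Set.range q
  · right
    obtain ⟨a, rfl⟩ := hc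
    have h2 := hx.2
    have e0 := F_cr 0
    have e1 := F_cr 1
    have e2 := F_cr 2
    simp only [cr_zero, cr_one, cr_two] at e0 e1 e2
    fin_cases p <;> fin_cases a <;>
      simp only [Fin.zero_eta, Fin.mk_one, Fin.reduceFinMk, Fin.isValue, junction_left,
        junction_right, junction_left', junction_right', junction_bot_left, junction_bot_right, junction_center,
        junction_center', e0, e1, e2, Set.mem_range_self, not_true_eq_false] at h2 ⊢ <;> tauto
  · exact Or.inl ⟨p, x', ⟨hx', hc⟩, rfl⟩

/-! ### The graph Laplacian and harmonicity -/

open Classical in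
/-- The graph Laplacian of level `m` at `x`, by recursion on the first letter of the words. A cell
`F p` that does not contain `x` contributes nothing, since `G p x` is then outside the gasket. -/
noncomputable def lap : ℕ → (Plane → ℝ) → Plane → ℝ
  | 0, u, x => ∑ i : Fin 3, if q i = x then ∑ j : Fin 3, (u x - u (q j)) else 0
  | m + 1, u, x => ∑ p : Fin 6, lap m (u ∘ F p) (G p x)

/-- All cells of level `m` containing `x` lie at depth less than `lam`. -/
def Adm : ℕ → ℝ → Plane → Prop
  | 0, lam, x => x ∈ gasket → 1 < lam
  | m + 1, lam, x => ∀ p, Adm m (3 * lam - dp p) (G p x)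

theorem Fword_cons (p : Fin 6) (w : List (Fin 6)) (z : Plane) :
    Fword (p :: w) z = F p (Fword w z) := rfl

@[simp] theorem Fword_nil (z : Plane) : Fword [] z = z := rfl

theorem Fword_append (v w : List (Fin 6)) (z : Plane) :
    Fword (v ++ w) z = Fword v (Fword w z) := by
  induction v with
  | nil => rfl
  | cons p v ih => rw [List.cons_append, Fword_cons, ih, Fword_cons]

theorem Fword_mem (w : List (Fin 6)) {z : Plane} (hz : z ∈ gasket) : Fword w z ∈ gasket := by
  induction w with
  | nil => exact hz
  | cons p v ih => exact F_mem p ih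

theorem Fword_injective (w : List (Fin 6)) : Function.Injective (Fword w) := by
  induction w with
  | nil => exact fun _ _ h => h
  | cons p v ih => exact (F_injective p).comp ih

theorem mem_cell_cons {p : Fin 6} {w : List (Fin 6)} {x : Plane} :
    x ∈ cell (p :: w) ↔ G p x ∈ cell w := by
  constructor
  · rintro ⟨z, hz, rfl⟩
    exact ⟨z, hz, by rw [Fword_cons, G_F]⟩
  · rintro ⟨z, hz, h⟩
    exact ⟨z, hz, by rw [Fword_cons, h, F_G]⟩

theorem mem_cell_nil {x : Plane} : x ∈ cell [] ↔ x ∈ gasket :=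
  ⟨by rintro ⟨z, hz, rfl⟩; exact hz, fun h => ⟨x, h, rfl⟩⟩

theorem cell_subset_gasket (w : List (Fin 6)) : cell w ⊆ gasket := by
  rintro _ ⟨z, hz, rfl⟩; exact Fword_mem w hz

/-- Sums over words of length `m + 1`, split according to the first letter. -/
theorem sum_word_succ {M : Type*} [AddCommMonoid M] (m : ℕ) (g : List (Fin 6) → M) :
    ∑ w : Fin (m + 1) → Fin 6, g (List.ofFn w)
      = ∑ p : Fin 6, ∑ w : Fin m → Fin 6, g (p :: List.ofFn w) := by
  rw [← Fintype.sum_prod_type' (f := fun (p : Fin 6) (w : Fin m → Fin 6) => g (p :: List.ofFn w))]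
  refine (Fintype.sum_equiv (Fin.consEquiv fun _ => Fin 6) _ _ fun x => ?_).symm
  simp [Fin.consEquiv, List.ofFn_succ]

theorem forall_word_succ {m : ℕ} {g : List (Fin 6) → Prop} :
    (∀ w : Fin (m + 1) → Fin 6, g (List.ofFn w))
      ↔ ∀ p : Fin 6, ∀ w : Fin m → Fin 6, g (p :: List.ofFn w) := by
  constructor
  · intro h p w
    simpa [List.ofFn_succ] using h (Fin.cons p w)
  · intro h w
    rw [List.ofFn_succ]
    exact h _ _

open Classical in
/-- `lap` is the sum in the definition of `IsHarmonicOn`. -/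
theorem sum_eq_lap (m : ℕ) (u : Plane → ℝ) (x : Plane) :
    ∑ w : Fin m → Fin 6, ∑ i : Fin 3,
      (if Fword (List.ofFn w) (q i) = x then
        ∑ j : Fin 3, (u x - u (Fword (List.ofFn w) (q j))) else 0) = lap m u x := by
  induction m generalizing u x with
  | zero => simp [lap]
  | succ m ih =>
    rw [sum_word_succ m fun l => ∑ i : Fin 3,
      (if Fword l (q i) = x then ∑ j : Fin 3, (u x - u (Fword l (q j))) else 0)]
    rw [lap]
    refine Finset.sum_congr rfl fun p _ => ?_
    rw [← ih]
    simp only [Fword_cons, F_eq_iff, Function.comp, F_G]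

theorem adm_iff {m : ℕ} {lam : ℝ} {x : Plane} :
    Adm m lam x ↔ ∀ w : Fin m → Fin 6, x ∈ cell (List.ofFn w) →
      ∀ z ∈ cell (List.ofFn w), 1 - z.2 < lam := by
  induction m generalizing lam x with
  | zero =>
    constructor
    · intro h w hx z hz
      simp only [List.ofFn_zero, mem_cell_nil] at hx hz
      exact (depth_le_one hz).trans_lt (h hx)
    · intro h hx
      have := h Fin.elim0 (by simpa [mem_cell_nil] using hx) (q 1)
        (by simpa [mem_cell_nil] using q_mem 1)
      simpa [q] using this
  | succ m ih =>
    rw [forall_word_succ (g := fun l => x ∈ cell l → ∀ z ∈ cell l, 1 - z.2 < lam), Adm]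
    refine forall_congr' fun p => ?_
    rw [ih]
    refine forall_congr' fun w => ?_
    rw [mem_cell_cons]
    refine imp_congr_right fun _ => ⟨fun h z hz => ?_, fun h z hz => ?_⟩
    · have h1 := h (G p z) (mem_cell_cons.1 hz)
      have h2 := depth_F p (G p z)
      rw [F_G] at h2
      linarith
    · have h1 := h (F p z) (mem_cell_cons.2 (by rwa [G_F]))
      have h2 := depth_F p z
      linarith

theorem lap_of_notMem {m : ℕ} (u : Plane → ℝ) {x : Plane} (hx : x ∉ gasket) : lap m u x = 0 := by
  induction m generalizing u x with
  | zero =>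
    refine Finset.sum_eq_zero fun i _ => if_neg ?_
    rintro rfl; exact hx (q_mem i)
  | succ m ih =>
    refine Finset.sum_eq_zero fun p _ => ih _ fun h => hx ?_
    rw [← F_G p x]; exact F_mem p h

theorem lap_zero_inner (u : Plane → ℝ) {x : Plane} (hx : Inner x) : lap 0 u x = 0 :=
  Finset.sum_eq_zero fun i _ => if_neg fun h => hx.2 ⟨i, h⟩

theorem lap_congr {m : ℕ} {u v : Plane → ℝ} (h : ∀ z ∈ gasket, u z = v z) (x : Plane) :
    lap m u x = lap m v x := by
  induction m generalizing u v x with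
  | zero =>
    refine Finset.sum_congr rfl fun i _ => ?_
    split_ifs with hi
    · subst hi; simp only [h _ (q_mem _)]
    · rfl
  | succ m ih =>
    exact Finset.sum_congr rfl fun p _ => ih (fun z hz => h _ (F_mem p hz)) _

theorem lap_F_inner (m : ℕ) (u : Plane → ℝ) (p : Fin 6) {x : Plane} (hx : Inner x) :
    lap (m + 1) u (F p x) = lap m (u ∘ F p) x := by
  rw [lap, Finset.sum_eq_single p, G_F]
  · exact fun p' _ h => lap_of_notMem _ (hx.G_notMem h)
  · simp

theorem lap_corner (m : ℕ) (u : Plane → ℝ) (a : Fin 3) :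
    lap (m + 1) u (q a) = lap m (u ∘ F (cr a)) (q a) := by
  rw [lap, Finset.sum_eq_single (cr a), G_cr]
  · exact fun p' _ h => lap_of_notMem _ (G_q_notMem h)
  · simp

theorem lap_zero_corner (u : Plane → ℝ) (a : Fin 3) :
    lap 0 u (q a) = (u (q a) - u (q 0)) + (u (q a) - u (q 1)) + (u (q a) - u (q 2)) := by
  have hq : ∀ i j, q i = q j ↔ i = j := fun i j => by
    refine ⟨fun h => ?_, fun h => h ▸ rfl⟩
    have := bary_q i i
    rw [h, bary_q] at this
    by_contra hne
    rw [if_neg fun e => hne e.symm, if_pos rfl] at this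
    norm_num at this
  simp only [lap, hq, Finset.sum_ite_eq', Finset.mem_univ, if_true, Fin.sum_univ_three]

theorem adm_of_notMem {m : ℕ} {lam : ℝ} {x : Plane} (hx : x ∉ gasket) : Adm m lam x := by
  induction m generalizing lam x with
  | zero => exact fun h => absurd h hx
  | succ m ih =>
    exact fun p => ih fun h => hx (by rw [← F_G p x]; exact F_mem p h)

theorem adm_F_inner {m : ℕ} {lam : ℝ} {p : Fin 6} {x : Plane} (hx : Inner x) :
    Adm (m + 1) lam (F p x) ↔ Adm m (3 * lam - dp p) x := by
  constructor
  · intro h; simpa using h p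
  · intro h p'
    by_cases hp : p' = p
    · subst hp; simpa using h
    · exact adm_of_notMem (hx.G_notMem hp)

theorem adm_corner {m : ℕ} {lam : ℝ} {a : Fin 3} :
    Adm (m + 1) lam (q a) ↔ Adm m (3 * lam - dp (cr a)) (q a) := by
  constructor
  · intro h; simpa using h (cr a)
  · intro h p'
    by_cases hp : p' = cr a
    · subst hp; simpa using h
    · exact adm_of_notMem (G_q_notMem hp)

theorem adm_top {m : ℕ} {lam : ℝ} : Adm m lam (q 0) ↔ 1 < 3 ^ m * lam := by
  induction m generalizing lam with
  | zero => simp [Adm, q_mem]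
  | succ m ih =>
    rw [adm_corner, ih, pow_succ, mul_assoc]; simp [dp]

theorem adm_bot {m : ℕ} {lam : ℝ} {a : Fin 3} (ha : a ≠ 0) : Adm m lam (q a) ↔ 1 < lam := by
  have hd : dp (cr a) = 2 := by fin_cases a <;> simp [dp] at ha ⊢
  induction m generalizing lam with
  | zero => simp [Adm, q_mem]
  | succ m ih =>
    exact adm_corner.trans (ih.trans (by rw [hd]; constructor <;> intro h <;> linarith))

theorem adm_of_one_lt {m : ℕ} {lam : ℝ} (h : 1 < lam) (x : Plane) : Adm m lam x := by
  induction m generalizing lam x with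
  | zero => exact fun _ => h
  | succ m ih => exact fun p => ih (by have := dp_le_two p; linarith) _

/-- `u` is harmonic at depth less than `lam`, with the cells at `q₀` included. For `1 < lam` the
domain is the whole gasket. -/
def Harm (lam : ℝ) (u : Plane → ℝ) : Prop :=
  ∀ m x, Inner x → Adm m lam x → lap m u x = 0

theorem Harm.comp {lam : ℝ} {u : Plane → ℝ} (h : Harm lam u) (p : Fin 6) :
    Harm (3 * lam - dp p) (u ∘ F p) := fun m x hx ha => by
  rw [← lap_F_inner m u p hx]
  exact h _ _ (hx.F p) ((adm_F_inner hx).2 ha)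

/-- If the domain is the whole gasket then the depth does not matter. -/
theorem Harm.mono {lam lam' : ℝ} {u : Plane → ℝ} (h : Harm lam u) (hl : 1 < lam) : Harm lam' u :=
  fun m x hx _ => h m x hx (adm_of_one_lt hl x)

/-- Harmonic functions on the whole gasket. -/
abbrev FullHarm (u : Plane → ℝ) : Prop := Harm 2 u

theorem FullHarm.comp {u : Plane → ℝ} (h : FullHarm u) (p : Fin 6) : FullHarm (u ∘ F p) :=
  (Harm.comp h p).mono (by have := dp_le_two p; linarith)

/-! ### The Laplacian at the junctions of the first level -/

theorem inner_F_q {p : Fin 6} {a : Fin 3} (h : p ≠ cr a) : Inner (F p (q a)) := by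
  refine ⟨F_mem p (q_mem a), ?_⟩
  rintro ⟨b, hb⟩
  obtain ⟨h1, h2⟩ := eq_of_F_eq_q (q_mem a) hb.symm
  have h3 := congrFun (congrArg bary h2) a
  rw [bary_q, bary_q, if_pos rfl] at h3
  by_cases hab : b = a
  · exact h (hab ▸ h1)
  · rw [if_neg hab] at h3; norm_num at h3

theorem forall_fin6 {Q : Fin 6 → Prop} : (∀ p, Q p) ↔ Q 0 ∧ Q 1 ∧ Q 2 ∧ Q 3 ∧ Q 4 ∧ Q 5 := by
  constructor
  · intro h; exact ⟨h 0, h 1, h 2, h 3, h 4, h 5⟩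
  · rintro ⟨h0, h1, h2, h3, h4, h5⟩ p
    fin_cases p <;> assumption

theorem G_notMem_of {p p' : Fin 6} {a : Fin 3} (b : Fin 3)
    (h : 3 * ((bary (q a) b + off p b) / 3) - off p' b < 0) : G p' (F p (q a)) ∉ gasket :=
  notMem_of_bary_neg (a := b) (by rw [bary_G, bary_F]; exact h)

theorem G_junction_left :
    G 5 (F 0 (q 1)) = q 0 ∧ ∀ p, p ≠ 0 → p ≠ 5 → G p (F 0 (q 1)) ∉ gasket := by
  refine ⟨by rw [← junction_left, G_F], forall_fin6.2 ?_⟩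
  refine ⟨by simp, fun _ _ => G_notMem_of 1 ?_, fun _ _ => G_notMem_of 2 ?_,
    fun _ _ => G_notMem_of 2 ?_, fun _ _ => G_notMem_of 2 ?_, by simp⟩ <;> simp [bary_q, off]

theorem G_junction_right :
    G 4 (F 0 (q 2)) = q 0 ∧ ∀ p, p ≠ 0 → p ≠ 4 → G p (F 0 (q 2)) ∉ gasket := by
  refine ⟨by rw [← junction_right, G_F], forall_fin6.2 ?_⟩
  refine ⟨by simp, fun _ _ => G_notMem_of 1 ?_, fun _ _ => G_notMem_of 2 ?_,
    fun _ _ => G_notMem_of 1 ?_, by simp, fun _ _ => G_notMem_of 1 ?_⟩ <;> simp [bary_q, off]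

theorem G_junction_left' :
    G 1 (F 5 (q 1)) = q 0 ∧ ∀ p, p ≠ 5 → p ≠ 1 → G p (F 5 (q 1)) ∉ gasket := by
  refine ⟨by rw [← junction_left', G_F], forall_fin6.2 ?_⟩
  refine ⟨fun _ _ => G_notMem_of 0 ?_, by simp, fun _ _ => G_notMem_of 2 ?_,
    fun _ _ => G_notMem_of 2 ?_, fun _ _ => G_notMem_of 2 ?_, by simp⟩ <;> simp [bary_q, off]

theorem G_junction_right' :
    G 2 (F 4 (q 2)) = q 0 ∧ ∀ p, p ≠ 4 → p ≠ 2 → G p (F 4 (q 2)) ∉ gasket := by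
  refine ⟨by rw [← junction_right', G_F], forall_fin6.2 ?_⟩
  refine ⟨fun _ _ => G_notMem_of 0 ?_, fun _ _ => G_notMem_of 1 ?_, by simp,
    fun _ _ => G_notMem_of 1 ?_, by simp, fun _ _ => G_notMem_of 1 ?_⟩ <;> simp [bary_q, off]

theorem G_junction_bot_left :
    G 3 (F 1 (q 2)) = q 1 ∧ ∀ p, p ≠ 1 → p ≠ 3 → G p (F 1 (q 2)) ∉ gasket := by
  refine ⟨by rw [← junction_bot_left, G_F], forall_fin6.2 ?_⟩
  refine ⟨fun _ _ => G_notMem_of 0 ?_, by simp, fun _ _ => G_notMem_of 2 ?_,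
    by simp, fun _ _ => G_notMem_of 0 ?_, fun _ _ => G_notMem_of 0 ?_⟩ <;> simp [bary_q, off]

theorem G_junction_bot_right :
    G 3 (F 2 (q 1)) = q 2 ∧ ∀ p, p ≠ 2 → p ≠ 3 → G p (F 2 (q 1)) ∉ gasket := by
  refine ⟨by rw [← junction_bot_right, G_F], forall_fin6.2 ?_⟩
  refine ⟨fun _ _ => G_notMem_of 0 ?_, fun _ _ => G_notMem_of 1 ?_, by simp,
    by simp, fun _ _ => G_notMem_of 0 ?_, fun _ _ => G_notMem_of 0 ?_⟩ <;> simp [bary_q, off]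

theorem G_junction_center : G 5 (F 3 (q 0)) = q 2 ∧ G 4 (F 3 (q 0)) = q 1 ∧
    ∀ p, p ≠ 3 → p ≠ 4 → p ≠ 5 → G p (F 3 (q 0)) ∉ gasket := by
  refine ⟨by rw [← junction_center, G_F], by rw [← junction_center', G_F], forall_fin6.2 ?_⟩
  refine ⟨fun _ _ _ => G_notMem_of 0 ?_, fun _ _ _ => G_notMem_of 1 ?_,
    fun _ _ _ => G_notMem_of 2 ?_, by simp, by simp, by simp⟩ <;> simp [bary_q, off]

theorem lap_two_cells {m : ℕ} {u : Plane → ℝ} {x : Plane} {p p' : Fin 6} (hpp : p ≠ p')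
    (h : ∀ r, r ≠ p → r ≠ p' → G r x ∉ gasket) :
    lap (m + 1) u x = lap m (u ∘ F p) (G p x) + lap m (u ∘ F p') (G p' x) := by
  rw [lap, ← Finset.sum_subset (Finset.subset_univ {p, p'}), Finset.sum_pair hpp]
  intro r _ hr
  simp only [Finset.mem_insert, Finset.mem_singleton, not_or] at hr
  exact lap_of_notMem _ (h r hr.1 hr.2)

theorem adm_two_cells {m : ℕ} {lam : ℝ} {x : Plane} {p p' : Fin 6}
    (h : ∀ r, r ≠ p → r ≠ p' → G r x ∉ gasket) :
    Adm (m + 1) lam x ↔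
      Adm m (3 * lam - dp p) (G p x) ∧ Adm m (3 * lam - dp p') (G p' x) := by
  refine ⟨fun H => ⟨H p, H p'⟩, fun H r => ?_⟩
  by_cases h1 : r = p
  · subst h1; exact H.1
  by_cases h2 : r = p'
  · subst h2; exact H.2
  exact adm_of_notMem (h r h1 h2)

section junctions
variable (m : ℕ) (u : Plane → ℝ) (lam : ℝ)

theorem lap_left : lap (m + 1) u (F 0 (q 1))
    = lap m (u ∘ F 0) (q 1) + lap m (u ∘ F 5) (q 0) := by
  rw [lap_two_cells (by decide) G_junction_left.2, G_F, G_junction_left.1]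
theorem lap_right : lap (m + 1) u (F 0 (q 2))
    = lap m (u ∘ F 0) (q 2) + lap m (u ∘ F 4) (q 0) := by
  rw [lap_two_cells (by decide) G_junction_right.2, G_F, G_junction_right.1]
theorem lap_left' : lap (m + 1) u (F 5 (q 1))
    = lap m (u ∘ F 5) (q 1) + lap m (u ∘ F 1) (q 0) := by
  rw [lap_two_cells (by decide) G_junction_left'.2, G_F, G_junction_left'.1]
theorem lap_right' : lap (m + 1) u (F 4 (q 2))
    = lap m (u ∘ F 4) (q 2) + lap m (u ∘ F 2) (q 0) := by
  rw [lap_two_cells (by decide) G_junction_right'.2, G_F, G_junction_right'.1]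
theorem lap_bot_left : lap (m + 1) u (F 1 (q 2))
    = lap m (u ∘ F 1) (q 2) + lap m (u ∘ F 3) (q 1) := by
  rw [lap_two_cells (by decide) G_junction_bot_left.2, G_F, G_junction_bot_left.1]
theorem lap_bot_right : lap (m + 1) u (F 2 (q 1))
    = lap m (u ∘ F 2) (q 1) + lap m (u ∘ F 3) (q 2) := by
  rw [lap_two_cells (by decide) G_junction_bot_right.2, G_F, G_junction_bot_right.1]
theorem lap_center : lap (m + 1) u (F 3 (q 0))
    = lap m (u ∘ F 3) (q 0) + lap m (u ∘ F 4) (q 1) + lap m (u ∘ F 5) (q 2) := by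
  obtain ⟨h1, h2, h3⟩ := G_junction_center
  rw [lap, Fin.sum_univ_six, lap_of_notMem _ (h3 0 (by decide) (by decide) (by decide)),
    lap_of_notMem _ (h3 1 (by decide) (by decide) (by decide)),
    lap_of_notMem _ (h3 2 (by decide) (by decide) (by decide)), G_F, h1, h2]
  ring

theorem adm_left : Adm (m + 1) lam (F 0 (q 1))
    ↔ Adm m (3 * lam - dp 0) (q 1) ∧ Adm m (3 * lam - dp 5) (q 0) := by
  rw [adm_two_cells G_junction_left.2, G_F, G_junction_left.1]
theorem adm_right : Adm (m + 1) lam (F 0 (q 2))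
    ↔ Adm m (3 * lam - dp 0) (q 2) ∧ Adm m (3 * lam - dp 4) (q 0) := by
  rw [adm_two_cells G_junction_right.2, G_F, G_junction_right.1]
theorem adm_left' : Adm (m + 1) lam (F 5 (q 1))
    ↔ Adm m (3 * lam - dp 5) (q 1) ∧ Adm m (3 * lam - dp 1) (q 0) := by
  rw [adm_two_cells G_junction_left'.2, G_F, G_junction_left'.1]
theorem adm_right' : Adm (m + 1) lam (F 4 (q 2))
    ↔ Adm m (3 * lam - dp 4) (q 2) ∧ Adm m (3 * lam - dp 2) (q 0) := by
  rw [adm_two_cells G_junction_right'.2, G_F, G_junction_right'.1]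
theorem adm_bot_left : Adm (m + 1) lam (F 1 (q 2))
    ↔ Adm m (3 * lam - dp 1) (q 2) ∧ Adm m (3 * lam - dp 3) (q 1) := by
  rw [adm_two_cells G_junction_bot_left.2, G_F, G_junction_bot_left.1]
theorem adm_bot_right : Adm (m + 1) lam (F 2 (q 1))
    ↔ Adm m (3 * lam - dp 2) (q 1) ∧ Adm m (3 * lam - dp 3) (q 2) := by
  rw [adm_two_cells G_junction_bot_right.2, G_F, G_junction_bot_right.1]
theorem adm_center : Adm (m + 1) lam (F 3 (q 0))
    ↔ Adm m (3 * lam - dp 3) (q 0) ∧ Adm m (3 * lam - dp 4) (q 1) ∧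
      Adm m (3 * lam - dp 5) (q 2) := by
  obtain ⟨h1, h2, h3⟩ := G_junction_center
  refine ⟨fun H => ⟨by simpa using H 3, by simpa [h2] using H 4, by simpa [h1] using H 5⟩,
    fun H => forall_fin6.2 ?_⟩
  rw [G_F, h1, h2]
  exact ⟨adm_of_notMem (h3 0 (by decide) (by decide) (by decide)),
    adm_of_notMem (h3 1 (by decide) (by decide) (by decide)),
    adm_of_notMem (h3 2 (by decide) (by decide) (by decide)), H.1, H.2.1, H.2.2⟩

end junctions

/-! ### Harmonic functions on the whole gasket -/

/-- The values of a harmonic function at the vertices of the first level. -/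
structure Ext (u : Plane → ℝ) : Prop where
  left : u (F 0 (q 1)) = (8 * u (q 0) + 4 * u (q 1) + 3 * u (q 2)) / 15
  right : u (F 0 (q 2)) = (8 * u (q 0) + 3 * u (q 1) + 4 * u (q 2)) / 15
  left' : u (F 5 (q 1)) = (4 * u (q 0) + 8 * u (q 1) + 3 * u (q 2)) / 15
  right' : u (F 4 (q 2)) = (4 * u (q 0) + 3 * u (q 1) + 8 * u (q 2)) / 15
  botLeft : u (F 1 (q 2)) = (3 * u (q 0) + 8 * u (q 1) + 4 * u (q 2)) / 15
  botRight : u (F 2 (q 1)) = (3 * u (q 0) + 4 * u (q 1) + 8 * u (q 2)) / 15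
  center : u (F 3 (q 0)) = (u (q 0) + u (q 1) + u (q 2)) / 3

theorem F0_q0 : F 0 (q 0) = q 0 := F_cr 0
theorem F1_q1 : F 1 (q 1) = q 1 := F_cr 1
theorem F2_q2 : F 2 (q 2) = q 2 := F_cr 2

/-- The harmonic extension rule: the seven junctions give seven linear equations for the values there. -/
theorem FullHarm.ext {u : Plane → ℝ} (h : FullHarm u) : Ext u := by
  have adm : ∀ x, Adm 1 2 x := adm_of_one_lt (by norm_num)
  have h1 := h 1 _ (inner_F_q (p := 0) (a := 1) (by decide)) (adm _)
  have h2 := h 1 _ (inner_F_q (p := 0) (a := 2) (by decide)) (adm _)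
  have h3 := h 1 _ (inner_F_q (p := 5) (a := 1) (by decide)) (adm _)
  have h4 := h 1 _ (inner_F_q (p := 4) (a := 2) (by decide)) (adm _)
  have h5 := h 1 _ (inner_F_q (p := 1) (a := 2) (by decide)) (adm _)
  have h6 := h 1 _ (inner_F_q (p := 2) (a := 1) (by decide)) (adm _)
  have h7 := h 1 _ (inner_F_q (p := 3) (a := 0) (by decide)) (adm _)
  rw [lap_left] at h1
  rw [lap_right] at h2
  rw [lap_left'] at h3
  rw [lap_right'] at h4
  rw [lap_bot_left] at h5
  rw [lap_bot_right] at h6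
  rw [lap_center] at h7
  simp only [lap_zero_corner, Function.comp, junction_left, junction_right, junction_left',
    junction_right', junction_bot_left, junction_bot_right, junction_center, junction_center',
    F0_q0, F1_q1, F2_q2] at h1 h2 h3 h4 h5 h6 h7
  constructor <;> linarith

/-- The flux at a corner is multiplied by `7 / 15` from one level to the next. -/
theorem Ext.lap_zero {u : Plane → ℝ} (h : Ext u) (a : Fin 3) :
    lap 0 (u ∘ F (cr a)) (q a) = 7 / 15 * lap 0 u (q a) := by
  have h1 := h.left
  have h2 := h.right
  have h3 := h.left'
  have h4 := h.right'
  have h5 := h.botLeft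
  have h6 := h.botRight
  fin_cases a <;>
  simp only [Fin.zero_eta, Fin.mk_one, Fin.reduceFinMk, lap_zero_corner, Function.comp, F0_q0,
    F1_q1, F2_q2, cr_zero, cr_one, cr_two, junction_left', junction_right'] <;> linarith

theorem FullHarm.lap_corner {u : Plane → ℝ} (h : FullHarm u) (m : ℕ) (a : Fin 3) :
    lap m u (q a) = (7 / 15) ^ m * lap 0 u (q a) := by
  induction m generalizing u with
  | zero => simp
  | succ m ih =>
    rw [SG3.lap_corner, ih (h.comp _), h.ext.lap_zero, pow_succ]; ring

/-- The unrenormalized energy of the boundary values of a function. -/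
noncomputable def tri (u : Plane → ℝ) : ℝ :=
  (u (q 0) - u (q 1)) ^ 2 + (u (q 1) - u (q 2)) ^ 2 + (u (q 2) - u (q 0)) ^ 2

theorem tri_nonneg (u : Plane → ℝ) : 0 ≤ tri u := by unfold tri; positivity

/-- The graph energy of a harmonic function is invariant when renormalized by `15 / 7`. -/
theorem Ext.sum_tri {u : Plane → ℝ} (h : Ext u) :
    ∑ p, tri (u ∘ F p) = 7 / 15 * tri u := by
  rw [Fin.sum_univ_six]
  simp only [tri, Function.comp, junction_left, junction_right, junction_left',
    junction_right', junction_bot_left, junction_bot_right, junction_center, junction_center',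
    F0_q0, F1_q1, F2_q2, h.left, h.right, h.left', h.right', h.botLeft, h.botRight, h.center]
  ring

/-- The cell at a corner carries less than its share of the energy, so that the renormalized energy of
the cells at a corner tends to zero. -/
theorem Ext.tri_top {u : Plane → ℝ} (h : Ext u) : tri (u ∘ F 0) ≤ (7 / 15) ^ 2 * tri u := by
  simp only [tri, Function.comp, F0_q0, h.left, h.right]
  nlinarith [sq_nonneg (u (q 1) - u (q 2))]

/-! ### Removing the singularity at `q₀` -/

/-- `u` is harmonic at depth less than `lam`, except possibly on the cells that contain `q₀`. -/
def PuncHarm (lam : ℝ) (u : Plane → ℝ) : Prop :=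
  ∀ m x, Inner x → (G 0)^[m] x ∉ gasket → Adm m lam x → lap m u x = 0

theorem G_notMem {p : Fin 6} {x : Plane} (hx : x ∉ gasket) : G p x ∉ gasket := fun h =>
  hx (by rw [← F_G p x]; exact F_mem p h)

theorem iterate_G_notMem {m : ℕ} {x : Plane} (hx : x ∉ gasket) : (G 0)^[m] x ∉ gasket := by
  induction m generalizing x with
  | zero => exact hx
  | succ m ih => exact ih (G_notMem hx)

theorem PuncHarm.mono {lam lam' : ℝ} {u : Plane → ℝ} (h : PuncHarm lam u) (hl : 1 < lam) :
    PuncHarm lam' u := fun m x hx hG _ => h m x hx hG (adm_of_one_lt hl x)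

theorem PuncHarm.comp_top {lam : ℝ} {u : Plane → ℝ} (h : PuncHarm lam u) :
    PuncHarm (3 * lam) (u ∘ F 0) := fun m x hx hG ha => by
  rw [← lap_F_inner m u 0 hx]
  refine h _ _ (hx.F 0) (by simpa using hG) ((adm_F_inner hx).2 ?_)
  simpa [dp] using ha

theorem PuncHarm.comp {lam : ℝ} {u : Plane → ℝ} (h : PuncHarm lam u) {p : Fin 6} (hp : p ≠ 0) :
    Harm (3 * lam - dp p) (u ∘ F p) := fun m x hx ha => by
  rw [← lap_F_inner m u p hx]
  exact h _ _ (hx.F p) (iterate_G_notMem (x := G 0 (F p x)) (hx.G_notMem hp.symm))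
    ((adm_F_inner hx).2 ha)

section ring

variable {v : Plane → ℝ}

theorem PuncHarm.eq_left' (h : PuncHarm 2 v) : 4 * v (F 5 (q 1))
    = v (F 0 (q 1)) + v (F 3 (q 0)) + v (q 1) + v (F 1 (q 2)) := by
  have h3 := h 1 _ (inner_F_q (p := 5) (a := 1) (by decide))
    (G_junction_left'.2 0 (by decide) (by decide)) (adm_of_one_lt (by norm_num) _)
  rw [lap_left'] at h3
  simp only [lap_zero_corner, Function.comp, junction_left, junction_left', junction_center,
    F1_q1] at h3
  linarith

theorem PuncHarm.eq_right' (h : PuncHarm 2 v) : 4 * v (F 4 (q 2))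
    = v (F 0 (q 2)) + v (F 3 (q 0)) + v (q 2) + v (F 2 (q 1)) := by
  have h3 := h 1 _ (inner_F_q (p := 4) (a := 2) (by decide))
    (G_junction_right'.2 0 (by decide) (by decide)) (adm_of_one_lt (by norm_num) _)
  rw [lap_right'] at h3
  simp only [lap_zero_corner, Function.comp, junction_right, junction_right', junction_center',
    F2_q2] at h3
  linarith

theorem PuncHarm.eq_botLeft (h : PuncHarm 2 v) : 4 * v (F 1 (q 2))
    = v (F 5 (q 1)) + v (q 1) + v (F 3 (q 0)) + v (F 2 (q 1)) := by
  have h3 := h 1 _ (inner_F_q (p := 1) (a := 2) (by decide))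
    (G_junction_bot_left.2 0 (by decide) (by decide)) (adm_of_one_lt (by norm_num) _)
  rw [lap_bot_left] at h3
  simp only [lap_zero_corner, Function.comp, junction_left', junction_bot_left, junction_bot_right,
    F1_q1] at h3
  linarith

theorem PuncHarm.eq_botRight (h : PuncHarm 2 v) : 4 * v (F 2 (q 1))
    = v (F 4 (q 2)) + v (q 2) + v (F 3 (q 0)) + v (F 1 (q 2)) := by
  have h3 := h 1 _ (inner_F_q (p := 2) (a := 1) (by decide))
    (G_junction_bot_right.2 0 (by decide) (by decide)) (adm_of_one_lt (by norm_num) _)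
  rw [lap_bot_right] at h3
  simp only [lap_zero_corner, Function.comp, junction_right', junction_bot_left, junction_bot_right,
    F2_q2] at h3
  linarith

theorem PuncHarm.eq_center (h : PuncHarm 2 v) : 6 * v (F 3 (q 0))
    = v (F 0 (q 1)) + v (F 5 (q 1)) + v (F 0 (q 2)) + v (F 4 (q 2)) + v (F 1 (q 2))
      + v (F 2 (q 1)) := by
  have h3 := h 1 _ (inner_F_q (p := 3) (a := 0) (by decide))
    (G_junction_center.2.2 0 (by decide) (by decide) (by decide)) (adm_of_one_lt (by norm_num) _)
  rw [lap_center] at h3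
  simp only [lap_zero_corner, Function.comp, junction_left, junction_right, junction_bot_left,
    junction_bot_right, junction_center, junction_center'] at h3
  linarith

/-- Balance of the fluxes at `F₀ q₁`, from the equation of the second level. -/
theorem PuncHarm.eq_left (h : PuncHarm 2 v) :
    2 * v (F 0 (q 1)) - v (F 0 (F 5 (q 1))) - v (F 0 (F 1 (q 2)))
      + 7 / 15 * (2 * v (F 0 (q 1)) - v (F 5 (q 1)) - v (F 3 (q 0))) = 0 := by
  have h3 := h 2 _ (inner_F_q (p := 0) (a := 1) (by decide))
    (by simpa using G_q_notMem (p := 0) (a := 1) (by decide)) (adm_of_one_lt (by norm_num) _)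
  have h5 : FullHarm (v ∘ F 5) := (h.comp (by decide)).mono (by simp [dp]; norm_num)
  rw [lap_left, h5.lap_corner, lap_corner] at h3
  simp only [lap_zero_corner, Function.comp, cr_one, junction_left', F1_q1, junction_left,
    junction_center] at h3
  linarith

theorem PuncHarm.eq_right (h : PuncHarm 2 v) :
    2 * v (F 0 (q 2)) - v (F 0 (F 4 (q 2))) - v (F 0 (F 2 (q 1)))
      + 7 / 15 * (2 * v (F 0 (q 2)) - v (F 4 (q 2)) - v (F 3 (q 0))) = 0 := by
  have h3 := h 2 _ (inner_F_q (p := 0) (a := 2) (by decide))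
    (by simpa using G_q_notMem (p := 0) (a := 2) (by decide)) (adm_of_one_lt (by norm_num) _)
  have h5 : FullHarm (v ∘ F 4) := (h.comp (by decide)).mono (by simp [dp]; norm_num)
  rw [lap_right, h5.lap_corner, lap_corner] at h3
  simp only [lap_zero_corner, Function.comp, cr_two, junction_right', F2_q2, junction_right,
    junction_center'] at h3
  linarith

theorem PuncHarm.comp_top_two (h : PuncHarm 2 v) : PuncHarm 2 (v ∘ F 0) :=
  h.comp_top.mono (by norm_num)

/-- The symmetric part satisfies a two-term recursion for its increments (conservation of flux). -/
theorem PuncHarm.sym_rec (h : PuncHarm 2 v) :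
    (v (F 0 (q 1)) + v (F 0 (q 2))) - (v (F 0 (F 0 (q 1))) + v (F 0 (F 0 (q 2))))
      = 7 / 15 * ((v (q 1) + v (q 2)) - (v (F 0 (q 1)) + v (F 0 (q 2)))) := by
  have a1 := h.eq_left'
  have a2 := h.eq_right'
  have a3 := h.eq_botLeft
  have a4 := h.eq_botRight
  have a5 := h.eq_center
  have b1 := h.comp_top_two.eq_left'
  have b2 := h.comp_top_two.eq_right'
  have b3 := h.comp_top_two.eq_botLeft
  have b4 := h.comp_top_two.eq_botRight
  have b5 := h.comp_top_two.eq_center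
  have c1 := h.eq_left
  have c2 := h.eq_right
  simp only [Function.comp] at b1 b2 b3 b4 b5
  linarith

/-- The antisymmetric part satisfies a three-term recursion with characteristic roots `1/15` and
`7`. -/
theorem PuncHarm.anti_rec (h : PuncHarm 2 v) :
    106 * (v (F 0 (q 1)) - v (F 0 (q 2)))
      = 15 * (v (F 0 (F 0 (q 1))) - v (F 0 (F 0 (q 2)))) + 7 * (v (q 1) - v (q 2)) := by
  have a1 := h.eq_left'
  have a2 := h.eq_right'
  have a3 := h.eq_botLeft
  have a4 := h.eq_botRight
  have b1 := h.comp_top_two.eq_left'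
  have b2 := h.comp_top_two.eq_right'
  have b3 := h.comp_top_two.eq_botLeft
  have b4 := h.comp_top_two.eq_botRight
  have c1 := h.eq_left
  have c2 := h.eq_right
  simp only [Function.comp] at b1 b2 b3 b4
  linarith

end ring

/-- A solution of the two recursions that converges to `a` is the harmonic one. -/
theorem top_values_of_tendsto {a : ℝ} {A B : ℕ → ℝ} (hA : Tendsto A atTop (𝓝 a))
    (hB : Tendsto B atTop (𝓝 a))
    (hs : ∀ k, (A (k + 1) + B (k + 1)) - (A (k + 2) + B (k + 2))
      = 7 / 15 * ((A k + B k) - (A (k + 1) + B (k + 1))))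
    (hd : ∀ k, 106 * (A (k + 1) - B (k + 1)) = 15 * (A (k + 2) - B (k + 2)) + 7 * (A k - B k)) :
    A 1 = (8 * a + 4 * A 0 + 3 * B 0) / 15 ∧ B 1 = (8 * a + 3 * A 0 + 4 * B 0) / 15 := by
  have hA1 := hA.comp (tendsto_add_atTop_nat 1)
  have hB1 := hB.comp (tendsto_add_atTop_nat 1)
  have s1 : ∀ k, (A (k + 1) + B (k + 1)) - 7 / 15 * (A k + B k)
      = (A 1 + B 1) - 7 / 15 * (A 0 + B 0) := by
    intro k
    induction k with
    | zero => rfl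
    | succ k ih => rw [← ih]; linarith [hs k]
  have s2 : (A 1 + B 1) - 7 / 15 * (A 0 + B 0) = (a + a) - 7 / 15 * (a + a) := by
    refine tendsto_nhds_unique (tendsto_const_nhds (x := (A 1 + B 1) - 7 / 15 * (A 0 + B 0)))
      (((hA1.add hB1).sub ((hA.add hB).const_mul (7 / 15))).congr fun k => ?_)
    exact s1 k
  have d1 : ∀ k, (A k - B k) - 15 * (A (k + 1) - B (k + 1))
      = 7 ^ k * ((A 0 - B 0) - 15 * (A 1 - B 1)) := by
    intro k
    induction k with
    | zero => simp
    | succ k ih => rw [pow_succ']; linarith [hd k]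
  -- the growing mode with root `7` is excluded by convergence
  have d2 : (A 0 - B 0) - 15 * (A 1 - B 1) = 0 := by
    have t1 : Tendsto (fun k => (A k - B k) - 15 * (A (k + 1) - B (k + 1))) atTop (𝓝 0) := by
      simpa using (hA.sub hB).sub ((hA1.sub hB1).const_mul 15)
    have t2 : Tendsto (fun k : ℕ => (1 / 7 : ℝ) ^ k) atTop (𝓝 0) :=
      tendsto_pow_atTop_nhds_zero_of_lt_one (by norm_num) (by norm_num)
    have t3 := t2.mul t1
    rw [mul_zero] at t3
    refine (tendsto_nhds_unique t3 (tendsto_const_nhds.congr fun k => ?_)).symm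
    rw [d1 k, ← mul_assoc, ← mul_pow]; norm_num
  constructor <;> linarith

theorem iterate_F_zero_succ (k : ℕ) (z : Plane) : (F 0)^[k + 1] z = F 0 ((F 0)^[k] z) :=
  Function.iterate_succ_apply' _ _ _

theorem PuncHarm.iterate {v : Plane → ℝ} (h : PuncHarm 2 v) (k : ℕ) :
    PuncHarm 2 (v ∘ (F 0)^[k]) := by
  induction k with
  | zero => exact h
  | succ k ih => exact ih.comp_top_two

/-- Removable singularity: the case of the whole gasket. -/
theorem PuncHarm.fullHarm {v : Plane → ℝ} (h : PuncHarm 2 v)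
    (h1 : Tendsto (fun k => v ((F 0)^[k] (q 1))) atTop (𝓝 (v (q 0))))
    (h2 : Tendsto (fun k => v ((F 0)^[k] (q 2))) atTop (𝓝 (v (q 0)))) : FullHarm v := by
  have key : ∀ m, ∀ v : Plane → ℝ, PuncHarm 2 v →
      Tendsto (fun k => v ((F 0)^[k] (q 1))) atTop (𝓝 (v (q 0))) →
      Tendsto (fun k => v ((F 0)^[k] (q 2))) atTop (𝓝 (v (q 0))) →
      ∀ x, Inner x → lap m v x = 0 := by
    intro m
    induction m with
    | zero => exact fun v _ _ _ x hx => lap_zero_inner v hx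
    | succ m ih =>
      intro v h h1 h2 x hx
      by_cases hG : (G 0)^[m + 1] x ∈ gasket
      swap
      · exact h _ x hx hG (adm_of_one_lt (by norm_num) x)
      have hm : (G 0)^[m] (G 0 x) ∈ gasket := hG
      have hx' : G 0 x ∈ gasket := by
        by_contra hc; exact iterate_G_notMem hc hm
      have ex : F 0 (G 0 x) = x := F_G 0 x
      by_cases hi : Inner (G 0 x)
      · rw [← ex, lap_F_inner m v 0 hi]
        refine ih _ h.comp_top_two ?_ ?_ _ hi
        · simpa [Function.comp_def, ← iterate_F_zero_succ, F0_q0] using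
            h1.comp (tendsto_add_atTop_nat 1)
        · simpa [Function.comp_def, ← iterate_F_zero_succ, F0_q0] using
            h2.comp (tendsto_add_atTop_nat 1)
      · have : G 0 x ∈ Set.range q := by
          by_contra hc; exact hi ⟨hx', hc⟩
        obtain ⟨a, ha⟩ := this
        rw [← ha] at hm ex
        have hm0 : a ≠ 0 → m = 0 := by
          intro hne
          by_contra hm1
          obtain ⟨m', rfl⟩ := Nat.exists_eq_succ_of_ne_zero hm1
          refine iterate_G_notMem (G_q_notMem (p := 0) (a := a) ?_) hm
          exact fun e => hne (cr_injective e.symm)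
        obtain ⟨t1, t2⟩ := top_values_of_tendsto h1 h2
          (fun k => (h.iterate k).sym_rec)
          (fun k => (h.iterate k).anti_rec)
        simp only [Function.iterate_zero, Function.iterate_one, id] at t1 t2
        have a1 := h.eq_left'
        have a2 := h.eq_right'
        have a3 := h.eq_botLeft
        have a4 := h.eq_botRight
        have a5 := h.eq_center
        fin_cases a
        · exfalso; exact hx.2 ⟨0, by rw [← ex]; exact F0_q0.symm⟩
        · obtain rfl := hm0 (by decide)
          rw [← ex]
          simp only [Fin.mk_one]
          rw [lap_left]
          simp only [lap_zero_corner, Function.comp, junction_left, junction_center, F0_q0]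
          linarith
        · obtain rfl := hm0 (by decide)
          rw [← ex]
          simp only [Fin.reduceFinMk]
          rw [lap_right]
          simp only [lap_zero_corner, Function.comp, junction_right, junction_center', F0_q0]
          linarith
  exact fun m x hx _ => key m v h h1 h2 x hx

/-- Removable singularity at `q₀`. -/
theorem PuncHarm.harm {lam : ℝ} (h0 : 0 < lam) (hl : lam ≤ 1) {v : Plane → ℝ} (h : PuncHarm lam v)
    (h1 : Tendsto (fun k => v ((F 0)^[k] (q 1))) atTop (𝓝 (v (q 0))))
    (h2 : Tendsto (fun k => v ((F 0)^[k] (q 2))) atTop (𝓝 (v (q 0)))) : Harm lam v := by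
  obtain ⟨n, hn⟩ := pow_unbounded_of_one_lt (1 / lam) (by norm_num : (1 : ℝ) < 3)
  rw [div_lt_iff₀ h0] at hn
  induction n generalizing lam v with
  | zero => simp at hn; linarith
  | succ n ih =>
    have t1 : Tendsto (fun k => (v ∘ F 0) ((F 0)^[k] (q 1))) atTop (𝓝 ((v ∘ F 0) (q 0))) := by
      simpa [Function.comp_def, ← iterate_F_zero_succ, F0_q0] using
            h1.comp (tendsto_add_atTop_nat 1)
    have t2 : Tendsto (fun k => (v ∘ F 0) ((F 0)^[k] (q 2))) atTop (𝓝 ((v ∘ F 0) (q 0))) := by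
      simpa [Function.comp_def, ← iterate_F_zero_succ, F0_q0] using
            h2.comp (tendsto_add_atTop_nat 1)
    have hH : Harm (3 * lam) (v ∘ F 0) := by
      by_cases hc : 3 * lam ≤ 1
      · exact ih (by positivity) hc h.comp_top t1 t2 (by rw [pow_succ] at hn; linarith)
      · exact ((h.comp_top.mono (not_le.1 hc)).fullHarm t1 t2).mono (by norm_num)
    intro m x hx ha
    rcases m with _ | m
    · exact lap_zero_inner v hx
    by_cases hG : (G 0)^[m + 1] x ∈ gasket
    swap
    · exact h _ x hx hG ha
    have hm : (G 0)^[m] (G 0 x) ∈ gasket := hG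
    have hx' : G 0 x ∈ gasket := by
      by_contra hc; exact iterate_G_notMem hc hm
    have ex : F 0 (G 0 x) = x := F_G 0 x
    by_cases hi : Inner (G 0 x)
    · rw [← ex, lap_F_inner m v 0 hi]
      rw [← ex, adm_F_inner hi] at ha
      exact hH _ _ hi (by simpa [dp] using ha)
    have : G 0 x ∈ Set.range q := by
      by_contra hc; exact hi ⟨hx', hc⟩
    obtain ⟨a, haq⟩ := this
    rw [← haq] at hm ex
    have hne : a ≠ 0 := by
      rintro rfl
      exact hx.2 ⟨0, by rw [← ex]; exact F0_q0.symm⟩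
    have hm0 : m = 0 := by
      by_contra hm1
      obtain ⟨m', rfl⟩ := Nat.exists_eq_succ_of_ne_zero hm1
      refine iterate_G_notMem (G_q_notMem (p := 0) (a := a) ?_) hm
      exact fun e => hne (cr_injective e.symm)
    subst hm0
    -- the equation of the second level at `x` is `7/15` times that of the first level
    have h0full : 1 < 3 * lam → FullHarm (v ∘ F 0) := fun hc => hH.mono hc
    fin_cases a
    · exact absurd rfl hne
    · rw [← ex] at ha ⊢
      simp only [Fin.mk_one] at ha ⊢
      have ha' := (adm_left 0 lam).1 ha
      rw [adm_bot (by decide), adm_top] at ha'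
      have e5 : FullHarm (v ∘ F 5) := (h.comp (by decide)).mono (by simpa using ha'.2)
      have hh := h 2 _ (inner_F_q (p := 0) (a := 1) (by decide))
        (by simpa using G_q_notMem (p := 0) (a := 1) (by decide))
        ((adm_left 1 lam).2 ⟨(adm_bot (by decide)).2 ha'.1, adm_top.2 (by linarith [ha'.2])⟩)
      rw [lap_left, (h0full (by simpa [dp] using ha'.1)).lap_corner, e5.lap_corner] at hh
      rw [lap_left]
      linarith
    · rw [← ex] at ha ⊢
      simp only [Fin.reduceFinMk] at ha ⊢
      have ha' := (adm_right 0 lam).1 ha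
      rw [adm_bot (by decide), adm_top] at ha'
      have e5 : FullHarm (v ∘ F 4) := (h.comp (by decide)).mono (by simpa using ha'.2)
      have hh := h 2 _ (inner_F_q (p := 0) (a := 2) (by decide))
        (by simpa using G_q_notMem (p := 0) (a := 2) (by decide))
        ((adm_right 1 lam).2 ⟨(adm_bot (by decide)).2 ha'.1, adm_top.2 (by linarith [ha'.2])⟩)
      rw [lap_right, (h0full (by simpa [dp] using ha'.1)).lap_corner, e5.lap_corner] at hh
      rw [lap_right]
      linarith

/-! ### From the domain `Ω_λ` to the depth conditions -/

theorem top_notMem_of_cell {m : ℕ} {x : Plane} (h : (G 0)^[m] x ∉ gasket)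
    {w : Fin m → Fin 6} (hx : x ∈ cell (List.ofFn w)) : q 0 ∉ cell (List.ofFn w) := by
  have key : ∀ (l : List (Fin 6)) (x : Plane), (G 0)^[l.length] x ∉ gasket → x ∈ cell l →
      q 0 ∉ cell l := by
    intro l
    induction l with
    | nil => exact fun x h hx => absurd (mem_cell_nil.1 hx) h
    | cons p l ih =>
      intro x h hx h0
      rw [mem_cell_cons] at hx h0
      have hp : p = 0 := (eq_of_F_eq_q (cell_subset_gasket _ h0) (F_G p _)).1
      subst hp
      exact ih _ h hx (by simpa using (G_cr 0) ▸ h0)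
  exact key _ x (by simpa using h) hx

/-- The definition of harmonicity in `Ω_λ` says nothing about the cells that contain `q₀`, because
`q₀` does not belong to `Ω_λ`. -/
theorem IsHarmonicOn.puncHarm {lam : ℝ} (hl : lam ≤ 1) {u : Plane → ℝ}
    (h : IsHarmonicOn (Om lam) u) : PuncHarm lam u := by
  intro m x hx hG ha
  rw [← sum_eq_lap]
  have ha := adm_iff.1 ha
  have hq : ∀ w : Fin m → Fin 6, x ∈ cell (List.ofFn w) → cell (List.ofFn w) ⊆ Om lam := by
    intro w hw z hz
    refine ⟨cell_subset_gasket _ hz, ?_, by linarith [ha w hw z hz]⟩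
    rintro ⟨a, rfl⟩
    fin_cases a
    · exact top_notMem_of_cell hG hw hz
    all_goals
      have := ha w hw _ hz
      simp [q] at this
      linarith
  refine h m x ⟨hx.1, hx.2, ?_⟩ hq
  have : ∃ w : Fin m → Fin 6, x ∈ cell (List.ofFn w) := by
    have key : ∀ (m : ℕ) (x : Plane), x ∈ gasket → ∃ w : Fin m → Fin 6, x ∈ cell (List.ofFn w) := by
      intro m
      induction m with
      | zero => exact fun x hx => ⟨Fin.elim0, by simpa [mem_cell_nil] using hx⟩
      | succ m ih =>
        intro x hx
        obtain ⟨p, x', hx', rfl⟩ := exists_F hx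
        obtain ⟨w, hw⟩ := ih x' hx'
        exact ⟨Fin.cons p w, by simpa [List.ofFn_succ, mem_cell_cons] using hw⟩
    exact key m x hx.1
  obtain ⟨w, hw⟩ := this
  linarith [ha w hw x hw]

theorem lap_update {m : ℕ} {u : Plane → ℝ} {a : ℝ} {x : Plane} (h : (G 0)^[m] x ∉ gasket) :
    lap m (Function.update u (q 0) a) x = lap m u x := by
  induction m generalizing u x with
  | zero => rw [lap_of_notMem _ (x := x) h, lap_of_notMem _ (x := x) h]
  | succ m ih =>
    refine Finset.sum_congr rfl fun p _ => ?_
    by_cases hp : p = 0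
    · subst hp
      have e : Function.update u (q 0) a ∘ F 0 = Function.update (u ∘ F 0) (q 0) a := by
        funext z
        by_cases hz : z = q 0
        · subst hz; simp [F0_q0]
        · have : F 0 z ≠ q 0 := fun e => hz (F_injective 0 (e.trans F0_q0.symm))
          simp [hz, this]
      rw [e, ih h]
    · refine lap_congr (fun z hz => ?_) _
      have : F p z ≠ q 0 := fun e => hp (eq_of_F_eq_q hz e).1
      simp [this]

theorem PuncHarm.update {lam : ℝ} {u : Plane → ℝ} (h : PuncHarm lam u) (a : ℝ) :
    PuncHarm lam (Function.update u (q 0) a) := fun m x hx hG ha => by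
  rw [lap_update hG]; exact h m x hx hG ha

theorem F_continuous (p : Fin 6) : Continuous (F p) := (F_lipschitz p).continuous

theorem tendsto_iterate_top (z : Plane) : Tendsto (fun k => (F 0)^[k] z) atTop (𝓝 (q 0)) := by
  have h : ∀ k, dist ((F 0)^[k] z) (q 0) ≤ (1 / 3) ^ k * dist z (q 0) := by
    intro k
    induction k with
    | zero => simp
    | succ k ih =>
      have h1 := (F_lipschitz 0).dist_le_mul ((F 0)^[k] z) (q 0)
      rw [F0_q0] at h1
      rw [iterate_F_zero_succ, pow_succ]
      have e : ((1 / 3 : ℝ≥0) : ℝ) = 1 / 3 := by norm_num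
      rw [e] at h1
      linarith
  rw [tendsto_iff_dist_tendsto_zero]
  refine squeeze_zero (fun _ => dist_nonneg) h ?_
  simpa using (tendsto_pow_atTop_nhds_zero_of_lt_one (by norm_num : (0 : ℝ) ≤ 1 / 3)
    (by norm_num)).mul_const (dist z (q 0))

theorem depth_iterate (k : ℕ) (z : Plane) : 1 - ((F 0)^[k] z).2 = (1 - z.2) / 3 ^ k := by
  induction k with
  | zero => simp
  | succ k ih => rw [iterate_F_zero_succ, depth_F, ih, pow_succ]; simp [dp]; field_simp

theorem iterate_mem (k : ℕ) {z : Plane} (hz : z ∈ gasket) : (F 0)^[k] z ∈ gasket := by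
  induction k with
  | zero => exact hz
  | succ k ih => rw [iterate_F_zero_succ]; exact F_mem 0 ih

theorem iterate_notMem_corners {lam : ℝ} (hl : lam ≤ 1) {k : ℕ} {z : Plane} (hz : z ≠ q 0)
    (h : 1 - ((F 0)^[k] z).2 < lam) : (F 0)^[k] z ∉ Set.range q := by
  rintro ⟨a, ha⟩
  fin_cases a
  · have e : (F 0)^[k] (q 0) = q 0 := Function.iterate_fixed F0_q0 k
    exact hz ((F_injective 0).iterate k (ha.symm.trans e.symm))
  all_goals
    rw [← ha] at h
    simp [q] at h
    linarith

/-- A harmonic function in `Ω_λ` with limit `a` at `q₀` becomes harmonic on the cells at `q₀` too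
when it is given the value `a` at `q₀`. -/
theorem IsHarmonicOn.harm {lam : ℝ} (h0 : 0 < lam) (hl : lam ≤ 1) {u : Plane → ℝ} {a : ℝ}
    (h : IsHarmonicOn (Om lam) u) (ha : Tendsto u (𝓝[Om lam] (q 0)) (𝓝 a)) :
    Harm lam (Function.update u (q 0) a) := by
  have key : ∀ b : Fin 3, b ≠ 0 →
      Tendsto (fun k => Function.update u (q 0) a ((F 0)^[k] (q b))) atTop
        (𝓝 (Function.update u (q 0) a (q 0))) := by
    intro b hb
    have hqb : q b ≠ q 0 := fun e => by
      have := congrFun (congrArg bary e) 0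
      rw [bary_q, bary_q, if_pos rfl, if_neg hb] at this
      norm_num at this
    have t := tendsto_iterate_top (q b)
    have ev : ∀ᶠ k in atTop, (F 0)^[k] (q b) ∈ Om lam := by
      have t2 : Tendsto (fun k : ℕ => (1 - (q b).2) / 3 ^ k) atTop (𝓝 0) := by
        have := (tendsto_pow_atTop_nhds_zero_of_lt_one (by norm_num : (0 : ℝ) ≤ 1 / 3)
          (by norm_num)).const_mul (1 - (q b).2)
        simpa [div_eq_mul_inv] using this
      filter_upwards [t2.eventually_lt_const h0] with k hk
      rw [← depth_iterate] at hk
      exact ⟨iterate_mem k (q_mem b), iterate_notMem_corners hl hqb hk, by linarith⟩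
    have t3 : Tendsto (fun k => (F 0)^[k] (q b)) atTop (𝓝[Om lam] (q 0)) :=
      tendsto_nhdsWithin_iff.2 ⟨t, ev⟩
    rw [Function.update_self]
    refine (ha.comp t3).congr' ?_
    filter_upwards [ev] with k hk
    have : (F 0)^[k] (q b) ≠ q 0 := fun e => hk.2.1 ⟨0, e.symm⟩
    simp [this]
  exact ((h.puncHarm hl).update a).harm h0 hl (key 1 (by decide)) (key 2 (by decide))

/-! ### Effective conductances -/

/-- The effective conductance between `q₀` and the ends of the branches, when each branch of a
network of type `k` is closed by a resistor of conductance `t`. -/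
noncomputable def conduct (k : ℕ) (t : ℝ) : ℝ :=
  if k = 1 then 2 * t / (1 + t) else t * (18 + 4 * t) / (3 * t ^ 2 + 15 * t + 6)

theorem conduct_mono {k : ℕ} {s t : ℝ} (hs : 0 ≤ s) (hst : s ≤ t) : conduct k s ≤ conduct k t := by
  have ht := hs.trans hst
  unfold conduct
  split_ifs
  · rw [div_le_div_iff₀ (by positivity) (by positivity)]; nlinarith
  · rw [div_le_div_iff₀ (by positivity) (by positivity)]
    have h1 : 0 ≤ (t - s) * (6 * (s * t) + 24 * (s + t) + 108) :=
      mul_nonneg (sub_nonneg.2 hst) (by positivity)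
    nlinarith

theorem conduct_bounds {k : ℕ} {t : ℝ} (ht : 15 / 7 ≤ t) :
    1 ≤ conduct k t ∧ conduct k t ≤ 2 := by
  have h0 : 0 < t := by linarith
  unfold conduct
  split_ifs
  · rw [le_div_iff₀ (by positivity), div_le_iff₀ (by positivity)]
    constructor <;> linarith
  · rw [le_div_iff₀ (by positivity), div_le_iff₀ (by positivity)]
    constructor <;> nlinarith

theorem conduct_continuousAt {k : ℕ} {t : ℝ} (ht : 0 < t) : ContinuousAt (conduct k) t := by
  unfold conduct
  split_ifs
  · exact ContinuousAt.div (by fun_prop) (by fun_prop) (by positivity)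
  · exact ContinuousAt.div (by fun_prop) (by fun_prop) (by positivity)

/-- Upper approximations of the conductance between `q₀` and `X_λ`. -/
noncomputable def etaN : ℕ → ℝ → ℝ
  | 0, lam => (15 / 7) ^ m1 lam * 2
  | n + 1, lam => (15 / 7) ^ m1 lam * conduct (iota1 lam) (etaN n (R lam))

/-- The conductance between `q₀` and `X_λ`, as the limit of the conductances of finite networks. -/
noncomputable def etaT (lam : ℝ) : ℝ := ⨅ n, etaN n lam

/-- The conductance between `q₀` and `X_λ`, renormalized to the scale of the first branching. -/
noncomputable def theta (lam : ℝ) : ℝ := conduct (iota1 lam) (etaT (R lam))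

theorem pow_m1_ge {lam : ℝ} (h0 : 0 < lam) (h1 : lam ≤ 1) : (15 / 7 : ℝ) ≤ (15 / 7) ^ m1 lam := by
  simpa using pow_le_pow_right₀ (by norm_num : (1 : ℝ) ≤ 15 / 7) (m1_spec h0 h1).1

theorem etaN_ge (n : ℕ) {lam : ℝ} (h0 : 0 < lam) (h1 : lam ≤ 1) :
    (15 / 7 : ℝ) ^ m1 lam ≤ etaN n lam := by
  induction n generalizing lam with
  | zero =>
    rw [etaN]; linarith [pow_pos (by norm_num : (0 : ℝ) < 15 / 7) (m1 lam)]
  | succ n ih =>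
    obtain ⟨hR0, hR1⟩ := R_mem h0 h1
    rw [etaN]
    refine le_mul_of_one_le_right (by positivity) (conduct_bounds ?_).1
    exact (pow_m1_ge hR0 hR1).trans (ih hR0 hR1)

theorem etaN_ge' (n : ℕ) {lam : ℝ} (h0 : 0 < lam) (h1 : lam ≤ 1) : 15 / 7 ≤ etaN n lam :=
  (pow_m1_ge h0 h1).trans (etaN_ge n h0 h1)

theorem etaN_antitone {lam : ℝ} (h0 : 0 < lam) (h1 : lam ≤ 1) : Antitone fun n => etaN n lam := by
  refine antitone_nat_of_succ_le fun n => ?_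
  induction n generalizing lam with
  | zero =>
    obtain ⟨hR0, hR1⟩ := R_mem h0 h1
    rw [etaN, etaN]
    exact mul_le_mul_of_nonneg_left (conduct_bounds (etaN_ge' 0 hR0 hR1)).2 (by positivity)
  | succ n ih =>
    obtain ⟨hR0, hR1⟩ := R_mem h0 h1
    change _ * conduct _ (etaN (n + 1) (R lam)) ≤ _ * conduct _ (etaN n (R lam))
    refine mul_le_mul_of_nonneg_left (conduct_mono ?_ (ih hR0 hR1)) (by positivity)
    linarith [etaN_ge' (n + 1) hR0 hR1]

theorem etaN_tendsto {lam : ℝ} (h0 : 0 < lam) (h1 : lam ≤ 1) :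
    Tendsto (fun n => etaN n lam) atTop (𝓝 (etaT lam)) := by
  refine tendsto_atTop_ciInf (etaN_antitone h0 h1) ⟨15 / 7, ?_⟩
  rintro _ ⟨n, rfl⟩
  exact etaN_ge' n h0 h1

theorem etaT_ge {lam : ℝ} (h0 : 0 < lam) (h1 : lam ≤ 1) : 15 / 7 ≤ etaT lam :=
  le_ciInf fun n => etaN_ge' n h0 h1

theorem etaT_eq {lam : ℝ} (h0 : 0 < lam) (h1 : lam ≤ 1) :
    etaT lam = (15 / 7) ^ m1 lam * theta lam := by
  obtain ⟨hR0, hR1⟩ := R_mem h0 h1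
  refine tendsto_nhds_unique ((etaN_tendsto h0 h1).comp (tendsto_add_atTop_nat 1)) ?_
  have hc := (conduct_continuousAt (k := iota1 lam)
    (by linarith [etaT_ge hR0 hR1] : 0 < etaT (R lam))).tendsto.comp (etaN_tendsto hR0 hR1)
  exact hc.const_mul _

theorem theta_bounds {lam : ℝ} (h0 : 0 < lam) (h1 : lam ≤ 1) :
    1 ≤ theta lam ∧ theta lam ≤ 2 := by
  obtain ⟨hR0, hR1⟩ := R_mem h0 h1
  exact conduct_bounds (etaT_ge hR0 hR1)

theorem iota1_eq (lam : ℝ) : iota1 lam = 1 ∨ iota1 lam = 2 := digit_eq lam 0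

theorem S_one : S 1 = {4, 5} := rfl
theorem S_two : S 2 = {1, 2, 3} := rfl

theorem dp_of_mem {k : ℕ} (hk : k = 1 ∨ k = 2) {i : Fin 6} (hi : i ∈ S k) : dp i = k := by
  rcases hk with rfl | rfl
  · simp only [S_one, Finset.mem_insert, Finset.mem_singleton] at hi
    rcases hi with rfl | rfl <;> simp [dp]
  · simp only [S_two, Finset.mem_insert, Finset.mem_singleton] at hi
    rcases hi with rfl | rfl | rfl <;> simp [dp]

/-- The weights of the branches, in terms of `etaT`. -/
noncomputable def wT (lam : ℝ) (i : Fin 6) : ℝ :=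
  if iota1 lam = 1 then 1 / 2
  else if i = 3 then (3 + etaT (R lam)) / (9 + 2 * etaT (R lam))
  else (6 + etaT (R lam)) / (18 + 4 * etaT (R lam))

theorem wT_bounds {lam : ℝ} (h0 : 0 < lam) (h1 : lam ≤ 1) (i : Fin 6) :
    1 / 4 ≤ wT lam i ∧ wT lam i ≤ 1 / 2 := by
  obtain ⟨hR0, hR1⟩ := R_mem h0 h1
  have h := etaT_ge hR0 hR1
  unfold wT
  split_ifs
  · norm_num
  · rw [div_le_div_iff₀ (by norm_num) (by linarith), div_le_div_iff₀ (by linarith) (by norm_num)]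
    constructor <;> linarith
  · rw [div_le_div_iff₀ (by norm_num) (by linarith), div_le_div_iff₀ (by linarith) (by norm_num)]
    constructor <;> linarith

theorem sum_wT {lam : ℝ} (h0 : 0 < lam) (h1 : lam ≤ 1) : ∑ i ∈ S (iota1 lam), wT lam i = 1 := by
  obtain ⟨hR0, hR1⟩ := R_mem h0 h1
  have h := etaT_ge hR0 hR1
  have h2 : (9 + 2 * etaT (R lam)) ≠ 0 := by linarith
  have h3 : (18 + 4 * etaT (R lam)) ≠ 0 := by linarith
  rcases iota1_eq lam with hi | hi
  · rw [hi, S_one]; simp [wT, hi]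
  · rw [hi, S_two]; simp [wT, hi]; field_simp; ring

/-! ### The network of the first branching -/

/-- `u` on the top cell of the first branching. -/
noncomputable def headFun (lam : ℝ) (u : Plane → ℝ) : Plane → ℝ := u ∘ (F 0)^[m1 lam - 1]

/-- The function `u` on the `i`-th branch. -/
noncomputable def branch (lam : ℝ) (u : Plane → ℝ) (i : Fin 6) : Plane → ℝ := headFun lam u ∘ F i

/-- The flux of `u` at `q₀`, divided by the conductance: the drop from `u q₀` to the mean of the
boundary values. -/
noncomputable def drop (lam : ℝ) (u : Plane → ℝ) : ℝ :=
  (2 * u (q 0) - headFun lam u (F 0 (q 1)) - headFun lam u (F 0 (q 2))) / theta lam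

/-- The mean of the boundary values of `u`, computed from the flux of `u` at `q₀`. -/
noncomputable def beta (lam : ℝ) (u : Plane → ℝ) : ℝ := u (q 0) - drop lam u

/-- The energy of `u` on the full cells of the first branching (with unit conductances). -/
noncomputable def netE (lam : ℝ) (u : Plane → ℝ) : ℝ :=
  tri (headFun lam u ∘ F 0) +
    if iota1 lam = 1 then 0 else tri (headFun lam u ∘ F 5) + tri (headFun lam u ∘ F 4)

theorem netE_nonneg (lam : ℝ) (u : Plane → ℝ) : 0 ≤ netE lam u := by
  unfold netE
  have h1 := tri_nonneg (headFun lam u ∘ F 0)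
  have h2 := tri_nonneg (headFun lam u ∘ F 5)
  have h3 := tri_nonneg (headFun lam u ∘ F 4)
  split_ifs <;> linarith

theorem headFun_top (lam : ℝ) (u : Plane → ℝ) : headFun lam u (q 0) = u (q 0) := by
  simp only [headFun, Function.comp, Function.iterate_fixed F0_q0]

theorem Harm.iterate {lam : ℝ} {u : Plane → ℝ} (h : Harm lam u) (k : ℕ) :
    Harm (3 ^ k * lam) (u ∘ (F 0)^[k]) := by
  induction k with
  | zero => simpa using h
  | succ k ih =>
    have := ih.comp 0
    simp only [dp, Matrix.cons_val_zero, sub_zero] at this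
    rw [pow_succ', mul_assoc]
    exact this

section network

variable {lam : ℝ} {u : Plane → ℝ}

theorem three_pow_m1 (h0 : 0 < lam) (h1 : lam ≤ 1) :
    3 * (3 ^ (m1 lam - 1) * lam) = R lam + iota1 lam := by
  have e : (3 : ℝ) ^ m1 lam = 3 * 3 ^ (m1 lam - 1) := by
    rw [← pow_succ']; congr 1; have := (m1_spec h0 h1).1; omega
  unfold R
  rw [e]; ring

theorem Harm.headFun (h : Harm lam u) : Harm (3 ^ (m1 lam - 1) * lam) (headFun lam u) :=
  h.iterate _

theorem Harm.head_full (h0 : 0 < lam) (h1 : lam ≤ 1) (h : Harm lam u) {p : Fin 6}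
    (hp : dp p < iota1 lam) : FullHarm (SG3.headFun lam u ∘ F p) := by
  refine (h.headFun.comp p).mono ?_
  rw [three_pow_m1 h0 h1]
  have hR := (R_mem h0 h1).1
  rcases iota1_eq lam with hi | hi <;> rw [hi] at hp ⊢ <;>
    fin_cases p <;> simp [dp] at hp ⊢ <;> linarith

theorem Harm.branch (h0 : 0 < lam) (h1 : lam ≤ 1) (h : Harm lam u) {i : Fin 6}
    (hi : i ∈ S (iota1 lam)) : Harm (R lam) (branch lam u i) := by
  have := h.headFun.comp i
  rwa [three_pow_m1 h0 h1, dp_of_mem (iota1_eq lam) hi, add_sub_cancel_right] at this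

theorem headFun_comp_zero (h0 : 0 < lam) (h1 : lam ≤ 1) (u : Plane → ℝ) :
    SG3.headFun lam u ∘ F 0 = u ∘ (F 0)^[m1 lam] := by
  have e : m1 lam = m1 lam - 1 + 1 := by have := (m1_spec h0 h1).1; omega
  conv_rhs => rw [e]
  rfl

theorem lap_iterate (m k : ℕ) (u : Plane → ℝ) :
    lap (m + k) u (q 0) = lap m (u ∘ (F 0)^[k]) (q 0) := by
  induction k generalizing u with
  | zero => rfl
  | succ k ih =>
    rw [← add_assoc, lap_corner, ih, cr_zero]
    congr 1
    funext z
    exact congrArg u (Function.iterate_succ_apply' (F 0) k z).symm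

/-- The flux at `q₀`, at all scales below the first branching. -/
theorem Harm.lap_top (h0 : 0 < lam) (h1 : lam ≤ 1) (h : Harm lam u) {m : ℕ} (hm : m1 lam ≤ m) :
    lap m u (q 0) = (7 / 15) ^ m * (etaT lam * drop lam u) := by
  have hp : dp 0 < iota1 lam := by rcases iota1_eq lam with hi | hi <;> rw [hi] <;> simp [dp]
  have hf := h.head_full h0 h1 hp
  rw [headFun_comp_zero h0 h1] at hf
  obtain ⟨k, rfl⟩ := Nat.exists_eq_add_of_le' hm
  have ht : theta lam ≠ 0 := by linarith [(theta_bounds h0 h1).1]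
  rw [lap_iterate, hf.lap_corner, ← headFun_comp_zero h0 h1, lap_zero_corner, etaT_eq h0 h1, drop,
    pow_add]
  simp only [Function.comp, F0_q0, headFun_top]
  have e : (7 / 15 : ℝ) ^ m1 lam * (15 / 7) ^ m1 lam = 1 := by rw [← mul_pow]; norm_num
  have e2 := mul_div_cancel₀ (2 * u (q 0) - SG3.headFun lam u (F 0 (q 1))
    - SG3.headFun lam u (F 0 (q 2))) ht
  linear_combination (-(7 / 15 : ℝ) ^ k * (2 * u (q 0) - SG3.headFun lam u (F 0 (q 1))
    - SG3.headFun lam u (F 0 (q 2)))) * e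
    - (7 / 15 : ℝ) ^ k * (7 / 15) ^ m1 lam * (15 / 7) ^ m1 lam * e2

theorem Harm.lap_branch (h0 : 0 < lam) (h1 : lam ≤ 1) (h : Harm lam u) {i : Fin 6}
    (hi : i ∈ S (iota1 lam)) :
    lap (m1 (R lam)) (SG3.headFun lam u ∘ F i) (q 0)
      = (7 / 15) ^ m1 (R lam) * (etaT (R lam) * drop (R lam) (SG3.branch lam u i)) :=
  (h.branch h0 h1 hi).lap_top (R_mem h0 h1).1 (R_mem h0 h1).2 le_rfl

/-- The network equations for a branching of type one. -/
theorem Harm.net_one (h0 : 0 < lam) (h1 : lam ≤ 1) (h : Harm lam u) (hi : iota1 lam = 1) :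
    (2 * SG3.branch lam u 5 (q 0) - u (q 0) - SG3.branch lam u 4 (q 0))
        + etaT (R lam) * drop (R lam) (SG3.branch lam u 5) = 0 ∧
    (2 * SG3.branch lam u 4 (q 0) - u (q 0) - SG3.branch lam u 5 (q 0))
        + etaT (R lam) * drop (R lam) (SG3.branch lam u 4) = 0 := by
  obtain ⟨hR0, hR1⟩ := R_mem h0 h1
  have hs := (m1_spec hR0 hR1).2.1
  have e3 := three_pow_m1 h0 h1
  have hf := h.head_full h0 h1 (p := 0) (by rw [hi]; simp [dp])
  have b5 := h.lap_branch h0 h1 (i := 5) (by rw [hi]; decide)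
  have b4 := h.lap_branch h0 h1 (i := 4) (by rw [hi]; decide)
  have hpos : (0 : ℝ) < (7 / 15) ^ m1 (R lam) := by positivity
  have e := headFun_top lam u
  rw [hi] at e3
  constructor
  · have := h.headFun (m1 (R lam) + 1) _ (inner_F_q (p := 0) (a := 1) (by decide))
      ((adm_left _ _).2 ⟨(adm_bot (by decide)).2 (by simp [dp]; push_cast at e3; linarith),
        adm_top.2 (by rw [e3]; simpa [dp] using hs)⟩)
    rw [lap_left, hf.lap_corner, b5, ← mul_add] at this
    have := (mul_eq_zero.1 this).resolve_left hpos.ne'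
    simp only [lap_zero_corner, SG3.branch, Function.comp, F0_q0, e, junction_left,
      junction_right] at this ⊢
    linarith
  · have := h.headFun (m1 (R lam) + 1) _ (inner_F_q (p := 0) (a := 2) (by decide))
      ((adm_right _ _).2 ⟨(adm_bot (by decide)).2 (by simp [dp]; push_cast at e3; linarith),
        adm_top.2 (by rw [e3]; simpa [dp] using hs)⟩)
    rw [lap_right, hf.lap_corner, b4, ← mul_add] at this
    have := (mul_eq_zero.1 this).resolve_left hpos.ne'
    simp only [lap_zero_corner, SG3.branch, Function.comp, F0_q0, e, junction_left,
      junction_right] at this ⊢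
    linarith

/-- The network equations for a branching of type two. -/
theorem Harm.net_two (h0 : 0 < lam) (h1 : lam ≤ 1) (h : Harm lam u) (hi : iota1 lam = 2) :
    4 * SG3.headFun lam u (F 0 (q 1)) = u (q 0) + SG3.headFun lam u (F 0 (q 2))
      + SG3.branch lam u 1 (q 0) + SG3.branch lam u 3 (q 0) ∧
    4 * SG3.headFun lam u (F 0 (q 2)) = u (q 0) + SG3.headFun lam u (F 0 (q 1))
      + SG3.branch lam u 2 (q 0) + SG3.branch lam u 3 (q 0) ∧
    (2 * SG3.branch lam u 1 (q 0) - SG3.headFun lam u (F 0 (q 1)) - SG3.branch lam u 3 (q 0))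
        + etaT (R lam) * drop (R lam) (SG3.branch lam u 1) = 0 ∧
    (2 * SG3.branch lam u 2 (q 0) - SG3.headFun lam u (F 0 (q 2)) - SG3.branch lam u 3 (q 0))
        + etaT (R lam) * drop (R lam) (SG3.branch lam u 2) = 0 ∧
    (4 * SG3.branch lam u 3 (q 0) - SG3.headFun lam u (F 0 (q 1)) - SG3.branch lam u 1 (q 0)
        - SG3.headFun lam u (F 0 (q 2)) - SG3.branch lam u 2 (q 0))
        + etaT (R lam) * drop (R lam) (SG3.branch lam u 3) = 0 := by
  obtain ⟨hR0, hR1⟩ := R_mem h0 h1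
  have hs := (m1_spec hR0 hR1).2.1
  have e3 := three_pow_m1 h0 h1
  have hf0 := h.head_full h0 h1 (p := 0) (by rw [hi]; simp [dp])
  have hf5 := h.head_full h0 h1 (p := 5) (by rw [hi]; simp [dp])
  have hf4 := h.head_full h0 h1 (p := 4) (by rw [hi]; simp [dp])
  have b1 := h.lap_branch h0 h1 (i := 1) (by rw [hi]; decide)
  have b2 := h.lap_branch h0 h1 (i := 2) (by rw [hi]; decide)
  have b3 := h.lap_branch h0 h1 (i := 3) (by rw [hi]; decide)
  have hpos : (0 : ℝ) < (7 / 15) ^ m1 (R lam) := by positivity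
  have e := headFun_top lam u
  rw [hi] at e3
  push_cast at e3
  have hR : 3 * (3 ^ (m1 lam - 1) * lam) - 2 = R lam := by linarith
  refine ⟨?_, ?_, ?_, ?_, ?_⟩
  · have := h.headFun 1 _ (inner_F_q (p := 0) (a := 1) (by decide))
      ((adm_left _ _).2 ⟨(adm_bot (by decide)).2 (by simp [dp]; linarith),
        adm_top.2 (by simp [dp]; linarith)⟩)
    rw [lap_left] at this
    simp only [lap_zero_corner, SG3.branch, Function.comp, F0_q0, e, junction_left,
      junction_left', junction_center] at this ⊢
    linarith
  · have := h.headFun 1 _ (inner_F_q (p := 0) (a := 2) (by decide))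
      ((adm_right _ _).2 ⟨(adm_bot (by decide)).2 (by simp [dp]; linarith),
        adm_top.2 (by simp [dp]; linarith)⟩)
    rw [lap_right] at this
    simp only [lap_zero_corner, SG3.branch, Function.comp, F0_q0, e, junction_right,
      junction_right', junction_center'] at this ⊢
    linarith
  · have := h.headFun (m1 (R lam) + 1) _ (inner_F_q (p := 5) (a := 1) (by decide))
      ((adm_left' _ _).2 ⟨(adm_bot (by decide)).2 (by simp [dp]; linarith),
        adm_top.2 (by simpa [dp, hR] using hs)⟩)
    rw [lap_left', hf5.lap_corner, b1, ← mul_add] at this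
    have := (mul_eq_zero.1 this).resolve_left hpos.ne'
    simp only [lap_zero_corner, SG3.branch, Function.comp, junction_left,
      junction_left', junction_center] at this ⊢
    linarith
  · have := h.headFun (m1 (R lam) + 1) _ (inner_F_q (p := 4) (a := 2) (by decide))
      ((adm_right' _ _).2 ⟨(adm_bot (by decide)).2 (by simp [dp]; linarith),
        adm_top.2 (by simpa [dp, hR] using hs)⟩)
    rw [lap_right', hf4.lap_corner, b2, ← mul_add] at this
    have := (mul_eq_zero.1 this).resolve_left hpos.ne'
    simp only [lap_zero_corner, SG3.branch, Function.comp, junction_right,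
      junction_right', junction_center'] at this ⊢
    linarith
  · have := h.headFun (m1 (R lam) + 1) _ (inner_F_q (p := 3) (a := 0) (by decide))
      ((adm_center _ _).2 ⟨adm_top.2 (by simpa [dp, hR] using hs),
        (adm_bot (by decide)).2 (by simp [dp]; linarith),
        (adm_bot (by decide)).2 (by simp [dp]; linarith)⟩)
    rw [lap_center, hf4.lap_corner, hf5.lap_corner, b3, ← mul_add, ← mul_add] at this
    have := (mul_eq_zero.1 this).resolve_left hpos.ne'
    simp only [lap_zero_corner, SG3.branch, Function.comp, junction_left, junction_right,
      junction_left', junction_right', junction_center, junction_center'] at this ⊢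
    linarith

/-- The Haar coefficients of the boundary means of the branches. -/
noncomputable def coef (lam : ℝ) (u : Plane → ℝ) (j : ℕ) : ℝ :=
  if iota1 lam = 1 then (beta (R lam) (branch lam u 5) - beta (R lam) (branch lam u 4)) / 2
  else if j = 1 then (beta (R lam) (branch lam u 1) - beta (R lam) (branch lam u 2)) / 2
  else (beta (R lam) (branch lam u 1) + beta (R lam) (branch lam u 2)) / 2
    - beta (R lam) (branch lam u 3)

theorem Icc_one_two : Finset.Icc 1 2 = ({1, 2} : Finset ℕ) := rfl

/-- The mean over `X` is the weighted mean of the means over the branches. -/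
theorem Harm.beta_eq (h0 : 0 < lam) (h1 : lam ≤ 1) (h : Harm lam u) :
    beta lam u = ∑ i ∈ S (iota1 lam), wT lam i * beta (R lam) (SG3.branch lam u i) := by
  obtain ⟨hR0, hR1⟩ := R_mem h0 h1
  have hη := etaT_ge hR0 hR1
  rcases iota1_eq lam with hi | hi
  · obtain ⟨n5, n4⟩ := h.net_one h0 h1 hi
    rw [hi, S_one]
    simp only [wT, hi, Finset.mem_singleton, Finset.sum_insert, Finset.sum_singleton, if_true,
      show (4 : Fin 6) ≠ 5 by decide, not_false_eq_true, beta]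
    rw [drop, theta, conduct, if_pos hi]
    have e5 : SG3.headFun lam u (F 0 (q 1)) = SG3.branch lam u 5 (q 0) := by
      rw [SG3.branch, Function.comp, junction_left]
    have e4 : SG3.headFun lam u (F 0 (q 2)) = SG3.branch lam u 4 (q 0) := by
      rw [SG3.branch, Function.comp, junction_right]
    rw [e5, e4]
    have hne : etaT (R lam) ≠ 0 := by linarith
    have hne' : 1 + etaT (R lam) ≠ 0 := by linarith
    field_simp
    linear_combination n5 + n4
  · obtain ⟨n1, n2, n3, n4, n5⟩ := h.net_two h0 h1 hi
    rw [hi, S_two]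
    simp only [wT, hi, Finset.mem_insert, Finset.mem_singleton, Finset.sum_insert,
      Finset.sum_singleton, if_true, if_false, show (1 : Fin 6) ≠ 2 by decide,
      show (1 : Fin 6) ≠ 3 by decide, show (2 : Fin 6) ≠ 3 by decide, or_self, not_false_eq_true,
      beta, show (2 : ℕ) ≠ 1 by decide]
    rw [drop, theta, conduct, if_neg (by rw [hi]; decide)]
    generalize etaT (R lam) = t at *
    generalize drop (R lam) (SG3.branch lam u 1) = D1 at *
    generalize drop (R lam) (SG3.branch lam u 2) = D2 at *
    generalize drop (R lam) (SG3.branch lam u 3) = D3 at *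
    have hne : t ≠ 0 := by linarith
    have hne2 : 18 + 4 * t ≠ 0 := by linarith
    have hne3 : 9 + 2 * t ≠ 0 := by linarith
    have hne4 : 3 * t ^ 2 + 15 * t + 6 ≠ 0 := by positivity
    have e : ((6 + t) / (18 + 4 * t)) * (SG3.branch lam u 1 (q 0) - D1)
        + (((6 + t) / (18 + 4 * t)) * (SG3.branch lam u 2 (q 0) - D2)
        + ((3 + t) / (9 + 2 * t)) * (SG3.branch lam u 3 (q 0) - D3))
        = ((6 + t) * (SG3.branch lam u 1 (q 0) - D1) + (6 + t) * (SG3.branch lam u 2 (q 0) - D2)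
        + (6 + 2 * t) * (SG3.branch lam u 3 (q 0) - D3)) / (18 + 4 * t) := by
      field_simp; ring
    -- test the network equations against the potential `t² + 6t + 6`, `6 + t`, `6 + 2t` that has
    -- value `3t² + 15t + 6` at the top and vanishes at the ends of the branches
    have key : (2 * u (q 0) - SG3.headFun lam u (F 0 (q 1)) - SG3.headFun lam u (F 0 (q 2)))
        * (3 * t ^ 2 + 15 * t + 6) = t * ((18 + 4 * t) * u (q 0)
        - ((6 + t) * (SG3.branch lam u 1 (q 0) - D1) + (6 + t) * (SG3.branch lam u 2 (q 0) - D2)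
        + (6 + 2 * t) * (SG3.branch lam u 3 (q 0) - D3))) := by
      linear_combination -((t ^ 2 + 6 * t + 6) * (n1 + n2) + (6 + t) * (n3 + n4)
        + (6 + 2 * t) * n5)
    rw [e, div_div_eq_mul_div, key, mul_div_mul_left _ _ hne]
    field_simp
    ring

end network

/-! ### Energy estimates for one branching -/

section network

variable {lam : ℝ} {u : Plane → ℝ}

theorem sum_S_one {M : Type*} [AddCommMonoid M] (g : Fin 6 → M) : ∑ i ∈ S 1, g i = g 4 + g 5 := by
  rw [S_one, Finset.sum_pair (by decide)]

theorem sum_S_two {M : Type*} [AddCommMonoid M] (g : Fin 6 → M) :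
    ∑ i ∈ S 2, g i = g 1 + (g 2 + g 3) := by
  rw [S_two, Finset.sum_insert (by decide), Finset.sum_pair (by decide)]

theorem sum_Icc_one (g : ℕ → ℝ) : ∑ j ∈ Finset.Icc 1 1, g j = g 1 := by simp

theorem sum_Icc_two (g : ℕ → ℝ) : ∑ j ∈ Finset.Icc 1 2, g j = g 1 + g 2 := by
  rw [Icc_one_two, Finset.sum_pair (by decide)]

theorem headFun_left (lam : ℝ) (u : Plane → ℝ) :
    headFun lam u (F 0 (q 1)) = branch lam u 5 (q 0) := by
  rw [branch, Function.comp, junction_left]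

theorem headFun_right (lam : ℝ) (u : Plane → ℝ) :
    headFun lam u (F 0 (q 2)) = branch lam u 4 (q 0) := by
  rw [branch, Function.comp, junction_right]

theorem netE_one (hi : iota1 lam = 1) : netE lam u
    = (u (q 0) - branch lam u 5 (q 0)) ^ 2 + (branch lam u 5 (q 0) - branch lam u 4 (q 0)) ^ 2
      + (branch lam u 4 (q 0) - u (q 0)) ^ 2 := by
  simp only [netE, hi, if_true, tri, Function.comp, F0_q0, headFun_top, headFun_left, headFun_right,
    add_zero]

theorem netE_two (hi : iota1 lam = 2) : netE lam u
    = (u (q 0) - branch lam u 5 (q 0)) ^ 2 + (branch lam u 5 (q 0) - branch lam u 4 (q 0)) ^ 2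
      + (branch lam u 4 (q 0) - u (q 0)) ^ 2
      + ((branch lam u 5 (q 0) - branch lam u 1 (q 0)) ^ 2
        + (branch lam u 1 (q 0) - branch lam u 3 (q 0)) ^ 2
        + (branch lam u 3 (q 0) - branch lam u 5 (q 0)) ^ 2
      + ((branch lam u 4 (q 0) - branch lam u 3 (q 0)) ^ 2
        + (branch lam u 3 (q 0) - branch lam u 2 (q 0)) ^ 2
        + (branch lam u 2 (q 0) - branch lam u 4 (q 0)) ^ 2)) := by
  simp only [netE, hi, if_false, tri, branch, Function.comp, F0_q0, headFun_top, junction_left,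
    junction_right, junction_left', junction_right', junction_center, junction_center',
    show (2 : ℕ) ≠ 1 by decide]

/-- The drop is bounded by the energy of the top cell. -/
theorem drop_sq_le (h0 : 0 < lam) (h1 : lam ≤ 1) (u : Plane → ℝ) :
    drop lam u ^ 2 ≤ 2 * netE lam u := by
  have ht := (theta_bounds h0 h1).1
  have h2 : drop lam u ^ 2
      ≤ (2 * u (q 0) - headFun lam u (F 0 (q 1)) - headFun lam u (F 0 (q 2))) ^ 2 := by
    rw [drop, div_pow]
    exact div_le_self (sq_nonneg _) (by nlinarith)
  refine h2.trans ?_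
  have e : tri (headFun lam u ∘ F 0) ≤ netE lam u := by
    unfold netE
    have h2 := tri_nonneg (headFun lam u ∘ F 5)
    have h3 := tri_nonneg (headFun lam u ∘ F 4)
    split_ifs <;> linarith
  refine le_trans ?_ (mul_le_mul_of_nonneg_left e (by norm_num))
  simp only [tri, Function.comp, F0_q0, headFun_top]
  generalize headFun lam u (F 0 (q 1)) = x
  generalize headFun lam u (F 0 (q 2)) = y
  nlinarith [sq_nonneg (x - y)]

/-- The drop is bounded by the differences between `u q₀` and the values at the tops of the branches. -/
theorem Harm.drop_sq_le_diff (h0 : 0 < lam) (h1 : lam ≤ 1) (h : Harm lam u) :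
    drop lam u ^ 2 ≤ 2 * ∑ i ∈ S (iota1 lam), (u (q 0) - SG3.branch lam u i (q 0)) ^ 2 := by
  have ht := (theta_bounds h0 h1).1
  have h2 : drop lam u ^ 2
      ≤ (2 * u (q 0) - SG3.headFun lam u (F 0 (q 1)) - SG3.headFun lam u (F 0 (q 2))) ^ 2 := by
    rw [drop, div_pow]
    exact div_le_self (sq_nonneg _) (by nlinarith)
  refine h2.trans ?_
  rcases iota1_eq lam with hi | hi
  · rw [hi, sum_S_one, headFun_left, headFun_right]
    nlinarith [sq_nonneg (SG3.branch lam u 5 (q 0) - SG3.branch lam u 4 (q 0))]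
  · rw [hi, sum_S_two]
    obtain ⟨n1, n2, -⟩ := h.net_two h0 h1 hi
    have e : 2 * u (q 0) - SG3.headFun lam u (F 0 (q 1)) - SG3.headFun lam u (F 0 (q 2))
        = ((u (q 0) - SG3.branch lam u 1 (q 0)) + (u (q 0) - SG3.branch lam u 2 (q 0))
          + 2 * (u (q 0) - SG3.branch lam u 3 (q 0))) / 3 := by linarith
    rw [e]
    generalize u (q 0) - SG3.branch lam u 1 (q 0) = x
    generalize u (q 0) - SG3.branch lam u 2 (q 0) = y
    generalize u (q 0) - SG3.branch lam u 3 (q 0) = z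
    nlinarith [sq_nonneg (x - y), sq_nonneg (x - z), sq_nonneg (y - z), sq_nonneg x, sq_nonneg y,
      sq_nonneg z]

/-- The flux at `q₀`, at the scale of the first branching. -/
theorem theta_mul_drop (h0 : 0 < lam) (h1 : lam ≤ 1) (u : Plane → ℝ) : theta lam * drop lam u
    = 2 * u (q 0) - headFun lam u (F 0 (q 1)) - headFun lam u (F 0 (q 2)) := by
  rw [drop, mul_div_cancel₀]
  linarith [(theta_bounds h0 h1).1]

/-- The energy estimate for a branching of type two, as a statement about the potentials `a`, `p₄`,
`p₅`, `x₁`, `x₂`, `x₃` of the network and the drops `D₁`, `D₂`, `D₃` along the branches. -/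
theorem network_two_upper {a p4 p5 x1 x2 x3 D1 D2 D3 t : ℝ} (hη : 15 / 7 ≤ t)
    (n1 : 4 * p5 = a + p4 + x1 + x3) (n2 : 4 * p4 = a + p5 + x2 + x3)
    (n3 : 2 * x1 - p5 - x3 + t * D1 = 0) (n4 : 2 * x2 - p4 - x3 + t * D2 = 0)
    (n5 : 4 * x3 - p5 - x1 - p4 - x2 + t * D3 = 0) :
    (a - p5) ^ 2 + (p5 - p4) ^ 2 + (p4 - a) ^ 2
        + ((p5 - x1) ^ 2 + (x1 - x3) ^ 2 + (x3 - p5) ^ 2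
        + ((p4 - x3) ^ 2 + (x3 - x2) ^ 2 + (x2 - p4) ^ 2))
        + t * (D1 ^ 2 + (D2 ^ 2 + D3 ^ 2))
      ≤ (2 * a - p5 - p4) * (a - ((6 + t) / (18 + 4 * t) * (x1 - D1)
        + ((6 + t) / (18 + 4 * t) * (x2 - D2) + (3 + t) / (9 + 2 * t) * (x3 - D3))))
        + 6 * ((((x1 - D1) - (x2 - D2)) / 2) ^ 2
          + (((x1 - D1) + (x2 - D2)) / 2 - (x3 - D3)) ^ 2) := by
  have hne2 : 18 + 4 * t ≠ 0 := by linarith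
  have hne3 : 9 + 2 * t ≠ 0 := by linarith
  -- the Haar coefficients of the means `xᵢ - Dᵢ` of the branches
  set c1 := ((x1 - D1) - (x2 - D2)) / 2 with hc1
  set c2 := ((x1 - D1) + (x2 - D2)) / 2 - (x3 - D3) with hc2
  have e1 : (18 / 5) * c1 = -((9 / 5 + t) * (D1 - D2)) := by rw [hc1]; linarith
  have e2 : 6 * c2 = -((6 + 2 * t) * ((D1 + D2) / 2) - (6 + t) * D3) := by rw [hc2]; linarith
  have b1 : (6 + t) / (18 + 4 * t) * (x1 - D1)
      + ((6 + t) / (18 + 4 * t) * (x2 - D2) + (3 + t) / (9 + 2 * t) * (x3 - D3))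
      = (x3 - D3) + (12 + 2 * t) / (18 + 4 * t) * c2 := by
    rw [hc2]; field_simp; ring
  rw [b1]
  -- Green's formula: the equations at the nodes, multiplied by the potential minus the mean
  have green : (a - p5) ^ 2 + (p5 - p4) ^ 2 + (p4 - a) ^ 2
        + ((p5 - x1) ^ 2 + (x1 - x3) ^ 2 + (x3 - p5) ^ 2
        + ((p4 - x3) ^ 2 + (x3 - x2) ^ 2 + (x2 - p4) ^ 2))
        + t * (D1 ^ 2 + (D2 ^ 2 + D3 ^ 2))
      = (2 * a - p5 - p4) * (a - ((x3 - D3) + (12 + 2 * t) / (18 + 4 * t) * c2))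
        - t * (c1 * (D1 - D2) + c2 * (D1 + D2)
          - (12 + 2 * t) / (18 + 4 * t) * c2 * (D1 + D2 + D3)) := by
    rw [hc1, hc2]
    generalize (12 + 2 * t) / (18 + 4 * t) = k
    linear_combination
      (p5 - ((x3 - D3) + k * (((x1 - D1) + (x2 - D2)) / 2 - (x3 - D3)))) * n1
      + (p4 - ((x3 - D3) + k * (((x1 - D1) + (x2 - D2)) / 2 - (x3 - D3)))) * n2
      + (x1 - ((x3 - D3) + k * (((x1 - D1) + (x2 - D2)) / 2 - (x3 - D3)))) * n3
      + (x2 - ((x3 - D3) + k * (((x1 - D1) + (x2 - D2)) / 2 - (x3 - D3)))) * n4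
      + (x3 - ((x3 - D3) + k * (((x1 - D1) + (x2 - D2)) / 2 - (x3 - D3)))) * n5
  rw [green]
  have r1 : -(t * (c1 * (D1 - D2))) ≤ 6 * c1 ^ 2 := by
    have hc : c1 = -((9 / 5 + t) * (D1 - D2)) * (5 / 18) := by linarith
    rw [hc]
    have e : 6 * (-((9 / 5 + t) * (D1 - D2)) * (5 / 18)) ^ 2
        = -(t * (-((9 / 5 + t) * (D1 - D2)) * (5 / 18) * (D1 - D2)))
          + 5 / 18 * (9 / 5 + t) * (3 + 2 / 3 * t) * (D1 - D2) ^ 2 := by ring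
    have : 0 ≤ 5 / 18 * (9 / 5 + t) * (3 + 2 / 3 * t) * (D1 - D2) ^ 2 := by positivity
    linarith
  have r2 : -(t * (c2 * (D1 + D2) - (12 + 2 * t) / (18 + 4 * t) * c2 * (D1 + D2 + D3)))
      = 12 * t / (18 + 4 * t) * c2 ^ 2 := by
    field_simp
    linear_combination (-(2 * c2)) * e2
  have r3 : 12 * t / (18 + 4 * t) * c2 ^ 2 ≤ 6 * c2 ^ 2 := by
    refine mul_le_mul_of_nonneg_right ?_ (sq_nonneg _)
    rw [div_le_iff₀ (by linarith)]
    linarith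
  linarith

/-- The energy up to the next branching is bounded by the energy of the solution that only depends
on the means of the boundary values over the branches. -/
theorem Harm.netE_upper (h0 : 0 < lam) (h1 : lam ≤ 1) (h : Harm lam u) :
    netE lam u + etaT (R lam) * ∑ i ∈ S (iota1 lam), drop (R lam) (SG3.branch lam u i) ^ 2
      ≤ theta lam * drop lam u ^ 2
        + 6 * ∑ j ∈ Finset.Icc 1 (iota1 lam), coef lam u j ^ 2 := by
  obtain ⟨hR0, hR1⟩ := R_mem h0 h1
  have hη := etaT_ge hR0 hR1
  have hb := h.beta_eq h0 h1
  have hT := theta_mul_drop h0 h1 u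
  rw [sq (drop lam u), ← mul_assoc, hT]
  have hD : drop lam u = u (q 0) - beta lam u := by rw [beta]; ring
  rw [hD, hb]
  rcases iota1_eq lam with hi | hi
  · obtain ⟨n5, n4⟩ := h.net_one h0 h1 hi
    rw [hi, sum_S_one, sum_S_one, sum_Icc_one, netE_one hi, headFun_left, headFun_right]
    simp only [wT, hi, if_true, coef, beta]
    generalize SG3.branch lam u 5 (q 0) = x5 at *
    generalize SG3.branch lam u 4 (q 0) = x4 at *
    generalize drop (R lam) (SG3.branch lam u 5) = D5 at *
    generalize drop (R lam) (SG3.branch lam u 4) = D4 at *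
    generalize u (q 0) = a at *
    generalize etaT (R lam) = t at *
    have c0 : 6 * (((x5 - D5) - (x4 - D4)) / 2) = -((3 + t) * (D5 - D4)) := by linarith
    -- Green's formula, as for a branching of type two
    have green : (a - x5) ^ 2 + (x5 - x4) ^ 2 + (x4 - a) ^ 2 + t * (D4 ^ 2 + D5 ^ 2)
        = (2 * a - x5 - x4) * (a - (1 / 2 * (x4 - D4) + 1 / 2 * (x5 - D5)))
          - t * (((x5 - D5) - (x4 - D4)) / 2) * (D5 - D4) := by
      linear_combination (x5 - ((x4 - D4) + (x5 - D5)) / 2) * n5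
        + (x4 - ((x4 - D4) + (x5 - D5)) / 2) * n4
    rw [green]
    generalize ((x5 - D5) - (x4 - D4)) / 2 = c at *
    have hc : c = -((3 + t) * (D5 - D4)) / 6 := by linarith
    rw [hc]
    have : 0 ≤ (3 + t) * (D5 - D4) ^ 2 := by positivity
    nlinarith
  · obtain ⟨n1, n2, n3, n4, n5⟩ := h.net_two h0 h1 hi
    rw [hi, sum_S_two, sum_S_two, sum_Icc_two, netE_two hi]
    rw [headFun_left, headFun_right] at *
    simp only [wT, hi, if_true, coef, beta, if_false, show (2 : ℕ) ≠ 1 by decide,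
      show (1 : Fin 6) ≠ 3 by decide, show (2 : Fin 6) ≠ 3 by decide]
    exact network_two_upper hη n1 n2 n3 n4 n5

/-- The coefficients are bounded by the energies of this network and of those at the next branching,
which control the differences between the tops of the branches and the drops below them. -/
theorem coef_sq_le (h0 : 0 < lam) (h1 : lam ≤ 1) (u : Plane → ℝ) :
    ∑ j ∈ Finset.Icc 1 (iota1 lam), coef lam u j ^ 2
      ≤ 12 * (netE lam u + ∑ i ∈ S (iota1 lam), netE (R lam) (branch lam u i)) := by
  obtain ⟨hR0, hR1⟩ := R_mem h0 h1
  have hd := fun i => drop_sq_le hR0 hR1 (SG3.branch lam u i)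
  rcases iota1_eq lam with hi | hi
  · rw [hi, sum_S_one, sum_Icc_one, netE_one hi]
    simp only [coef, hi, if_true, beta]
    have d4 := hd 4
    have d5 := hd 5
    generalize SG3.branch lam u 5 (q 0) = x5 at *
    generalize SG3.branch lam u 4 (q 0) = x4 at *
    generalize drop (R lam) (SG3.branch lam u 5) = D5 at *
    generalize drop (R lam) (SG3.branch lam u 4) = D4 at *
    generalize netE (R lam) (SG3.branch lam u 5) = N5 at *
    generalize netE (R lam) (SG3.branch lam u 4) = N4 at *
    generalize u (q 0) = a at *
    have := sq_nonneg (a - x5)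
    have := sq_nonneg (x4 - a)
    nlinarith [sq_nonneg ((x5 - x4) + D5), sq_nonneg ((x5 - x4) - D4), sq_nonneg (D5 + D4)]
  · rw [hi, sum_S_two, sum_Icc_two, netE_two hi]
    simp only [coef, hi, if_true, beta, if_false, show (2 : ℕ) ≠ 1 by decide]
    have d1 := hd 1
    have d2 := hd 2
    have d3 := hd 3
    generalize SG3.branch lam u 5 (q 0) = p5 at *
    generalize SG3.branch lam u 4 (q 0) = p4 at *
    generalize SG3.branch lam u 1 (q 0) = x1 at *
    generalize SG3.branch lam u 2 (q 0) = x2 at *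
    generalize SG3.branch lam u 3 (q 0) = x3 at *
    generalize drop (R lam) (SG3.branch lam u 1) = D1 at *
    generalize drop (R lam) (SG3.branch lam u 2) = D2 at *
    generalize drop (R lam) (SG3.branch lam u 3) = D3 at *
    generalize netE (R lam) (SG3.branch lam u 1) = N1 at *
    generalize netE (R lam) (SG3.branch lam u 2) = N2 at *
    generalize netE (R lam) (SG3.branch lam u 3) = N3 at *
    generalize u (q 0) = a at *
    have s1 : (((x1 - D1) - (x2 - D2)) / 2) ^ 2
        ≤ (x1 - x3) ^ 2 + (x3 - x2) ^ 2 + D1 ^ 2 + D2 ^ 2 := by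
      have e : ((x1 - D1) - (x2 - D2)) / 2 = ((x1 - x3) + (x3 - x2) + -D1 + D2) / 2 := by ring
      rw [e]
      generalize x1 - x3 = A
      generalize x3 - x2 = B
      nlinarith [sq_nonneg (A - B), sq_nonneg (A + D1), sq_nonneg (A - D2), sq_nonneg (B + D1),
        sq_nonneg (B - D2), sq_nonneg (D1 + D2)]
    have s2 : (((x1 - D1) + (x2 - D2)) / 2 - (x3 - D3)) ^ 2
        ≤ 5 * ((x1 - x3) ^ 2 + (x3 - x2) ^ 2 + D1 ^ 2 + D2 ^ 2 + D3 ^ 2) := by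
      have e : ((x1 - D1) + (x2 - D2)) / 2 - (x3 - D3)
        = ((x1 - x3) / 2 + -(x3 - x2) / 2 + -D1 / 2 + -D2 / 2 + D3) := by ring
      rw [e]
      generalize x1 - x3 = A
      generalize x3 - x2 = B
      nlinarith [sq_nonneg (A / 2 + B / 2), sq_nonneg (A / 2 + D1 / 2), sq_nonneg (A / 2 + D2 / 2),
        sq_nonneg (A / 2 - D3), sq_nonneg (B / 2 - D1 / 2), sq_nonneg (B / 2 - D2 / 2),
        sq_nonneg (B / 2 + D3), sq_nonneg (D1 / 2 - D2 / 2), sq_nonneg (D1 / 2 + D3),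
        sq_nonneg (D2 / 2 + D3), sq_nonneg A, sq_nonneg B, sq_nonneg D1, sq_nonneg D2]
    have := sq_nonneg (a - p5)
    have := sq_nonneg (p5 - p4)
    have := sq_nonneg (p4 - a)
    have := sq_nonneg (p5 - x1)
    have := sq_nonneg (x3 - p5)
    have := sq_nonneg (p4 - x3)
    have := sq_nonneg (x2 - p4)
    have := sq_nonneg (x1 - x3)
    have := sq_nonneg (x3 - x2)
    have := sq_nonneg D3
    linarith

/-- The values of the Haar functions, in terms of `wT`. -/
noncomputable def haarT (lam : ℝ) (j : ℕ) (i : Fin 6) : ℝ :=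
  if iota1 lam = 1 then (if i = 5 then 1 else -1)
  else if j = 1 then (if i = 1 then 1 else if i = 2 then -1 else 0)
  else (if i = 3 then -2 * wT lam 1 else wT lam 3)

theorem wT_two_sum (h0 : 0 < lam) (h1 : lam ≤ 1) (hi : iota1 lam = 2) :
    2 * wT lam 1 + wT lam 3 = 1 ∧ wT lam 2 = wT lam 1 := by
  have h := sum_wT h0 h1
  rw [hi, sum_S_two] at h
  have e : wT lam 2 = wT lam 1 := by simp [wT, hi]
  exact ⟨by linarith, e⟩

/-- One step of the Haar expansion of the boundary means. -/
theorem Harm.beta_branch (h0 : 0 < lam) (h1 : lam ≤ 1) (h : Harm lam u) {i : Fin 6}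
    (hiS : i ∈ S (iota1 lam)) : beta (R lam) (SG3.branch lam u i)
      = beta lam u + ∑ j ∈ Finset.Icc 1 (iota1 lam), coef lam u j * haarT lam j i := by
  have hb := h.beta_eq h0 h1
  rcases iota1_eq lam with hi | hi
  · rw [hb, hi, sum_S_one, sum_Icc_one]
    rw [hi, S_one] at hiS
    simp only [Finset.mem_insert, Finset.mem_singleton] at hiS
    simp only [wT, haarT, coef, hi, if_true]
    rcases hiS with rfl | rfl
    · rw [if_neg (by decide)]; ring
    · rw [if_pos rfl]; ring
  · obtain ⟨w1, w2⟩ := wT_two_sum h0 h1 hi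
    rw [hb, hi, sum_S_two, sum_Icc_two, w2]
    rw [hi, S_two] at hiS
    simp only [Finset.mem_insert, Finset.mem_singleton] at hiS
    have e3 : wT lam 3 = 1 - 2 * wT lam 1 := by linarith
    simp only [haarT, coef, hi, if_true, if_false, show (2 : ℕ) ≠ 1 by decide, e3]
    rcases hiS with rfl | rfl | rfl <;> simp <;> ring

/-- The coefficients are the Haar coefficients with respect to the weights. -/
theorem coef_eq (h0 : 0 < lam) (h1 : lam ≤ 1) (u : Plane → ℝ) {j : ℕ}
    (hj : j ∈ Finset.Icc 1 (iota1 lam)) :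
    coef lam u j = (∑ i ∈ S (iota1 lam), haarT lam j i ^ 2 * wT lam i)⁻¹
      * ∑ i ∈ S (iota1 lam), haarT lam j i * (wT lam i * beta (R lam) (branch lam u i)) := by
  rcases iota1_eq lam with hi | hi
  · rw [hi, sum_S_one, sum_S_one]
    simp [wT, haarT, coef, hi]; ring
  · obtain ⟨w1, w2⟩ := wT_two_sum h0 h1 hi
    have p1 := (wT_bounds h0 h1 1).1
    have p3 := (wT_bounds h0 h1 3).1
    rw [hi, sum_S_two, sum_S_two, w2]
    rw [hi, Icc_one_two] at hj
    simp only [Finset.mem_insert, Finset.mem_singleton] at hj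
    simp only [haarT, coef, hi, if_false, show (2 : ℕ) ≠ 1 by decide]
    generalize wT lam 1 = x at *
    generalize wT lam 3 = y at *
    have hx : x ≠ 0 := by linarith
    have hy : y ≠ 0 := by linarith
    rcases hj with rfl | rfl
    · simp
      field_simp
      ring
    · simp
      have e : y ^ 2 * x + (y ^ 2 * x + (2 * x) ^ 2 * y) = 2 * x * y := by
        linear_combination (2 * x * y) * w1
      rw [e]
      field_simp
      ring

end network

/-! ### Functions on the gasket defined by self-similar systems -/

theorem exists_cell {z : Plane} (hz : z ∈ gasket) (n : ℕ) :
    ∃ w : Fin n → Fin 6, z ∈ cell (List.ofFn w) := by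
  induction n generalizing z with
  | zero => exact ⟨Fin.elim0, by simpa [mem_cell_nil] using hz⟩
  | succ n ih =>
    obtain ⟨p, z', hz', rfl⟩ := exists_F hz
    obtain ⟨w, hw⟩ := ih hz'
    exact ⟨Fin.cons p w, by simpa [List.ofFn_succ, mem_cell_cons] using hw⟩

theorem Fword_continuous (w : List (Fin 6)) : Continuous (Fword w) := by
  induction w with
  | nil => exact continuous_id
  | cons p w ih => exact (F_continuous p).comp ih

theorem cell_isClosed (w : List (Fin 6)) : IsClosed (cell w) :=
  (gasket_isCompact.image (Fword_continuous w)).isClosed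

/-- Three times the barycentric coordinates of `F p (q a)`. -/
def vertexCoord (p : Fin 6) (a c : Fin 3) : ℕ :=
  (![![2, 0, 0], ![0, 2, 0], ![0, 0, 2], ![0, 1, 1], ![1, 0, 1], ![1, 1, 0]] :
    Fin 6 → Fin 3 → ℕ) p c
    + if a = c then 1 else 0

theorem bary_vertex (p : Fin 6) (a c : Fin 3) : bary (F p (q a)) c = vertexCoord p a c / 3 := by
  rw [bary_F, bary_q, vertexCoord]
  congr 1
  rw [add_comm, Nat.cast_add]
  congr 1
  · fin_cases p <;> fin_cases c <;> simp [off]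
  · split_ifs <;> simp

/-- A table of values at the vertices of the first level is consistent once it respects the seven
junctions. -/
theorem eq_of_F_q_eq {f : Fin 6 → Fin 3 → ℝ} (h1 : f 0 1 = f 5 0) (h2 : f 0 2 = f 4 0)
    (h3 : f 5 1 = f 1 0) (h4 : f 4 2 = f 2 0) (h5 : f 1 2 = f 3 1) (h6 : f 2 1 = f 3 2)
    (h7 : f 5 2 = f 3 0) (h8 : f 4 1 = f 3 0) {p p' : Fin 6} {a b : Fin 3}
    (h : F p (q a) = F p' (q b)) : f p a = f p' b := by
  have hc : ∀ c, vertexCoord p a c = vertexCoord p' b c := fun c => by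
    have := congrFun (congrArg bary h) c
    rw [bary_vertex, bary_vertex] at this
    have h3 : (vertexCoord p a c : ℝ) = vertexCoord p' b c := by linarith
    exact_mod_cast h3
  have key : ∀ p a p' b, (∀ c, vertexCoord p a c = vertexCoord p' b c) → (p = p' ∧ a = b) ∨
      (p, a, p', b) ∈ ([(0, 1, 5, 0), (0, 2, 4, 0), (5, 1, 1, 0), (4, 2, 2, 0), (1, 2, 3, 1),
        (2, 1, 3, 2), (5, 2, 3, 0), (4, 1, 3, 0), (5, 2, 4, 1)] :
          List (Fin 6 × Fin 3 × Fin 6 × Fin 3)) ∨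
      (p', b, p, a) ∈ ([(0, 1, 5, 0), (0, 2, 4, 0), (5, 1, 1, 0), (4, 2, 2, 0), (1, 2, 3, 1),
        (2, 1, 3, 2), (5, 2, 3, 0), (4, 1, 3, 0), (5, 2, 4, 1)] :
          List (Fin 6 × Fin 3 × Fin 6 × Fin 3)) := by
    unfold vertexCoord
    decide +kernel
  have h9 : f 5 2 = f 4 1 := h7.trans h8.symm
  rcases key p a p' b hc with ⟨rfl, rfl⟩ | h | h
  · rfl
  · simp only [List.mem_cons, Prod.mk.injEq, List.not_mem_nil, or_false] at h
    rcases h with ⟨rfl, rfl, rfl, rfl⟩ | ⟨rfl, rfl, rfl, rfl⟩ | ⟨rfl, rfl, rfl, rfl⟩ |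
      ⟨rfl, rfl, rfl, rfl⟩ | ⟨rfl, rfl, rfl, rfl⟩ | ⟨rfl, rfl, rfl, rfl⟩ | ⟨rfl, rfl, rfl, rfl⟩ |
      ⟨rfl, rfl, rfl, rfl⟩ | ⟨rfl, rfl, rfl, rfl⟩ <;> assumption
  · simp only [List.mem_cons, Prod.mk.injEq, List.not_mem_nil, or_false] at h
    rcases h with ⟨rfl, rfl, rfl, rfl⟩ | ⟨rfl, rfl, rfl, rfl⟩ | ⟨rfl, rfl, rfl, rfl⟩ |
      ⟨rfl, rfl, rfl, rfl⟩ | ⟨rfl, rfl, rfl, rfl⟩ | ⟨rfl, rfl, rfl, rfl⟩ | ⟨rfl, rfl, rfl, rfl⟩ |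
      ⟨rfl, rfl, rfl, rfl⟩ | ⟨rfl, rfl, rfl, rfl⟩ <;> symm <;> assumption

/-- A self-similar system of functions on the gasket: the function of state `s`, composed with
`F p`, is the function of state `step s p`; it takes the value `cv s a` at `q a`, and its values lie
between `lo s` and `hi s`. The functions exist and are continuous because the values agree at the
junctions and the widths `hi - lo` tend to zero uniformly. -/
structure SelfSimilar (σ : Type) where
  step : σ → Fin 6 → σ
  cv : σ → Fin 3 → ℝ
  lo : σ → ℝ
  hi : σ → ℝ
  corner : ∀ s a, cv (step s (cr a)) a = cv s a
  junction : ∀ s p a p' b, F p (q a) = F p' (q b) → cv (step s p) a = cv (step s p') b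
  lo_le : ∀ s a, lo s ≤ cv s a
  le_hi : ∀ s a, cv s a ≤ hi s
  lo_step : ∀ s p, lo s ≤ lo (step s p)
  hi_step : ∀ s p, hi (step s p) ≤ hi s
  small : ∀ s, ∀ ε > 0, ∃ N, ∀ w : List (Fin 6), w.length = N →
    hi (w.foldl step s) - lo (w.foldl step s) < ε

namespace SelfSimilar

variable {σ : Type} (T : SelfSimilar σ)

/-- The state after the first `n` letters of `w`. -/
def run (s : σ) (w : ℕ → Fin 6) : ℕ → σ
  | 0 => s
  | n + 1 => T.step (run s w n) (w n)

theorem run_succ' (s : σ) (w : ℕ → Fin 6) (n : ℕ) :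
    T.run s w (n + 1) = T.run (T.step s (w 0)) (fun k => w (k + 1)) n := by
  induction n with
  | zero => rfl
  | succ n ih => rw [run, ih]; rfl

theorem run_eq_foldl (s : σ) (w : ℕ → Fin 6) (n : ℕ) :
    T.run s w n = (List.ofFn fun k : Fin n => w k).foldl T.step s := by
  induction n generalizing s w with
  | zero => rfl
  | succ n ih => rw [run_succ', ih, List.ofFn_succ]; rfl

theorem lo_mono (s : σ) (w : ℕ → Fin 6) : Monotone fun n => T.lo (T.run s w n) :=
  monotone_nat_of_le_succ fun _ => T.lo_step _ _

theorem hi_anti (s : σ) (w : ℕ → Fin 6) : Antitone fun n => T.hi (T.run s w n) :=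
  antitone_nat_of_succ_le fun _ => T.hi_step _ _

theorem lo_le_hi (s : σ) : T.lo s ≤ T.hi s := (T.lo_le s 0).trans (T.le_hi s 0)

/-- The value of the function of state `s` at the point with address `w`. -/
noncomputable def val (s : σ) (w : ℕ → Fin 6) : ℝ := ⨆ n, T.lo (T.run s w n)

theorem bdd (s : σ) (w : ℕ → Fin 6) : BddAbove (Set.range fun n => T.lo (T.run s w n)) :=
  ⟨T.hi s, by rintro _ ⟨n, rfl⟩; exact (T.lo_le_hi _).trans (T.hi_anti s w (Nat.zero_le n))⟩

theorem tendsto_lo (s : σ) (w : ℕ → Fin 6) :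
    Tendsto (fun n => T.lo (T.run s w n)) atTop (𝓝 (T.val s w)) :=
  tendsto_atTop_ciSup (T.lo_mono s w) (T.bdd s w)

theorem lo_le_val (s : σ) (w : ℕ → Fin 6) : T.lo s ≤ T.val s w := le_ciSup (T.bdd s w) 0

theorem val_le_hi (s : σ) (w : ℕ → Fin 6) : T.val s w ≤ T.hi s :=
  ciSup_le fun n => (T.lo_le_hi _).trans (T.hi_anti s w (Nat.zero_le n))

theorem val_step (s : σ) (w : ℕ → Fin 6) :
    T.val s w = T.val (T.step s (w 0)) fun k => w (k + 1) := by
  refine tendsto_nhds_unique ((T.tendsto_lo s w).comp (tendsto_add_atTop_nat 1)) ?_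
  refine (T.tendsto_lo (T.step s (w 0)) fun k => w (k + 1)).congr fun n => ?_
  simp only [Function.comp, run_succ']

theorem tendsto_width (s : σ) (w : ℕ → Fin 6) :
    Tendsto (fun n => T.hi (T.run s w n) - T.lo (T.run s w n)) atTop (𝓝 0) := by
  rw [Metric.tendsto_atTop]
  intro ε hε
  obtain ⟨N, hN⟩ := T.small s ε hε
  refine ⟨N, fun n hn => ?_⟩
  have h1 := hN _ (List.length_ofFn (f := fun k : Fin N => w k))
  rw [← run_eq_foldl] at h1
  have h2 := T.lo_mono s w hn
  have h3 := T.hi_anti s w hn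
  have h4 := T.lo_le_hi (T.run s w n)
  rw [Real.dist_eq, sub_zero, abs_of_nonneg (by linarith)]
  simp only at h2 h3
  linarith

/-- The orbit of `z` under the inverses of the contractions named by `w`. -/
noncomputable def orb (w : ℕ → Fin 6) (z : Plane) : ℕ → Plane
  | 0 => z
  | n + 1 => G (w n) (orb w z n)

theorem orb_succ' (w : ℕ → Fin 6) (z : Plane) (n : ℕ) :
    orb w z (n + 1) = orb (fun k => w (k + 1)) (G (w 0) z) n := by
  induction n with
  | zero => rfl
  | succ n ih => rw [orb, ih]; rfl

/-- `w` is an address of `z`. -/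
def IsAddr (w : ℕ → Fin 6) (z : Plane) : Prop := ∀ n, orb w z n ∈ gasket

theorem IsAddr.tail {w : ℕ → Fin 6} {z : Plane} (h : IsAddr w z) :
    IsAddr (fun k => w (k + 1)) (G (w 0) z) := fun n => by
  rw [← orb_succ']; exact h _

theorem exists_addr {z : Plane} (hz : z ∈ gasket) : ∃ w, IsAddr w z := by
  have h : ∀ z : gasket, ∃ p, G p z ∈ gasket := fun z => by
    obtain ⟨p, z', hz', e⟩ := exists_F z.2
    exact ⟨p, by rwa [← e, G_F]⟩
  choose d hd using h
  let nxt : gasket → gasket := fun z => ⟨G (d z) z, hd z⟩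
  refine ⟨fun n => d (nxt^[n] ⟨z, hz⟩), fun n => ?_⟩
  have : orb (fun n => d (nxt^[n] ⟨z, hz⟩)) z n = nxt^[n] ⟨z, hz⟩ := by
    induction n with
    | zero => rfl
    | succ n ih => rw [orb, ih, Function.iterate_succ_apply']
  rw [this]
  exact (nxt^[n] ⟨z, hz⟩).2

theorem val_corner (s : σ) {w : ℕ → Fin 6} {a : Fin 3} (h : IsAddr w (q a)) :
    T.val s w = T.cv s a := by
  have key : ∀ n, ∀ s, ∀ w, IsAddr w (q a) → T.cv (T.run s w n) a = T.cv s a := by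
    intro n
    induction n with
    | zero => exact fun s w _ => rfl
    | succ n ih =>
      intro s w h
      have h1 : w 0 = cr a := (eq_of_F_eq_q (h 1) (F_G _ _)).1
      have h2 := h.tail
      rw [h1, G_cr] at h2
      rw [run_succ', ih _ _ h2, h1, T.corner]
  refine tendsto_nhds_unique (T.tendsto_lo s w) ?_
  have h2 : Tendsto (fun n => T.cv s a - (T.hi (T.run s w n) - T.lo (T.run s w n))) atTop
      (𝓝 (T.cv s a)) := by simpa using (T.tendsto_width s w).const_sub (T.cv s a)
  refine tendsto_of_tendsto_of_tendsto_of_le_of_le h2 tendsto_const_nhds (fun n => ?_) fun n => ?_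
  · have := T.le_hi (T.run s w n) a
    rw [key n s w h] at this
    simp only
    linarith
  · have := T.lo_le (T.run s w n) a
    rwa [key n s w h] at this

/-- The value does not depend on the address: where two addresses of a point part, the point is a
junction. -/
theorem val_unique (s : σ) {w w' : ℕ → Fin 6} {z : Plane} (h : IsAddr w z) (h' : IsAddr w' z) :
    T.val s w = T.val s w' := by
  have key : ∀ N, ∀ s z w w', IsAddr w z → IsAddr w' z → (∀ n < N, w n = w' n) → w N ≠ w' N →
      T.val s w = T.val s w' := by
    intro N
    induction N with
    | zero =>
      intro s z w w' h h' _ hne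
      have e : F (w 0) (G (w 0) z) = F (w' 0) (G (w' 0) z) := by rw [F_G, F_G]
      obtain ⟨a, b, ha, hb⟩ := exists_corner_of_F_eq hne (h 1) (h' 1) e
      have t := h.tail
      have t' := h'.tail
      change G (w 0) z = q a at ha
      change G (w' 0) z = q b at hb
      rw [ha] at t e
      rw [hb] at t' e
      rw [T.val_step s w, T.val_step s w', T.val_corner _ t, T.val_corner _ t']
      exact T.junction s _ _ _ _ e
    | succ N ih =>
      intro s z w w' h h' hlt hne
      have e0 : w 0 = w' 0 := hlt 0 (Nat.succ_pos N)
      rw [T.val_step s w, T.val_step s w', ← e0]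
      refine ih _ (G (w 0) z) _ _ h.tail ?_ (fun n hn => hlt _ (by omega)) hne
      rw [e0]; exact h'.tail
  by_cases hw : w = w'
  · rw [hw]
  have hex : ∃ n, w n ≠ w' n := by
    by_contra hc; push Not at hc; exact hw (funext hc)
  classical
  exact key (Nat.find hex) s z w w' h h'
    (fun n hn => by simpa using Nat.find_min hex hn) (Nat.find_spec hex)

open Classical in
/-- The function of state `s`. -/
noncomputable def fn (s : σ) (z : Plane) : ℝ :=
  if h : z ∈ gasket then T.val s (exists_addr h).choose else 0

theorem fn_eq (s : σ) {z : Plane} (hz : z ∈ gasket) {w : ℕ → Fin 6} (h : IsAddr w z) :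
    T.fn s z = T.val s w := by
  rw [fn, dif_pos hz]
  exact T.val_unique s (exists_addr hz).choose_spec h

theorem fn_F (s : σ) (p : Fin 6) {z : Plane} (hz : z ∈ gasket) :
    T.fn s (F p z) = T.fn (T.step s p) z := by
  obtain ⟨w, hw⟩ := exists_addr hz
  let w' : ℕ → Fin 6 := fun n => Nat.casesOn n p w
  have e : ∀ n, orb w' (F p z) (n + 1) = orb w z n := fun n => by
    rw [orb_succ']
    change orb w (G p (F p z)) n = _
    rw [G_F]
  have h' : IsAddr w' (F p z) := fun n => by
    rcases n with _ | n
    · exact F_mem p hz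
    · rw [e]; exact hw n
  rw [T.fn_eq s (F_mem p hz) h', T.fn_eq _ hz hw, T.val_step]
  rfl

theorem fn_corner (s : σ) (a : Fin 3) : T.fn s (q a) = T.cv s a := by
  obtain ⟨w, hw⟩ := exists_addr (q_mem a)
  rw [T.fn_eq s (q_mem a) hw, T.val_corner s hw]

theorem fn_mem (s : σ) {z : Plane} (hz : z ∈ gasket) : T.lo s ≤ T.fn s z ∧ T.fn s z ≤ T.hi s := by
  rw [fn, dif_pos hz]
  exact ⟨T.lo_le_val _ _, T.val_le_hi _ _⟩

theorem fn_Fword (s : σ) (w : List (Fin 6)) {z : Plane} (hz : z ∈ gasket) :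
    T.fn s (Fword w z) = T.fn (w.foldl T.step s) z := by
  induction w generalizing s with
  | nil => rfl
  | cons p w ih => rw [Fword_cons, T.fn_F s p (Fword_mem w hz), ih]; rfl

theorem fn_continuousOn (s : σ) : ContinuousOn (T.fn s) gasket := by
  intro z hz
  rw [ContinuousWithinAt, Metric.tendsto_nhds]
  intro ε hε
  obtain ⟨N, hN⟩ := T.small s ε hε
  -- near `z` there are only points of the cells of level `N` that contain `z`
  have hU : ∀ᶠ y in 𝓝 z, ∀ w : Fin N → Fin 6, z ∉ cell (List.ofFn w) → y ∉ cell (List.ofFn w) := by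
    rw [eventually_all]
    intro w
    by_cases hw : z ∈ cell (List.ofFn w)
    · exact Eventually.of_forall fun y h => absurd hw h
    · filter_upwards [(cell_isClosed (List.ofFn w)).isOpen_compl.mem_nhds hw] with y hy _ using hy
  filter_upwards [mem_nhdsWithin_of_mem_nhds hU, self_mem_nhdsWithin] with y hy hyK
  obtain ⟨w, hw⟩ := exists_cell hyK N
  have hzw : z ∈ cell (List.ofFn w) := by
    by_contra hc; exact hy w hc hw
  obtain ⟨y', hy', rfl⟩ := hw
  obtain ⟨z', hz', rfl⟩ := hzw
  have h1 := hN _ (List.length_ofFn (f := w))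
  rw [T.fn_Fword s _ hy', T.fn_Fword s _ hz']
  have h2 := T.fn_mem ((List.ofFn w).foldl T.step s) hy'
  have h3 := T.fn_mem ((List.ofFn w).foldl T.step s) hz'
  rw [Real.dist_eq, abs_sub_lt_iff]
  constructor <;> linarith

end SelfSimilar

/-! ### Existence of `h₀` -/

theorem m1_of_lt {lam : ℝ} (h0 : 0 < lam) (h1 : lam ≤ 1) (h : 1 < 3 * lam) : m1 lam = 1 := by
  refine le_antisymm (Nat.sInf_le (by simpa using h)) (m1_spec h0 h1).1

theorem m1_three {lam : ℝ} (h0 : 0 < lam) (h : 3 * lam ≤ 1) : m1 lam = m1 (3 * lam) + 1 := by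
  have h1 : lam ≤ 1 := by linarith
  obtain ⟨a1, a2, a3⟩ := m1_spec h0 h1
  obtain ⟨b1, b2, b3⟩ := m1_spec (by positivity : 0 < 3 * lam) h
  refine le_antisymm (Nat.sInf_le ?_) ?_
  · change 1 < 3 ^ (m1 (3 * lam) + 1) * lam
    rw [pow_succ, mul_assoc]; exact b2
  · have h2 : m1 lam ≠ 1 := fun e => by rw [e] at a2; linarith
    obtain ⟨k, hk⟩ := Nat.exists_eq_add_of_le' a1
    have : m1 (3 * lam) ≤ k := Nat.sInf_le (by
      change 1 < 3 ^ k * (3 * lam)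
      rw [hk, pow_succ, mul_assoc] at a2; exact a2)
    omega

theorem iota1_three {lam : ℝ} (h0 : 0 < lam) (h : 3 * lam ≤ 1) : iota1 lam = iota1 (3 * lam) := by
  unfold iota1
  rw [m1_three h0 h, pow_succ, mul_assoc]

theorem R_three {lam : ℝ} (h0 : 0 < lam) (h : 3 * lam ≤ 1) : R lam = R (3 * lam) := by
  unfold R
  rw [iota1_three h0 h, m1_three h0 h, pow_succ, mul_assoc]

theorem etaT_three {lam : ℝ} (h0 : 0 < lam) (h : 3 * lam ≤ 1) :
    etaT lam = 15 / 7 * etaT (3 * lam) := by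
  rw [etaT_eq h0 (by linarith), etaT_eq (by positivity) h, theta, theta, iota1_three h0 h,
    R_three h0 h, m1_three h0 h, pow_succ]
  ring

theorem etaT_one {lam : ℝ} (h0 : 0 < lam) (h : 1 < 3 * lam) (h2 : 3 * lam ≤ 2) :
    etaT lam = 15 / 7 * (2 * etaT (3 * lam - 1) / (1 + etaT (3 * lam - 1))) := by
  have hm := m1_of_lt h0 (by linarith) h
  have hi : iota1 lam = 1 := by rw [iota1, hm, pow_one, if_pos h2]
  rw [etaT_eq h0 (by linarith), theta, R, hi, hm, conduct, if_pos rfl]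
  simp

theorem etaT_two {lam : ℝ} (h0 : 0 < lam) (h1 : lam ≤ 1) (h2 : 2 < 3 * lam) :
    etaT lam = 15 / 7 * (etaT (3 * lam - 2) * (18 + 4 * etaT (3 * lam - 2))
      / (3 * etaT (3 * lam - 2) ^ 2 + 15 * etaT (3 * lam - 2) + 6)) := by
  have hm := m1_of_lt h0 h1 (by linarith)
  have hi : iota1 lam = 2 := by rw [iota1, hm, pow_one, if_neg (by linarith)]
  rw [etaT_eq h0 h1, theta, R, hi, hm, conduct, if_neg (by decide)]
  simp

/-- Induction on the number of magnifications by `3` that bring `lam` above `1 / 3`. -/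
theorem scale_induction {Q : ℝ → Prop} (hbig : ∀ lam, 0 < lam → lam ≤ 1 → 1 < 3 * lam → Q lam)
    (hstep : ∀ lam, 0 < lam → 3 * lam ≤ 1 → Q (3 * lam) → Q lam) {lam : ℝ} (h0 : 0 < lam)
    (h1 : lam ≤ 1) : Q lam := by
  obtain ⟨n, hn⟩ := pow_unbounded_of_one_lt (1 / lam) (by norm_num : (1 : ℝ) < 3)
  rw [div_lt_iff₀ h0] at hn
  induction n generalizing lam with
  | zero => simp at hn; linarith
  | succ n ih =>
    by_cases hc : 3 * lam ≤ 1
    · exact hstep lam h0 hc (ih (by positivity) hc (by rw [pow_succ] at hn; linarith))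
    · exact hbig lam h0 h1 (not_le.1 hc)

/-- The boundary values on the cell `F p` of the harmonic function with boundary values `P`. -/
noncomputable def extend (P : Fin 3 → ℝ) : Fin 6 → Fin 3 → ℝ :=
  ![![P 0, (8 * P 0 + 4 * P 1 + 3 * P 2) / 15, (8 * P 0 + 3 * P 1 + 4 * P 2) / 15],
    ![(4 * P 0 + 8 * P 1 + 3 * P 2) / 15, P 1, (3 * P 0 + 8 * P 1 + 4 * P 2) / 15],
    ![(4 * P 0 + 3 * P 1 + 8 * P 2) / 15, (3 * P 0 + 4 * P 1 + 8 * P 2) / 15, P 2],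
    ![(P 0 + P 1 + P 2) / 3, (3 * P 0 + 8 * P 1 + 4 * P 2) / 15,
      (3 * P 0 + 4 * P 1 + 8 * P 2) / 15],
    ![(8 * P 0 + 3 * P 1 + 4 * P 2) / 15, (P 0 + P 1 + P 2) / 3,
      (4 * P 0 + 3 * P 1 + 8 * P 2) / 15],
    ![(8 * P 0 + 4 * P 1 + 3 * P 2) / 15, (4 * P 0 + 8 * P 1 + 3 * P 2) / 15,
      (P 0 + P 1 + P 2) / 3]]

/-- The states of the system that defines `h₀`: on a cell inside the domain the function is harmonic
with boundary values `P`; on a cell cut by the boundary it is `t * h₀` for the residual parameter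
`lam`, extended by zero below the boundary. -/
inductive CellState where
  | full (P : Fin 3 → ℝ) : CellState
  | cut (t lam : ℝ) (ht : 0 ≤ t) (h0 : 0 < lam) (h1 : lam ≤ 1) : CellState

namespace CellState

/-- The potential at the ends of the branches of type one. -/
noncomputable def potX (t eta : ℝ) : ℝ := t / (1 + eta)
/-- The potential at `F₀ q₁` and `F₀ q₂` in a branching of type two. -/
noncomputable def potP (t eta : ℝ) : ℝ :=
  t * (eta ^ 2 + 6 * eta + 6) / (3 * eta ^ 2 + 15 * eta + 6)
/-- The potential at the ends of the outer branches of type two. -/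
noncomputable def potR (t eta : ℝ) : ℝ := t * (6 + eta) / (3 * eta ^ 2 + 15 * eta + 6)
/-- The potential at the end of the middle branch of type two. -/
noncomputable def potC (t eta : ℝ) : ℝ := t * (6 + 2 * eta) / (3 * eta ^ 2 + 15 * eta + 6)

theorem potX_mem {t eta : ℝ} (ht : 0 ≤ t) (he : 15 / 7 ≤ eta) :
    0 ≤ potX t eta ∧ potX t eta ≤ t / 2 := by
  refine ⟨div_nonneg ht (by linarith), div_le_div_of_nonneg_left ht (by norm_num) (by linarith)⟩

theorem potP_mem {t eta : ℝ} (ht : 0 ≤ t) (he : 15 / 7 ≤ eta) :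
    0 ≤ potP t eta ∧ potP t eta ≤ t := by
  have : 0 ≤ eta := by linarith
  refine ⟨by unfold potP; positivity, ?_⟩
  rw [potP, div_le_iff₀ (by positivity)]
  exact mul_le_mul_of_nonneg_left (by nlinarith) ht

theorem potR_mem {t eta : ℝ} (ht : 0 ≤ t) (he : 15 / 7 ≤ eta) :
    0 ≤ potR t eta ∧ potR t eta ≤ t / 2 := by
  have : 0 ≤ eta := by linarith
  refine ⟨by unfold potR; positivity, ?_⟩
  rw [potR, div_le_iff₀ (by positivity), div_mul_eq_mul_div, mul_div_assoc]
  exact mul_le_mul_of_nonneg_left (by nlinarith) ht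

theorem potC_mem {t eta : ℝ} (ht : 0 ≤ t) (he : 15 / 7 ≤ eta) :
    0 ≤ potC t eta ∧ potC t eta ≤ t / 2 := by
  have : 0 ≤ eta := by linarith
  refine ⟨by unfold potC; positivity, ?_⟩
  rw [potC, div_le_iff₀ (by positivity), div_mul_eq_mul_div, mul_div_assoc]
  exact mul_le_mul_of_nonneg_left (by nlinarith) ht

theorem eta_ge_one {lam : ℝ} (h : ¬ 3 * lam ≤ 1) (h2 : 3 * lam ≤ 2) : 15 / 7 ≤ etaT (3 * lam - 1) :=
  etaT_ge (by linarith) (by linarith)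

theorem eta_ge_two {lam : ℝ} (h1 : lam ≤ 1) (h2 : ¬ 3 * lam ≤ 2) : 15 / 7 ≤ etaT (3 * lam - 2) :=
  etaT_ge (by linarith) (by linarith)

open Classical in
/-- The state of the cell `F p` inside a cell of a given state. -/
noncomputable def step : CellState → Fin 6 → CellState
  | full P, p => full (extend P p)
  | cut t lam ht h0 h1, p =>
    if h : 3 * lam ≤ 1 then ![cut t (3 * lam) ht (by positivity) h, full 0, full 0, full 0, full 0,
      full 0] p
    else if h2 : 3 * lam ≤ 2 then
      ![full ![t, potX t (etaT (3 * lam - 1)), potX t (etaT (3 * lam - 1))], full 0, full 0, full 0,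
        cut (potX t (etaT (3 * lam - 1))) (3 * lam - 1) (potX_mem ht (eta_ge_one h h2)).1
          (by linarith) (by linarith),
        cut (potX t (etaT (3 * lam - 1))) (3 * lam - 1) (potX_mem ht (eta_ge_one h h2)).1
          (by linarith) (by linarith)] p
    else
      ![full ![t, potP t (etaT (3 * lam - 2)), potP t (etaT (3 * lam - 2))],
        cut (potR t (etaT (3 * lam - 2))) (3 * lam - 2) (potR_mem ht (eta_ge_two h1 h2)).1
          (by linarith) (by linarith),
        cut (potR t (etaT (3 * lam - 2))) (3 * lam - 2) (potR_mem ht (eta_ge_two h1 h2)).1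
          (by linarith) (by linarith),
        cut (potC t (etaT (3 * lam - 2))) (3 * lam - 2) (potC_mem ht (eta_ge_two h1 h2)).1
          (by linarith) (by linarith),
        full ![potP t (etaT (3 * lam - 2)), potC t (etaT (3 * lam - 2)),
          potR t (etaT (3 * lam - 2))],
        full ![potP t (etaT (3 * lam - 2)), potR t (etaT (3 * lam - 2)),
          potC t (etaT (3 * lam - 2))]] p

/-- The values at the corners. -/
noncomputable def cv : CellState → Fin 3 → ℝ
  | full P => P
  | cut t _ _ _ _ => ![t, 0, 0]

/-- The least corner value. -/
noncomputable def lo : CellState → ℝ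
  | full P => min (P 0) (min (P 1) (P 2))
  | cut _ _ _ _ _ => 0

/-- The greatest corner value. -/
noncomputable def hi : CellState → ℝ
  | full P => max (P 0) (max (P 1) (P 2))
  | cut t _ _ _ _ => t

theorem lo_full_le (P : Fin 3 → ℝ) (a : Fin 3) : lo (full P) ≤ P a := by
  fin_cases a <;> simp [lo]

theorem le_hi_full (P : Fin 3 → ℝ) (a : Fin 3) : P a ≤ hi (full P) := by
  fin_cases a <;> simp [hi]

theorem le_lo_full {P : Fin 3 → ℝ} {x : ℝ} (h : ∀ a, x ≤ P a) : x ≤ lo (full P) :=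
  le_min (h 0) (le_min (h 1) (h 2))

theorem hi_full_le {P : Fin 3 → ℝ} {x : ℝ} (h : ∀ a, P a ≤ x) : hi (full P) ≤ x :=
  max_le (h 0) (max_le (h 1) (h 2))

theorem extend_corner (P : Fin 3 → ℝ) (a : Fin 3) : extend P (cr a) a = P a := by
  fin_cases a <;> simp [extend]

theorem extend_mem {P : Fin 3 → ℝ} {x y : ℝ} (h : ∀ a, x ≤ P a ∧ P a ≤ y) (p : Fin 6) (a : Fin 3) :
    x ≤ extend P p a ∧ extend P p a ≤ y := by
  have h0 := h 0
  have h1 := h 1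
  have h2 := h 2
  fin_cases p <;> fin_cases a <;> simp [extend] <;> constructor <;> linarith

theorem extend_diff {P : Fin 3 → ℝ} {x y : ℝ} (h : ∀ a, x ≤ P a ∧ P a ≤ y) (p : Fin 6)
    (a b : Fin 3) : extend P p a - extend P p b ≤ 7 / 15 * (y - x) := by
  have h0 := h 0
  have h1 := h 1
  have h2 := h 2
  fin_cases p <;> fin_cases a <;> fin_cases b <;> simp [extend] <;> linarith

theorem width_full_step (P : Fin 3 → ℝ) (p : Fin 6) :
    hi (full (extend P p)) - lo (full (extend P p)) ≤ 7 / 15 * (hi (full P) - lo (full P)) := by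
  have h : ∀ a, lo (full P) ≤ P a ∧ P a ≤ hi (full P) := fun a => ⟨lo_full_le P a, le_hi_full P a⟩
  have h1 : ∀ a, extend P p a - 7 / 15 * (hi (full P) - lo (full P)) ≤ lo (full (extend P p)) :=
    fun a => le_lo_full fun b => by linarith [extend_diff h p a b]
  have h2 : hi (full (extend P p))
      ≤ lo (full (extend P p)) + 7 / 15 * (hi (full P) - lo (full P)) :=
    hi_full_le fun a => by linarith [h1 a]
  linarith

theorem lo_le_cv (s : CellState) (a : Fin 3) : lo s ≤ cv s a := by
  cases s with
  | full P => exact lo_full_le P a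
  | cut t lam ht h0 h1 => fin_cases a <;> simp [lo, cv, ht]

theorem cv_le_hi (s : CellState) (a : Fin 3) : cv s a ≤ hi s := by
  cases s with
  | full P => exact le_hi_full P a
  | cut t lam ht h0 h1 => fin_cases a <;> simp [hi, cv, ht]

theorem step_mem (s : CellState) (p : Fin 6) : lo s ≤ lo (step s p) ∧ hi (step s p) ≤ hi s := by
  cases s with
  | full P =>
    have h : ∀ a, lo (full P) ≤ P a ∧ P a ≤ hi (full P) := fun a => ⟨lo_full_le P a, le_hi_full P a⟩
    exact ⟨le_lo_full fun a => (extend_mem h p a).1, hi_full_le fun a => (extend_mem h p a).2⟩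
  | cut t lam ht h0 h1 =>
    simp only [step]
    split_ifs with h h2
    · fin_cases p <;> simp [lo, hi, ht]
    · have hx := potX_mem ht (eta_ge_one h h2)
      have hx' : potX t (etaT (3 * lam - 1)) ≤ t := by linarith
      fin_cases p <;> simp [lo, hi, ht, hx.1, hx']
    · have hp := potP_mem ht (eta_ge_two h1 h2)
      have hr := potR_mem ht (eta_ge_two h1 h2)
      have hc := potC_mem ht (eta_ge_two h1 h2)
      have hr' : potR t (etaT (3 * lam - 2)) ≤ t := by linarith
      have hc' : potC t (etaT (3 * lam - 2)) ≤ t := by linarith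
      fin_cases p <;> simp [lo, hi, hp.1, hp.2, hr.1, hr', hc.1, hc']

theorem cv_corner (s : CellState) (a : Fin 3) : cv (step s (cr a)) a = cv s a := by
  cases s with
  | full P => exact extend_corner P a
  | cut t lam ht h0 h1 =>
    simp only [step]
    split_ifs with h h2 <;> fin_cases a <;> simp [cv]

theorem cv_junction (s : CellState) (p : Fin 6) (a : Fin 3) (p' : Fin 6) (b : Fin 3)
    (e : F p (q a) = F p' (q b)) : cv (step s p) a = cv (step s p') b := by
  refine eq_of_F_q_eq (f := fun p a => cv (step s p) a) ?_ ?_ ?_ ?_ ?_ ?_ ?_ ?_ e <;>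
  · cases s with
    | full P => simp [step, cv, extend]
    | cut t lam ht h0 h1 =>
      simp only [step]
      split_ifs with h h2 <;> simp [cv]

/-- All cells of some level inside a cell of state `s` have width less than `ε`. -/
def Small (s : CellState) (ε : ℝ) : Prop :=
  ∃ N, ∀ w : List (Fin 6), w.length = N → hi (w.foldl step s) - lo (w.foldl step s) < ε

theorem foldl_mem (w : List (Fin 6)) (s : CellState) :
    lo s ≤ lo (w.foldl step s) ∧ hi (w.foldl step s) ≤ hi s := by
  induction w generalizing s with
  | nil => exact ⟨le_rfl, le_rfl⟩
  | cons p w ih =>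
    exact ⟨(step_mem s p).1.trans (ih _).1, (ih _).2.trans (step_mem s p).2⟩

theorem small_of_step {s : CellState} {ε : ℝ} (h : ∀ p, Small (step s p) ε) : Small s ε := by
  choose N hN using h
  refine ⟨Finset.univ.sup N + 1, fun w hw => ?_⟩
  rcases w with _ | ⟨p, w⟩
  · simp at hw
  have hle : N p ≤ Finset.univ.sup N := Finset.le_sup (Finset.mem_univ p)
  have hl : w.length = Finset.univ.sup N := by simpa using hw
  rw [List.foldl_cons, ← List.take_append_drop (N p) w, List.foldl_append]
  have h1 := hN p (w.take (N p)) (by rw [List.length_take]; omega)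
  have h2 := foldl_mem (w.drop (N p)) ((w.take (N p)).foldl step (step s p))
  linarith

theorem small_full (P : Fin 3 → ℝ) {ε : ℝ} (hε : 0 < ε) : Small (full P) ε := by
  have key : ∀ (w : List (Fin 6)) (P : Fin 3 → ℝ),
      hi (w.foldl step (full P)) - lo (w.foldl step (full P))
        ≤ (7 / 15) ^ w.length * (hi (full P) - lo (full P)) := by
    intro w
    induction w with
    | nil => intro P; simp
    | cons p w ih =>
      intro P
      refine (ih (extend P p)).trans ?_
      rw [List.length_cons, pow_succ, mul_assoc]
      exact mul_le_mul_of_nonneg_left (width_full_step P p) (by positivity)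
  have t := (tendsto_pow_atTop_nhds_zero_of_lt_one (by norm_num : (0 : ℝ) ≤ 7 / 15)
    (by norm_num)).mul_const (hi (full P) - lo (full P))
  rw [zero_mul] at t
  obtain ⟨N, hN⟩ := (t.eventually_lt_const hε).exists
  exact ⟨N, fun w hw => (key w P).trans_lt (by rw [hw]; exact hN)⟩

theorem small_cut {ε : ℝ} (hε : 0 < ε) (k : ℕ) : ∀ (lam : ℝ) (h0 : 0 < lam) (h1 : lam ≤ 1) (t : ℝ)
    (ht : 0 ≤ t), t < 2 ^ k * ε → Small (cut t lam ht h0 h1) ε := by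
  induction k with
  | zero =>
    intro lam h0 h1 t ht hlt
    refine ⟨0, fun w hw => ?_⟩
    rw [List.length_eq_zero_iff.1 hw]
    simpa [hi, lo] using hlt
  | succ k ih =>
    intro lam h0 h1
    refine scale_induction (Q := fun lam => ∀ (h0 : 0 < lam) (h1 : lam ≤ 1) (t : ℝ)
      (ht : 0 ≤ t), t < 2 ^ (k + 1) * ε → Small (cut t lam ht h0 h1) ε) ?_ ?_ h0 h1 h0 h1
    · intro lam _ _ hlt h0 h1 t ht htk
      rw [pow_succ] at htk
      refine small_of_step fun p => ?_
      simp only [step]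
      split_ifs with h h2
      · linarith
      · have hx := potX_mem ht (eta_ge_one h h2)
        fin_cases p <;>
          first | exact small_full _ hε | exact ih _ _ _ _ _ (by linarith)
      · have hr := potR_mem ht (eta_ge_two h1 h2)
        have hc := potC_mem ht (eta_ge_two h1 h2)
        fin_cases p <;>
          first | exact small_full _ hε | exact ih _ _ _ _ _ (by linarith)
    · intro lam _ h3 hQ h0 h1 t ht htk
      refine small_of_step fun p => ?_
      simp only [step]
      rw [dif_pos h3]
      fin_cases p <;> first | exact small_full _ hε | exact hQ _ _ _ _ htk

theorem small (s : CellState) (ε : ℝ) (hε : ε > 0) : Small s ε := by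
  cases s with
  | full P => exact small_full P hε
  | cut t lam ht h0 h1 =>
    obtain ⟨k, hk⟩ := pow_unbounded_of_one_lt (t / ε) (by norm_num : (1 : ℝ) < 2)
    exact small_cut hε k lam h0 h1 t ht (by rwa [div_lt_iff₀ hε] at hk)

/-- The self-similar system that defines `h₀`. -/
noncomputable def system : SelfSimilar CellState where
  step := step
  cv := cv
  lo := lo
  hi := hi
  corner := cv_corner
  junction := cv_junction
  lo_le := lo_le_cv
  le_hi := cv_le_hi
  lo_step s p := (step_mem s p).1
  hi_step s p := (step_mem s p).2
  small := small

/-- The function of state `s`. -/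
noncomputable abbrev fn (s : CellState) : Plane → ℝ := system.fn s

theorem fn_F (s : CellState) (p : Fin 6) : ∀ z ∈ gasket, (fn s ∘ F p) z = fn (step s p) z :=
  fun _ hz => system.fn_F s p hz

theorem fn_corner (s : CellState) (a : Fin 3) : fn s (q a) = cv s a := system.fn_corner s a

theorem lap_fn_full_corner (m : ℕ) (P : Fin 3 → ℝ) (a : Fin 3) :
    lap m (fn (full P)) (q a) = (7 / 15) ^ m * (3 * P a - (P 0 + P 1 + P 2)) := by
  induction m generalizing P with
  | zero => rw [lap_zero_corner]; simp only [fn_corner, cv]; ring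
  | succ m ih =>
    rw [lap_corner, lap_congr (fn_F _ _), step, ih, pow_succ, mul_assoc]
    congr 1
    fin_cases a <;> simp [extend] <;> ring

theorem lap_fn_cut_top (m : ℕ) : ∀ (t lam : ℝ) (ht : 0 ≤ t) (h0 : 0 < lam) (h1 : lam ≤ 1),
    1 < 3 ^ m * lam → lap m (fn (cut t lam ht h0 h1)) (q 0) = (7 / 15) ^ m * (etaT lam * t) := by
  induction m with
  | zero => intro t lam ht h0 h1 h; simp at h; linarith
  | succ m ih =>
    intro t lam ht h0 h1 hm
    rw [lap_corner, lap_congr (fn_F _ _), cr_zero, step]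
    split_ifs with h h2
    · simp only [Matrix.cons_val_zero]
      rw [ih _ _ _ _ _ (by rw [pow_succ] at hm; linarith), etaT_three h0 h, pow_succ]
      ring
    · simp only [Matrix.cons_val_zero]
      have he := eta_ge_one h h2
      rw [lap_fn_full_corner, etaT_one h0 (not_le.1 h) h2, pow_succ]
      have : 1 + etaT (3 * lam - 1) ≠ 0 := by linarith
      simp [potX]
      field_simp
      ring
    · simp only [Matrix.cons_val_zero]
      have he := eta_ge_two h1 h2
      rw [lap_fn_full_corner, etaT_two h0 h1 (not_le.1 h2), pow_succ]
      have : 3 * etaT (3 * lam - 2) ^ 2 + 15 * etaT (3 * lam - 2) + 6 ≠ 0 := by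
        have : 0 ≤ etaT (3 * lam - 2) := by linarith
        positivity
      simp [potP]
      field_simp
      ring

theorem fn_full_harm (P : Fin 3 → ℝ) : FullHarm (fn (full P)) := by
  have key : ∀ m P x, Inner x → lap m (fn (full P)) x = 0 := by
    intro m
    induction m with
    | zero => exact fun P x hx => lap_zero_inner _ hx
    | succ m ih =>
      intro P x hx
      rcases hx.cases with ⟨p, x', hx', rfl⟩ | rfl | rfl | rfl | rfl | rfl | rfl | rfl
      · rw [lap_F_inner _ _ _ hx', lap_congr (fn_F _ _), step]; exact ih _ _ hx'
      · rw [lap_left]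
        simp only [lap_congr (fn_F _ _), step, lap_fn_full_corner]
        simp [extend]; ring
      · rw [lap_right]
        simp only [lap_congr (fn_F _ _), step, lap_fn_full_corner]
        simp [extend]; ring
      · rw [lap_left']
        simp only [lap_congr (fn_F _ _), step, lap_fn_full_corner]
        simp [extend]; ring
      · rw [lap_right']
        simp only [lap_congr (fn_F _ _), step, lap_fn_full_corner]
        simp [extend]; ring
      · rw [lap_bot_left]
        simp only [lap_congr (fn_F _ _), step, lap_fn_full_corner]
        simp [extend]; ring
      · rw [lap_bot_right]
        simp only [lap_congr (fn_F _ _), step, lap_fn_full_corner]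
        simp [extend]; ring
      · rw [lap_center]
        simp only [lap_congr (fn_F _ _), step, lap_fn_full_corner]
        simp [extend]; ring
  exact fun m x hx _ => key m P x hx

theorem fn_cut_harm (t lam : ℝ) (ht : 0 ≤ t) (h0 : 0 < lam) (h1 : lam ≤ 1) :
    Harm lam (fn (cut t lam ht h0 h1)) := by
  intro m
  induction m generalizing t lam with
  | zero => exact fun x hx _ => lap_zero_inner _ hx
  | succ m ih =>
    intro x hx ha
    by_cases h : 3 * lam ≤ 1
    · have n1 : ¬ (1 < 3 * lam) := by linarith
      have n2 : ¬ (1 < 3 * lam - 1) := by linarith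
      have n3 : ¬ (1 < 3 * lam - 2) := by linarith
      rcases hx.cases with ⟨p, x', hx', rfl⟩ | rfl | rfl | rfl | rfl | rfl | rfl | rfl
      · rw [lap_F_inner _ _ _ hx', lap_congr (fn_F _ _), step, dif_pos h]
        rw [adm_F_inner hx'] at ha
        fin_cases p
        · exact ih _ _ _ _ _ x' hx' (by simpa [dp] using ha)
        all_goals exact fn_full_harm _ m x' hx' (adm_of_one_lt (by norm_num) _)
      · rw [adm_left, adm_bot (by decide)] at ha; exact absurd (by simpa [dp] using ha.1) n1
      · rw [adm_right, adm_bot (by decide)] at ha; exact absurd (by simpa [dp] using ha.1) n1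
      · rw [adm_left', adm_bot (by decide)] at ha; exact absurd (by simpa [dp] using ha.1) n2
      · rw [adm_right', adm_bot (by decide)] at ha; exact absurd (by simpa [dp] using ha.1) n2
      · rw [adm_bot_left, adm_bot (by decide)] at ha; exact absurd (by simpa [dp] using ha.1) n3
      · rw [adm_bot_right, adm_bot (by decide)] at ha; exact absurd (by simpa [dp] using ha.1) n3
      · rw [adm_center, adm_bot (a := 1) (by decide)] at ha
        exact absurd (by simpa [dp] using ha.2.1) n2
    by_cases h2 : 3 * lam ≤ 2
    · have n2 : ¬ (1 < 3 * lam - 1) := by linarith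
      have n3 : ¬ (1 < 3 * lam - 2) := by linarith
      have he := eta_ge_one h h2
      have hne : 1 + etaT (3 * lam - 1) ≠ 0 := by linarith
      rcases hx.cases with ⟨p, x', hx', rfl⟩ | rfl | rfl | rfl | rfl | rfl | rfl | rfl
      · rw [lap_F_inner _ _ _ hx', lap_congr (fn_F _ _), step, dif_neg h, dif_pos h2]
        rw [adm_F_inner hx'] at ha
        fin_cases p
        all_goals
          first
          | exact fn_full_harm _ m x' hx' (adm_of_one_lt (by norm_num) _)
          | exact ih _ _ _ _ _ x' hx' (by simpa [dp] using ha)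
      · rw [adm_left, adm_top] at ha
        rw [lap_left, lap_congr (fn_F _ _), lap_congr (fn_F _ _), step, dif_neg h, dif_pos h2, step,
          dif_neg h, dif_pos h2]
        simp only [Matrix.cons_val]
        rw [lap_fn_full_corner, lap_fn_cut_top _ _ _ _ _ _ (by simpa [dp] using ha.2)]
        simp [potX]
        field_simp
        ring
      · rw [adm_right, adm_top] at ha
        rw [lap_right, lap_congr (fn_F _ _), lap_congr (fn_F _ _), step, dif_neg h, dif_pos h2,
          step,
          dif_neg h, dif_pos h2]
        simp only [Matrix.cons_val]
        rw [lap_fn_full_corner, lap_fn_cut_top _ _ _ _ _ _ (by simpa [dp] using ha.2)]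
        simp [potX]
        field_simp
        ring
      · rw [adm_left', adm_bot (by decide)] at ha; exact absurd (by simpa [dp] using ha.1) n2
      · rw [adm_right', adm_bot (by decide)] at ha; exact absurd (by simpa [dp] using ha.1) n2
      · rw [adm_bot_left, adm_bot (by decide)] at ha; exact absurd (by simpa [dp] using ha.1) n3
      · rw [adm_bot_right, adm_bot (by decide)] at ha; exact absurd (by simpa [dp] using ha.1) n3
      · rw [adm_center, adm_bot (a := 1) (by decide)] at ha
        exact absurd (by simpa [dp] using ha.2.1) n2
    have n3 : ¬ (1 < 3 * lam - 2) := by linarith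
    have he := eta_ge_two h1 h2
    have hne : 3 * etaT (3 * lam - 2) ^ 2 + 15 * etaT (3 * lam - 2) + 6 ≠ 0 := by
      have : 0 ≤ etaT (3 * lam - 2) := by linarith
      positivity
    rcases hx.cases with ⟨p, x', hx', rfl⟩ | rfl | rfl | rfl | rfl | rfl | rfl | rfl
    · rw [lap_F_inner _ _ _ hx', lap_congr (fn_F _ _), step, dif_neg h, dif_neg h2]
      rw [adm_F_inner hx'] at ha
      fin_cases p
      all_goals
        first
        | exact fn_full_harm _ m x' hx' (adm_of_one_lt (by norm_num) _)
        | exact ih _ _ _ _ _ x' hx' (by simpa [dp] using ha)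
    · rw [lap_left, lap_congr (fn_F _ _), lap_congr (fn_F _ _), step, dif_neg h, dif_neg h2, step,
        dif_neg h, dif_neg h2]
      simp only [Matrix.cons_val]
      rw [lap_fn_full_corner, lap_fn_full_corner]
      simp [potP, potC, potR]
      field_simp
      ring
    · rw [lap_right, lap_congr (fn_F _ _), lap_congr (fn_F _ _), step, dif_neg h, dif_neg h2, step,
        dif_neg h, dif_neg h2]
      simp only [Matrix.cons_val]
      rw [lap_fn_full_corner, lap_fn_full_corner]
      simp [potP, potC, potR]
      field_simp
      ring
    · rw [adm_left', adm_top] at ha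
      rw [lap_left', lap_congr (fn_F _ _), lap_congr (fn_F _ _), step, dif_neg h, dif_neg h2, step,
        dif_neg h, dif_neg h2]
      simp only [Matrix.cons_val]
      rw [lap_fn_full_corner, lap_fn_cut_top _ _ _ _ _ _ (by simpa [dp] using ha.2)]
      simp [potP, potC, potR]
      field_simp
      ring
    · rw [adm_right', adm_top] at ha
      rw [lap_right', lap_congr (fn_F _ _), lap_congr (fn_F _ _), step, dif_neg h, dif_neg h2, step,
        dif_neg h, dif_neg h2]
      simp only [Matrix.cons_val]
      rw [lap_fn_full_corner, lap_fn_cut_top _ _ _ _ _ _ (by simpa [dp] using ha.2)]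
      simp [potP, potC, potR]
      field_simp
      ring
    · rw [adm_bot_left, adm_bot (by decide)] at ha; exact absurd (by simpa [dp] using ha.1) n3
    · rw [adm_bot_right, adm_bot (by decide)] at ha; exact absurd (by simpa [dp] using ha.1) n3
    · rw [adm_center, adm_top] at ha
      rw [lap_center, lap_congr (fn_F _ _), lap_congr (fn_F _ _), lap_congr (fn_F _ _), step,
        dif_neg h, dif_neg h2, step, dif_neg h, dif_neg h2, step, dif_neg h, dif_neg h2]
      simp only [Matrix.cons_val]
      rw [lap_fn_full_corner, lap_fn_full_corner,
        lap_fn_cut_top _ _ _ _ _ _ (by simpa [dp] using ha.1)]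
      simp [potP, potC, potR]
      field_simp
      ring

theorem fn_zero {z : Plane} (hz : z ∈ gasket) : fn (full 0) z = 0 := by
  have := system.fn_mem (full 0) hz
  have e1 : system.lo (full 0) = 0 := by change lo (full 0) = 0; simp [lo]
  have e2 : system.hi (full 0) = 0 := by change hi (full 0) = 0; simp [hi]
  rw [e1, e2] at this
  exact le_antisymm this.2 this.1

theorem fn_nonneg (t lam : ℝ) (ht : 0 ≤ t) (h0 : 0 < lam) (h1 : lam ≤ 1) {z : Plane}
    (hz : z ∈ gasket) : 0 ≤ fn (cut t lam ht h0 h1) z :=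
  (system.fn_mem (cut t lam ht h0 h1) hz).1

theorem fn_below_le (k : ℕ) : ∀ (lam : ℝ) (h0 : 0 < lam) (h1 : lam ≤ 1) (t : ℝ) (ht : 0 ≤ t),
    ∀ z ∈ gasket, lam ≤ 1 - z.2 → fn (cut t lam ht h0 h1) z ≤ t / 2 ^ k := by
  induction k with
  | zero =>
    intro lam h0 h1 t ht z hz _
    rw [pow_zero, div_one]
    exact (system.fn_mem (cut t lam ht h0 h1) hz).2
  | succ k ih =>
    intro lam h0 h1
    refine scale_induction (Q := fun lam => ∀ (h0 : 0 < lam) (h1 : lam ≤ 1) (t : ℝ) (ht : 0 ≤ t),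
      ∀ z ∈ gasket, lam ≤ 1 - z.2 → fn (cut t lam ht h0 h1) z ≤ t / 2 ^ (k + 1)) ?_ ?_ h0 h1 h0 h1
    · intro lam _ _ hlt h0 h1 t ht z hz hd
      obtain ⟨p, z', hz', rfl⟩ := exists_F hz
      have hF := fn_F (cut t lam ht h0 h1) p z' hz'
      rw [Function.comp_apply] at hF
      rw [hF, step]
      rw [depth_F] at hd
      have hd1 := depth_le_one hz'
      have hpow : (0 : ℝ) ≤ t / 2 ^ (k + 1) := by positivity
      have hhalf : ∀ x, x ≤ t / 2 → x / 2 ^ k ≤ t / 2 ^ (k + 1) := fun x hx => by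
        rw [pow_succ', ← div_div]; gcongr
      have hcut : ∀ x mu (hx : 0 ≤ x) (g0 : 0 < mu) (g1 : mu ≤ 1), x ≤ t / 2 → mu ≤ 1 - z'.2 →
          fn (cut x mu hx g0 g1) z' ≤ t / 2 ^ (k + 1) := fun x mu hx g0 g1 hxt hmu =>
        (ih mu g0 g1 x hx z' hz' hmu).trans (hhalf x hxt)
      split_ifs with h h2
      · linarith
      · have hx := potX_mem ht (eta_ge_one h h2)
        fin_cases p <;> simp [dp] at hd ⊢ <;>
          first
          | (rw [fn_zero hz']; exact hpow)
          | exact hcut _ _ _ _ _ hx.2 (by linarith)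
          | (exfalso; linarith)
      · have hr := potR_mem ht (eta_ge_two h1 h2)
        have hc := potC_mem ht (eta_ge_two h1 h2)
        fin_cases p <;> simp [dp] at hd ⊢ <;>
          first
          | exact hcut _ _ _ _ _ hr.2 (by linarith)
          | exact hcut _ _ _ _ _ hc.2 (by linarith)
          | (exfalso; linarith)
    · intro lam _ h3 hQ h0 h1 t ht z hz hd
      obtain ⟨p, z', hz', rfl⟩ := exists_F hz
      have hF := fn_F (cut t lam ht h0 h1) p z' hz'
      rw [Function.comp_apply] at hF
      rw [hF, step, dif_pos h3]
      rw [depth_F] at hd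
      have hpow : (0 : ℝ) ≤ t / 2 ^ (k + 1) := by positivity
      fin_cases p
      · exact hQ _ _ _ _ z' hz' (by simp [dp] at hd; linarith)
      all_goals
        change fn (full 0) z' ≤ _
        rw [fn_zero hz']; exact hpow

theorem fn_below (lam : ℝ) (h0 : 0 < lam) (h1 : lam ≤ 1) (t : ℝ) (ht : 0 ≤ t) {z : Plane}
    (hz : z ∈ gasket) (hd : lam ≤ 1 - z.2) : fn (cut t lam ht h0 h1) z = 0 := by
  refine le_antisymm ?_ (fn_nonneg _ _ _ _ _ hz)
  have t1 : Tendsto (fun k : ℕ => t * (1 / 2 : ℝ) ^ k) atTop (𝓝 (t * 0)) :=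
    (tendsto_pow_atTop_nhds_zero_of_lt_one (by norm_num) (by norm_num)).const_mul t
  rw [mul_zero] at t1
  refine ge_of_tendsto' t1 fun k => ?_
  have := fn_below_le k lam h0 h1 t ht z hz hd
  rwa [div_eq_mul_inv, ← inv_pow, ← one_div] at this

end CellState

theorem Harm.isHarmonicOn {lam : ℝ} {u : Plane → ℝ} (h : Harm lam u) :
    IsHarmonicOn (Om lam) u := by
  intro m x hx hw
  rw [sum_eq_lap]
  refine h m x ⟨hx.1, hx.2.1⟩ (adm_iff.2 fun w hxw z hz => ?_)
  have := (hw w hxw hz).2.2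
  linarith

/-- The Dirichlet problem that defines `h₀` has a solution. -/
theorem exists_dirichlet {lam : ℝ} (h0 : 0 < lam) (h1 : lam ≤ 1) :
    ∃ u, IsDirichletSolution lam 1 (fun _ => 0) u := by
  refine ⟨CellState.fn (.cut 1 lam zero_le_one h0 h1), ?_, ?_, ?_, ?_⟩
  · refine (CellState.system.fn_continuousOn _).mono ?_
    rintro z (hz | rfl | hz)
    · exact hz.1
    · exact q_mem 0
    · exact hz.1
  · exact (CellState.fn_cut_harm 1 lam _ h0 h1).isHarmonicOn
  · rw [CellState.fn_corner]; rfl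
  · intro x hx
    exact CellState.fn_below lam h0 h1 1 _ hx.1 (by rw [hx.2]; linarith)

/-! ### Words along the boundary -/

/-- The word `w` followed by the letter `i`. -/
abbrev ext {n : ℕ} (w : Fin n → Fin 6) (i : Fin 6) : Fin (n + 1) → Fin 6 :=
  Fin.snoc (α := fun _ => Fin 6) w i

theorem ext_mem_W {lam : ℝ} {n : ℕ} {w : Fin n → Fin 6} {i : Fin 6} :
    ext w i ∈ W lam (n + 1) ↔ w ∈ W lam n ∧ i ∈ S (digit lam n) := by
  simp only [W, Fintype.mem_piFinset]
  rw [Fin.forall_fin_succ']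
  simp [ext]

theorem ext_init_last {n : ℕ} (w : Fin (n + 1) → Fin 6) :
    ext (fun k => w k.castSucc) (w (Fin.last n)) = w :=
  Fin.snoc_init_self w

theorem sum_W_succ {M : Type*} [AddCommMonoid M] (lam : ℝ) (n : ℕ)
    (g : (Fin (n + 1) → Fin 6) → M) :
    ∑ w ∈ W lam (n + 1), g w = ∑ w ∈ W lam n, ∑ i ∈ S (digit lam n), g (ext w i) := by
  rw [← Finset.sum_product']
  refine (Finset.sum_bij' (fun x _ => ext x.1 x.2)
    (fun w _ => (fun k => w k.castSucc, w (Fin.last n))) ?_ ?_ ?_ ?_ ?_).symm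
  · rintro ⟨w, i⟩ h
    exact ext_mem_W.2 (Finset.mem_product.1 h)
  · intro w hw
    rw [← ext_init_last w] at hw
    exact Finset.mem_product.2 (ext_mem_W.1 hw)
  · rintro ⟨w, i⟩ _
    simp [ext]
  · intro w _
    exact ext_init_last w
  · rintro ⟨w, i⟩ _; rfl

theorem W_zero (lam : ℝ) : W lam 0 = {Fin.elim0} := by
  ext w
  simp only [W, Fintype.mem_piFinset, Finset.mem_singleton]
  exact ⟨fun _ => Subsingleton.elim _ _, fun _ k => k.elim0⟩

theorem lamSeq_succ (lam : ℝ) (n : ℕ) : lamSeq lam (n + 1) = R (lamSeq lam n) :=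
  Function.iterate_succ_apply' _ _ _

theorem mSeq_succ (lam : ℝ) (n : ℕ) : mSeq lam (n + 1) = mSeq lam n + m1 (lamSeq lam n) :=
  Finset.sum_range_succ _ _

theorem Fword_replicate (k : ℕ) (z : Plane) : Fword (List.replicate k 0) z = (F 0)^[k] z := by
  induction k with
  | zero => rfl
  | succ k ih => rw [List.replicate_succ, Fword_cons, ih, iterate_F_zero_succ]

theorem fullWord_ext (lam : ℝ) {n : ℕ} (w : Fin n → Fin 6) (i : Fin 6) :
    fullWord lam (ext w i)
      = fullWord lam w ++ (List.replicate (m1 (lamSeq lam n) - 1) 0 ++ [i]) := by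
  unfold fullWord
  rw [List.ofFn_succ']
  simp [ext, mSeq_succ]

theorem Flam_ext (lam : ℝ) {n : ℕ} (w : Fin n → Fin 6) (i : Fin 6) (z : Plane) :
    Flam lam (ext w i) z = Flam lam w ((F 0)^[m1 (lamSeq lam n) - 1] (F i z)) := by
  unfold Flam
  rw [fullWord_ext, Fword_append, Fword_append, Fword_replicate]
  rfl

theorem Flam_zero (lam : ℝ) (w : Fin 0 → Fin 6) (z : Plane) : Flam lam w z = z := rfl

/-- The function `u` on the part of the domain below `F_w^λ q₀`. -/
noncomputable def part (lam : ℝ) (u : Plane → ℝ) {n : ℕ} (w : Fin n → Fin 6) : Plane → ℝ :=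
  u ∘ Flam lam w

theorem part_ext (lam : ℝ) (u : Plane → ℝ) {n : ℕ} (w : Fin n → Fin 6) (i : Fin 6) :
    part lam u (ext w i) = branch (lamSeq lam n) (part lam u w) i := by
  funext z
  simp only [part, branch, headFun, Function.comp, Flam_ext]

theorem part_zero (lam : ℝ) (u : Plane → ℝ) (w : Fin 0 → Fin 6) : part lam u w = u := rfl

/-- Induction over the words of `W λ n`. -/
theorem W_induction {lam : ℝ} {Q : ∀ n, (Fin n → Fin 6) → Prop} (h0 : ∀ w, Q 0 w)
    (hs : ∀ n w i, w ∈ W lam n → i ∈ S (digit lam n) → Q n w → Q (n + 1) (ext w i)) {n : ℕ}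
    {w : Fin n → Fin 6} (hw : w ∈ W lam n) : Q n w := by
  induction n with
  | zero => exact h0 w
  | succ n ih =>
    rw [← ext_init_last w] at hw ⊢
    have := ext_mem_W.1 hw
    exact hs n _ _ this.1 this.2 (ih this.1)

section words

variable {lam : ℝ} {u : Plane → ℝ}

theorem Harm.part (h0 : 0 < lam) (h1 : lam ≤ 1) (h : Harm lam u) {n : ℕ} {w : Fin n → Fin 6}
    (hw : w ∈ W lam n) : Harm (lamSeq lam n) (part lam u w) := by
  refine W_induction (lam := lam) (Q := fun n w => Harm (lamSeq lam n) (SG3.part lam u w))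
    (fun w => h) (fun n w i _ hi ih => ?_) hw
  obtain ⟨g0, g1⟩ := lamSeq_mem h0 h1 n
  rw [part_ext, lamSeq_succ]
  exact ih.branch g0 g1 hi

theorem depth_Flam (h0 : 0 < lam) (h1 : lam ≤ 1) {n : ℕ} {w : Fin n → Fin 6} (hw : w ∈ W lam n)
    (z : Plane) : 1 - (Flam lam w z).2
      = lam - (1 / 3) ^ mSeq lam n * (lamSeq lam n - (1 - z.2)) := by
  refine W_induction (lam := lam) (Q := fun n w => ∀ z, 1 - (Flam lam w z).2
      = lam - (1 / 3) ^ mSeq lam n * (lamSeq lam n - (1 - z.2)))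
    (fun w z => ?_) (fun n w i _ hi ih z => ?_) hw z
  · simp [Flam_zero, mSeq, lamSeq]
  · obtain ⟨g0, g1⟩ := lamSeq_mem h0 h1 n
    have e3 := three_pow_m1 g0 g1
    rw [Flam_ext, ih, depth_iterate, depth_F, dp_of_mem (digit_eq lam n) hi, lamSeq_succ, mSeq_succ,
      pow_add]
    have e : m1 (lamSeq lam n) = m1 (lamSeq lam n) - 1 + 1 := by
      have := (m1_spec g0 g1).1; omega
    rw [R, e]
    simp only [Nat.add_sub_cancel, digit]
    generalize m1 (lamSeq lam n) - 1 = k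
    have hk : (1 / 3 : ℝ) ^ (k + 1) * 3 ^ (k + 1) = 1 := by rw [← mul_pow]; norm_num
    have hk' : ((1 - z.2 + (iota1 (lamSeq lam n) : ℝ)) / 3) / 3 ^ k
        = (1 / 3) ^ (k + 1) * (1 - z.2 + iota1 (lamSeq lam n)) := by
      rw [div_div, ← pow_succ', div_eq_mul_inv, one_div, inv_pow, mul_comm]
    rw [hk']
    linear_combination ((1 / 3 : ℝ) ^ mSeq lam n * lamSeq lam n) * hk

/-- The mass of the set `X_w`, in terms of `wT`. -/
noncomputable def mass (lam : ℝ) {n : ℕ} (w : Fin n → Fin 6) : ℝ :=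
  ∏ k : Fin n, wT (lamSeq lam k) (w k)

theorem mass_ext (lam : ℝ) {n : ℕ} (w : Fin n → Fin 6) (i : Fin 6) :
    mass lam (ext w i) = mass lam w * wT (lamSeq lam n) i := by
  rw [mass, Fin.prod_univ_castSucc]
  simp [ext, mass]

theorem mass_pos (h0 : 0 < lam) (h1 : lam ≤ 1) {n : ℕ} (w : Fin n → Fin 6) : 0 < mass lam w :=
  Finset.prod_pos fun k _ => by
    obtain ⟨g0, g1⟩ := lamSeq_mem h0 h1 k
    linarith [(wT_bounds g0 g1 (w k)).1]

/-- The boundary means form a martingale. -/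
theorem Harm.beta_eq_sum (h0 : 0 < lam) (h1 : lam ≤ 1) (h : Harm lam u) (n : ℕ) :
    beta lam u = ∑ w ∈ W lam n, mass lam w * beta (lamSeq lam n) (SG3.part lam u w) := by
  induction n with
  | zero =>
    rw [W_zero, Finset.sum_singleton, part_zero]
    simp [mass, lamSeq]
  | succ n ih =>
    rw [sum_W_succ, ih]
    refine Finset.sum_congr rfl fun w hw => ?_
    obtain ⟨g0, g1⟩ := lamSeq_mem h0 h1 n
    rw [(h.part h0 h1 hw).beta_eq g0 g1, Finset.mul_sum]
    refine Finset.sum_congr rfl fun i _ => ?_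
    rw [mass_ext, part_ext, lamSeq_succ, mul_assoc]

theorem sum_mass (h0 : 0 < lam) (h1 : lam ≤ 1) (n : ℕ) : ∑ w ∈ W lam n, mass lam w = 1 := by
  induction n with
  | zero => rw [W_zero, Finset.sum_singleton]; simp [mass]
  | succ n ih =>
    rw [sum_W_succ, ← ih]
    refine Finset.sum_congr rfl fun w _ => ?_
    obtain ⟨g0, g1⟩ := lamSeq_mem h0 h1 n
    simp only [mass_ext]
    rw [← Finset.mul_sum]
    have := sum_wT g0 g1
    rw [digit, this, mul_one]

theorem abs_beta_le (h0 : 0 < lam) (h1 : lam ≤ 1) (v : Plane → ℝ) {ε : ℝ} (ha : |v (q 0)| ≤ ε)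
    (hb : |v ((F 0)^[m1 lam] (q 1))| ≤ ε) (hc : |v ((F 0)^[m1 lam] (q 2))| ≤ ε) :
    |beta lam v| ≤ 5 * ε := by
  have ht := (theta_bounds h0 h1).1
  have e : ∀ z, headFun lam v (F 0 z) = v ((F 0)^[m1 lam] z) := fun z =>
    congrFun (headFun_comp_zero h0 h1 v) z
  rw [beta, drop, e, e]
  have h2 : |(2 * v (q 0) - v ((F 0)^[m1 lam] (q 1)) - v ((F 0)^[m1 lam] (q 2))) / theta lam|
      ≤ 4 * ε := by
    rw [abs_div, abs_of_pos (by linarith : 0 < theta lam), div_le_iff₀ (by linarith)]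
    have h3 : |2 * v (q 0) - v ((F 0)^[m1 lam] (q 1)) - v ((F 0)^[m1 lam] (q 2))| ≤ 4 * ε := by
      rw [abs_le] at ha hb hc ⊢
      constructor <;> linarith
    have : 0 ≤ ε := (abs_nonneg _).trans ha
    nlinarith
  calc _ ≤ |v (q 0)| + |_| := abs_sub _ _
    _ ≤ 5 * ε := by linarith

end words

/-! ### Solutions of the Dirichlet problem with continuous boundary values -/

/-- The closure of `Ω_λ` is the part of the gasket of depth at most `lam`. -/
theorem closure_eq {lam : ℝ} (h0 : 0 < lam) (h1 : lam ≤ 1) :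
    Om lam ∪ ({q 0} ∪ X lam) = gasket ∩ {z | 1 - lam ≤ z.2} := by
  ext z
  constructor
  · rintro (h | rfl | h)
    · exact ⟨h.1, h.2.2.le⟩
    · refine ⟨q_mem 0, ?_⟩
      simp [q]; exact h0.le
    · exact ⟨h.1, h.2.ge⟩
  · rintro ⟨h, h2⟩
    have h2' : 1 - lam ≤ z.2 := h2
    rcases h2'.eq_or_lt with h3 | h3
    · exact Or.inr (Or.inr ⟨h, h3.symm⟩)
    · by_cases hq : z ∈ Set.range q
      · obtain ⟨a, rfl⟩ := hq
        fin_cases a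
        · exact Or.inr (Or.inl rfl)
        all_goals
          simp [q] at h3
          linarith
      · exact Or.inl ⟨h, hq, h3⟩

theorem closure_isCompact {lam : ℝ} (h0 : 0 < lam) (h1 : lam ≤ 1) :
    IsCompact (Om lam ∪ ({q 0} ∪ X lam)) := by
  rw [closure_eq h0 h1]
  exact gasket_isCompact.inter_right (isClosed_le continuous_const continuous_snd)

theorem Flam_mem_closure {lam : ℝ} (h0 : 0 < lam) (h1 : lam ≤ 1) {n : ℕ} {w : Fin n → Fin 6}
    (hw : w ∈ W lam n)
    {z : Plane} (hz : z ∈ gasket) (hd : 1 - z.2 ≤ lamSeq lam n) :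
    Flam lam w z ∈ Om lam ∪ ({q 0} ∪ X lam) := by
  rw [closure_eq h0 h1]
  refine ⟨Fword_mem _ hz, ?_⟩
  have h2 := depth_Flam h0 h1 hw z
  have : 0 ≤ (1 / 3 : ℝ) ^ mSeq lam n * (lamSeq lam n - (1 - z.2)) :=
    mul_nonneg (by positivity) (by linarith)
  simp only [Set.mem_ofPred_eq]
  linarith

theorem depth_top_iterate {mu : ℝ} (g0 : 0 < mu) (g1 : mu ≤ 1) {b : Fin 3} :
    1 - ((F 0)^[m1 mu] (q b)).2 ≤ mu := by
  rw [depth_iterate, div_le_iff₀ (by positivity)]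
  have h2 := (m1_spec g0 g1).2.1
  have h3 := depth_le_one (q_mem b)
  linarith

namespace IsDirichletSolution

variable {lam a : ℝ} {f u : Plane → ℝ}

theorem tendsto_apex (h : IsDirichletSolution lam a f u) :
    Tendsto u (𝓝[Om lam] (q 0)) (𝓝 a) := by
  have := h.continuousOn (q 0) (Or.inr (Or.inl rfl))
  rw [ContinuousWithinAt, h.apex] at this
  exact this.mono_left (nhdsWithin_mono _ Set.subset_union_left)

theorem harm (h0 : 0 < lam) (h1 : lam ≤ 1) (h : IsDirichletSolution lam a f u) : Harm lam u := by
  have := h.harmonic.harm h0 h1 h.tendsto_apex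
  rwa [← h.apex, Function.update_eq_self] at this

/-- If the boundary values vanish, then `u` is small near the boundary. -/
theorem small_near_boundary (h0 : 0 < lam) (h1 : lam ≤ 1)
    (h : IsDirichletSolution lam a (fun _ => 0) u) {ε : ℝ} (hε : 0 < ε) :
    ∃ δ > 0, ∀ z ∈ Om lam ∪ ({q 0} ∪ X lam), lam - δ < 1 - z.2 → |u z| ≤ ε := by
  set C := {z ∈ Om lam ∪ ({q 0} ∪ X lam) | ε ≤ |u z|} with hC
  have hcl : IsClosed C :=
    h.continuousOn.abs.preimage_isClosed_of_isClosed (closure_isCompact h0 h1).isClosed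
      isClosed_Ici
  have hcomp : IsCompact C := (closure_isCompact h0 h1).of_isClosed_subset hcl fun z hz => hz.1
  rcases C.eq_empty_or_nonempty with he | hne
  · refine ⟨1, one_pos, fun z hz _ => ?_⟩
    by_contra hc
    have : z ∈ C := ⟨hz, (not_le.1 hc).le⟩
    rw [he] at this
    exact this
  obtain ⟨y, hy, hmin⟩ := hcomp.exists_isMinOn hne (continuous_snd.continuousOn (s := C))
  have hlt : 1 - lam < y.2 := by
    have h2 := hy.1
    rw [closure_eq h0 h1] at h2
    refine lt_of_le_of_ne h2.2 fun e => ?_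
    have h3 : y ∈ X lam := ⟨h2.1, e.symm⟩
    have h4 := hy.2
    rw [h.boundary y h3] at h4
    simp at h4
    linarith
  refine ⟨y.2 - (1 - lam), by linarith, fun z hz hd => ?_⟩
  by_contra hc
  have hzC : z ∈ C := ⟨hz, (not_le.1 hc).le⟩
  have : y.2 ≤ z.2 := hmin hzC
  linarith

/-- Vanishing boundary values have vanishing mean: the mean is an average of means below small cells
near the boundary, where `u` is small. -/
theorem beta_eq_zero (h0 : 0 < lam) (h1 : lam ≤ 1)
    (h : IsDirichletSolution lam a (fun _ => 0) u) : beta lam u = 0 := by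
  have hH := h.harm h0 h1
  by_contra hne
  have hpos : 0 < |beta lam u| := abs_pos.2 hne
  obtain ⟨δ, hδ, hsm⟩ := h.small_near_boundary h0 h1 (ε := |beta lam u| / 10) (by positivity)
  obtain ⟨n, hn⟩ : ∃ n : ℕ, (1 / 3 : ℝ) ^ mSeq lam n < δ := by
    have hp : Tendsto (fun n => (1 / 3 : ℝ) ^ mSeq lam n) atTop (𝓝 0) :=
      (tendsto_pow_atTop_nhds_zero_of_lt_one (by norm_num) (by norm_num)).comp
        (mSeq_strictMono h0 h1).tendsto_atTop
    exact (hp.eventually_lt_const hδ).exists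
  obtain ⟨g0, g1⟩ := lamSeq_mem h0 h1 n
  have hz : ∀ w ∈ W lam n, ∀ z ∈ gasket, 1 - z.2 ≤ lamSeq lam n →
      |part lam u w z| ≤ |beta lam u| / 10 := by
    intro w hw z hz hd
    refine hsm _ (Flam_mem_closure h0 h1 hw hz hd) ?_
    rw [depth_Flam h0 h1 hw]
    have h3 := depth_nonneg hz
    have h4 : (1 / 3 : ℝ) ^ mSeq lam n * (lamSeq lam n - (1 - z.2)) ≤ (1 / 3 : ℝ) ^ mSeq lam n :=
      mul_le_of_le_one_right (by positivity) (by linarith)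
    linarith
  have hb : ∀ w ∈ W lam n, |beta (lamSeq lam n) (part lam u w)| ≤ 5 * (|beta lam u| / 10) :=
    fun w hw => abs_beta_le g0 g1 _ (hz w hw _ (q_mem 0) (by simp [q]; exact g0.le))
      (hz w hw _ (iterate_mem _ (q_mem 1)) (depth_top_iterate g0 g1))
      (hz w hw _ (iterate_mem _ (q_mem 2)) (depth_top_iterate g0 g1))
  have hle : |beta lam u| ≤ ∑ w ∈ W lam n, mass lam w * (5 * (|beta lam u| / 10)) := by
    conv_lhs => rw [hH.beta_eq_sum h0 h1 n]
    refine (Finset.abs_sum_le_sum_abs _ _).trans (Finset.sum_le_sum fun w hw => ?_)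
    rw [abs_mul, abs_of_pos (mass_pos h0 h1 w)]
    exact mul_le_mul_of_nonneg_left (hb w hw) (mass_pos h0 h1 w).le
  rw [← Finset.sum_mul, sum_mass h0 h1, one_mul] at hle
  linarith

end IsDirichletSolution

theorem Harm.normalDeriv {lam : ℝ} {u : Plane → ℝ} (h0 : 0 < lam) (h1 : lam ≤ 1)
    (h : Harm lam u) : normalDeriv u = etaT lam * drop lam u := by
  refine Tendsto.limUnder_eq (tendsto_const_nhds.congr' ?_)
  filter_upwards [eventually_ge_atTop (m1 lam)] with m hm
  have h2 := h.lap_top h0 h1 hm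
  have h3 := lap_iterate 0 m u
  rw [zero_add, h2, lap_zero_corner] at h3
  simp only [Function.comp, Function.iterate_fixed F0_q0] at h3
  have e : (15 / 7 : ℝ) ^ m * (7 / 15) ^ m = 1 := by rw [← mul_pow]; norm_num
  linear_combination (15 / 7 : ℝ) ^ m * h3 - (etaT lam * drop lam u) * e

/-- The normal derivative of `h₀` at `q₀` is the limit of the effective conductances. -/
theorem eta_eq {lam : ℝ} (h0 : 0 < lam) (h1 : lam ≤ 1) : eta lam = etaT lam := by
  have h : IsDirichletSolution lam 1 (fun _ => 0) (SG3.h0 lam) :=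
    Classical.epsilon_spec (exists_dirichlet h0 h1)
  have hb := h.beta_eq_zero h0 h1
  rw [eta, (h.harm h0 h1).normalDeriv h0 h1]
  rw [beta, h.apex] at hb
  have : drop lam (SG3.h0 lam) = 1 := by linarith
  rw [this, mul_one]

theorem weight_eq {lam : ℝ} (h0 : 0 < lam) (h1 : lam ≤ 1) (i : Fin 6) :
    weight lam i = wT lam i := by
  rw [weight, wT, eta_eq (R_mem h0 h1).1 (R_mem h0 h1).2]

theorem haarValue_eq {lam : ℝ} (h0 : 0 < lam) (h1 : lam ≤ 1) (j : ℕ) (i : Fin 6) :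
    haarValue lam j i = haarT lam j i := by
  rw [haarValue, haarT, weight_eq h0 h1, weight_eq h0 h1]

/-! ### The energy as a sum over the networks along the boundary -/

/-- The graph energy at level `m` of the cells of depth less than `lam`, including the cell at the
top vertex, in recursive form. -/
noncomputable def graphE : ℕ → ℝ → (Plane → ℝ) → ℝ
  | 0, lam, u => if 1 < lam then tri u else 0
  | m + 1, lam, u => 15 / 7 * ∑ p : Fin 6, graphE m (3 * lam - dp p) (u ∘ F p)

theorem graphE_nonneg (m : ℕ) (lam : ℝ) (u : Plane → ℝ) : 0 ≤ graphE m lam u := by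
  induction m generalizing lam u with
  | zero => rw [graphE]; split_ifs; exacts [tri_nonneg u, le_rfl]
  | succ m ih => exact mul_nonneg (by norm_num) (Finset.sum_nonneg fun p _ => ih _ _)

theorem graphE_of_nonpos (m : ℕ) {lam : ℝ} (h : lam ≤ 0) (u : Plane → ℝ) :
    graphE m lam u = 0 := by
  induction m generalizing lam u with
  | zero => rw [graphE, if_neg (by linarith)]
  | succ m ih =>
    rw [graphE, Finset.sum_eq_zero, mul_zero]
    intro p _
    exact ih (by have := dp_nonneg p; linarith) _

theorem FullHarm.graphE_eq {u : Plane → ℝ} (h : FullHarm u) (m : ℕ) {lam : ℝ} (hl : 1 < lam) :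
    graphE m lam u = tri u := by
  induction m generalizing lam u with
  | zero => rw [graphE, if_pos hl]
  | succ m ih =>
    have : ∀ p, graphE m (3 * lam - dp p) (u ∘ F p) = tri (u ∘ F p) := fun p =>
      ih (h.comp p) (by have := dp_le_two p; linarith)
    rw [graphE, Finset.sum_congr rfl fun p _ => this p, h.ext.sum_tri]
    ring

theorem Harm.graphE_mono {lam : ℝ} {u : Plane → ℝ} (h : Harm lam u) :
    Monotone fun m => graphE m lam u := by
  refine monotone_nat_of_le_succ fun m => ?_
  induction m generalizing lam u with
  | zero =>
    by_cases hl : 1 < lam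
    · rw [FullHarm.graphE_eq (h.mono hl) _ hl, FullHarm.graphE_eq (h.mono hl) _ hl]
    · rw [graphE, if_neg hl]
      exact graphE_nonneg _ _ _
  | succ m ih =>
    rw [graphE, graphE]
    exact mul_le_mul_of_nonneg_left (Finset.sum_le_sum fun p _ => ih (h.comp p)) (by norm_num)

theorem graphE_iterate (m : ℕ) {lam : ℝ} (u : Plane → ℝ) {k : ℕ} (hk : 3 ^ k * lam ≤ 1)
    (h0 : 0 ≤ lam) :
    graphE (m + k) lam u = (15 / 7) ^ k * graphE m (3 ^ k * lam) (u ∘ (F 0)^[k]) := by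
  induction k generalizing lam u with
  | zero => simp
  | succ k ih =>
    have hk' : 3 ^ k * (3 * lam) ≤ 1 := by rw [← mul_assoc, ← pow_succ]; exact hk
    have h3 : 3 * lam ≤ 1 := le_trans
      (le_mul_of_one_le_left (by positivity) (one_le_pow₀ (by norm_num))) hk'
    have hz : ∀ p : Fin 6, 1 ≤ dp p → graphE (m + k) (3 * lam - dp p) (u ∘ F p) = 0 :=
      fun p hp => graphE_of_nonpos _ (by linarith) _
    have e0 : 3 * lam - dp 0 = 3 * lam := by simp [dp]
    have hsum : ∑ p : Fin 6, graphE (m + k) (3 * lam - dp p) (u ∘ F p)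
        = graphE (m + k) (3 * lam) (u ∘ F 0) := by
      rw [Fin.sum_univ_six, e0, hz 1, hz 2, hz 3, hz 4, hz 5]
      · ring
      all_goals simp [dp]
    rw [← add_assoc, graphE, hsum, ih (u ∘ F 0) hk' (by positivity), pow_succ, ← mul_assoc,
      Function.comp_assoc, ← Function.iterate_succ' (F 0) k, pow_succ 3, mul_assoc (3 ^ k : ℝ)]
    ring

section

variable {lam : ℝ} {u : Plane → ℝ}

/-- One stage of the self-similar decomposition: a network of full cells, followed by copies of
smaller upper domains. -/
theorem Harm.graphE_step (h0 : 0 < lam) (h1 : lam ≤ 1) (h : Harm lam u) (m : ℕ) :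
    graphE (m + m1 lam) lam u = (15 / 7) ^ m1 lam * (netE lam u
      + ∑ i ∈ S (iota1 lam), graphE m (R lam) (SG3.branch lam u i)) := by
  obtain ⟨hm, hm2, hm3⟩ := m1_spec h0 h1
  have e3 := three_pow_m1 h0 h1
  obtain ⟨r0, r1⟩ := R_mem h0 h1
  have hfull : ∀ p, dp p < iota1 lam → dp p + 1 ≤ iota1 lam →
      graphE m (3 * (3 ^ (m1 lam - 1) * lam) - dp p) (SG3.headFun lam u ∘ F p)
        = tri (SG3.headFun lam u ∘ F p) := fun p hp hp' =>
    (h.head_full h0 h1 hp).graphE_eq m (by rw [e3]; linarith)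
  have hbr : ∀ i ∈ S (iota1 lam),
      graphE m (3 * (3 ^ (m1 lam - 1) * lam) - dp i) (SG3.headFun lam u ∘ F i)
        = graphE m (R lam) (SG3.branch lam u i) := fun i hi => by
    rw [e3, dp_of_mem (iota1_eq lam) hi, add_sub_cancel_right]; rfl
  have hout : ∀ p, (iota1 lam : ℝ) + 1 ≤ dp p →
      graphE m (3 * (3 ^ (m1 lam - 1) * lam) - dp p) (SG3.headFun lam u ∘ F p) = 0 := fun p hp =>
    graphE_of_nonpos _ (by rw [e3]; linarith) _
  have hle : 3 ^ (m1 lam - 1) * lam ≤ 1 := by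
    rcases iota1_eq lam with hi | hi <;> rw [hi] at e3 <;> push_cast at e3 <;> linarith
  have e : m + m1 lam = m + 1 + (m1 lam - 1) := by omega
  have ep : (15 / 7 : ℝ) ^ m1 lam = (15 / 7) ^ (m1 lam - 1) * (15 / 7) := by
    rw [← pow_succ]; congr 1; omega
  rw [e, graphE_iterate (m + 1) u hle h0.le, graphE, ep, mul_assoc]
  change (15 / 7 : ℝ) ^ (m1 lam - 1) * (15 / 7 * ∑ p : Fin 6,
    graphE m (3 * (3 ^ (m1 lam - 1) * lam) - dp p) (SG3.headFun lam u ∘ F p)) = _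
  congr 2
  rw [Fin.sum_univ_six, netE]
  rcases iota1_eq lam with hi | hi
  · rw [hi] at hfull hbr hout ⊢
    rw [hfull 0, hout 1, hout 2, hout 3, hbr 4, hbr 5, sum_S_one, if_pos rfl]
    · ring
    all_goals simp [dp, S_one]
    all_goals norm_num
  · rw [hi] at hfull hbr hout ⊢
    rw [hfull 0, hbr 1, hbr 2, hbr 3, hfull 4, hfull 5, sum_S_two, if_neg (by norm_num)]
    · ring
    all_goals simp [dp, S_two]
    all_goals norm_num

/-- The energy of the networks of stage `k`. -/
noncomputable def stageE (lam : ℝ) (u : Plane → ℝ) (k : ℕ) : ℝ :=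
  ∑ w ∈ W lam k, (15 / 7) ^ mSeq lam (k + 1) * netE (lamSeq lam k) (SG3.part lam u w)

theorem stageE_nonneg (lam : ℝ) (u : Plane → ℝ) (k : ℕ) : 0 ≤ stageE lam u k :=
  Finset.sum_nonneg fun _ _ => mul_nonneg (by positivity) (netE_nonneg _ _)

theorem Harm.graphE_stages (h0 : 0 < lam) (h1 : lam ≤ 1) (h : Harm lam u) (n m : ℕ) :
    graphE (m + mSeq lam n) lam u = ∑ k ∈ Finset.range n, stageE lam u k
      + ∑ w ∈ W lam n, (15 / 7) ^ mSeq lam n * graphE m (lamSeq lam n) (SG3.part lam u w) := by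
  induction n generalizing m with
  | zero =>
    rw [W_zero, Finset.sum_singleton, part_zero]
    simp [mSeq, lamSeq]
  | succ n ih =>
    obtain ⟨g0, g1⟩ := lamSeq_mem h0 h1 n
    have e : m + mSeq lam (n + 1) = (m + m1 (lamSeq lam n)) + mSeq lam n := by
      rw [mSeq_succ]; omega
    rw [e, ih, Finset.sum_range_succ, add_assoc, sum_W_succ, stageE, ← Finset.sum_add_distrib]
    congr 1
    refine Finset.sum_congr rfl fun w hw => ?_
    rw [(h.part h0 h1 hw).graphE_step g0 g1, mSeq_succ, pow_add, ← mul_assoc, mul_add,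
      Finset.mul_sum]
    simp only [part_ext, lamSeq_succ, digit]

theorem Harm.graphE_mSeq (h0 : 0 < lam) (h1 : lam ≤ 1) (h : Harm lam u) (n : ℕ) :
    graphE (mSeq lam n) lam u = ∑ k ∈ Finset.range n, stageE lam u k := by
  have := h.graphE_stages h0 h1 n 0
  rw [zero_add] at this
  rw [this, add_eq_left]
  refine Finset.sum_eq_zero fun w _ => ?_
  rw [graphE, if_neg (not_lt.2 (lamSeq_mem h0 h1 n).2), mul_zero]

/-- The energy of the cell of level `m` at the top vertex, if its depth is less than `lam`. -/
noncomputable def topE (m : ℕ) (lam : ℝ) (u : Plane → ℝ) : ℝ :=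
  if 1 < 3 ^ m * lam then (15 / 7) ^ m * tri (u ∘ (F 0)^[m]) else 0

theorem topE_nonneg (m : ℕ) (lam : ℝ) (u : Plane → ℝ) : 0 ≤ topE m lam u := by
  rw [topE]; split_ifs
  exacts [mul_nonneg (by positivity) (tri_nonneg _), le_rfl]

theorem topE_succ (m : ℕ) (lam : ℝ) (u : Plane → ℝ) :
    topE (m + 1) lam u = 15 / 7 * topE m (3 * lam) (u ∘ F 0) := by
  rw [topE, topE, pow_succ, mul_assoc, Function.comp_assoc, ← Function.iterate_succ' (F 0) m]
  split_ifs <;> ring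

theorem cellEnergy_cons (u : Plane → ℝ) (p : Fin 6) (w : List (Fin 6)) :
    cellEnergy u (p :: w) = 15 / 7 * cellEnergy (u ∘ F p) w := by
  simp only [cellEnergy, List.length_cons, Fword_cons, Function.comp]
  ring

theorem forall_cell_nil {lam : ℝ} : (∀ z ∈ cell [], 1 - z.2 < lam) ↔ 1 < lam := by
  constructor
  · intro h
    have := h (q 1) (mem_cell_nil.2 (q_mem 1))
    simpa [q] using this
  · intro h z hz
    exact (depth_le_one (mem_cell_nil.1 hz)).trans_lt h

theorem forall_cell_cons {lam : ℝ} {p : Fin 6} {w : List (Fin 6)} :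
    (∀ z ∈ cell (p :: w), 1 - z.2 < lam) ↔ ∀ z ∈ cell w, 1 - z.2 < 3 * lam - dp p := by
  constructor
  · rintro h _ ⟨z, hz, rfl⟩
    have := h (Fword (p :: w) z) ⟨z, hz, rfl⟩
    rw [Fword_cons, depth_F] at this
    linarith
  · rintro h _ ⟨z, hz, rfl⟩
    have := h (Fword w z) ⟨z, hz, rfl⟩
    rw [Fword_cons, depth_F]
    linarith

open Classical in
theorem sum_cellEnergy (m : ℕ) (lam : ℝ) (u : Plane → ℝ) :
    ∑ w : Fin m → Fin 6, (if ∀ z ∈ cell (List.ofFn w), 1 - z.2 < lam then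
      cellEnergy u (List.ofFn w) else 0) = graphE m lam u := by
  induction m generalizing lam u with
  | zero =>
    simp only [List.ofFn_zero, forall_cell_nil, Finset.univ_unique, Finset.sum_singleton]
    simp [graphE, cellEnergy, tri, Fword]
  | succ m ih =>
    rw [sum_word_succ m fun l => if ∀ z ∈ cell l, 1 - z.2 < lam then cellEnergy u l else 0, graphE,
      Finset.mul_sum]
    refine Finset.sum_congr rfl fun p _ => ?_
    rw [← ih, Finset.mul_sum]
    refine Finset.sum_congr rfl fun w _ => ?_
    rw [forall_cell_cons, cellEnergy_cons, mul_ite, mul_zero]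

open Classical in
/-- The cells that do not contain the top vertex carry all energy but that of one cell. -/
theorem sum_cellEnergy_punctured (m : ℕ) (lam : ℝ) (u : Plane → ℝ) :
    ∑ w : Fin m → Fin 6, (if (∀ z ∈ cell (List.ofFn w), 1 - z.2 < lam) ∧ q 0 ∉ cell (List.ofFn w)
      then cellEnergy u (List.ofFn w) else 0) + topE m lam u = graphE m lam u := by
  induction m generalizing lam u with
  | zero =>
    have : q 0 ∈ cell [] := mem_cell_nil.2 (q_mem 0)
    simp [this, graphE, topE]
  | succ m ih =>
    rw [sum_word_succ m fun l => if (∀ z ∈ cell l, 1 - z.2 < lam) ∧ q 0 ∉ cell l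
      then cellEnergy u l else 0, graphE, Fin.sum_univ_succ,
      Fin.sum_univ_succ (f := fun p => graphE m (3 * lam - dp p) (u ∘ F p)), mul_add, topE_succ,
      add_right_comm, Finset.mul_sum]
    have e0 : 3 * lam - dp 0 = 3 * lam := by simp [dp]
    congr 1
    · rw [e0, ← ih, mul_add, Finset.mul_sum]
      congr 1
      refine Finset.sum_congr rfl fun w _ => ?_
      have hG : G 0 (q 0) = q 0 := (F_eq_iff.1 F0_q0).symm
      rw [forall_cell_cons, cellEnergy_cons, mem_cell_cons, hG, mul_ite, mul_zero, e0]
    · refine Finset.sum_congr rfl fun p _ => ?_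
      rw [← sum_cellEnergy, Finset.mul_sum]
      refine Finset.sum_congr rfl fun w _ => ?_
      have hG : q 0 ∉ cell (p.succ :: List.ofFn w) := fun hc =>
        G_q_notMem (p := p.succ) (a := 0) (by rw [cr_zero]; exact Fin.succ_ne_zero p)
          (cell_subset_gasket _ (mem_cell_cons.1 hc))
      rw [cellEnergy_cons]
      simp only [hG, not_false_eq_true, and_true, forall_cell_cons, mul_ite, mul_zero]

theorem cell_subset_Om (h1 : lam ≤ 1) {w : List (Fin 6)} : cell w ⊆ Om lam ↔
    (∀ z ∈ cell w, 1 - z.2 < lam) ∧ q 0 ∉ cell w := by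
  constructor
  · intro h
    exact ⟨fun z hz => by linarith [(h hz).2.2], fun hc => (h hc).2.1 ⟨0, rfl⟩⟩
  · rintro ⟨h, h'⟩ z hz
    refine ⟨cell_subset_gasket w hz, ?_, by linarith [h z hz]⟩
    rintro ⟨a, rfl⟩
    have h2 := h _ hz
    fin_cases a
    · exact h' hz
    all_goals
      simp [q] at h2
      linarith

theorem cellEnergy_update {w : List (Fin 6)} (a : ℝ) (hw : q 0 ∉ cell w) :
    cellEnergy (Function.update u (q 0) a) w = cellEnergy u w := by
  have : ∀ i, Function.update u (q 0) a (Fword w (q i)) = u (Fword w (q i)) := fun i =>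
    Function.update_of_ne (fun hc => hw ⟨q i, q_mem i, hc⟩) _ _
  simp only [cellEnergy, this]

theorem cellEnergy_nonneg (w : List (Fin 6)) : 0 ≤ cellEnergy u w := by
  unfold cellEnergy; positivity

/-- The cell of `topE` is not contained in `Ω_λ`, and the value at `q₀` does not enter the energy. -/
theorem energy_eq (h1 : lam ≤ 1) (a : ℝ) : energy (Om lam) u
    = ⨆ m, ENNReal.ofReal (graphE m lam (Function.update u (q 0) a)
      - topE m lam (Function.update u (q 0) a)) := by
  classical
  rw [energy]
  congr 1
  funext m
  rw [← sum_cellEnergy_punctured, add_sub_cancel_right, ENNReal.ofReal_sum_of_nonneg]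
  · refine Finset.sum_congr rfl fun w _ => ?_
    by_cases h : cell (List.ofFn w) ⊆ Om lam
    · rw [if_pos h, if_pos ((cell_subset_Om h1).1 h),
        cellEnergy_update a ((cell_subset_Om h1).1 h).2]
    · rw [if_neg h, if_neg (mt (cell_subset_Om h1).2 h), ENNReal.ofReal_zero]
  · intro w _
    split_ifs
    exacts [cellEnergy_nonneg _, le_rfl]

theorem FullHarm.tri_iterate (h : FullHarm u) (k : ℕ) :
    tri (u ∘ (F 0)^[k]) ≤ ((7 / 15) ^ 2) ^ k * tri u := by
  induction k generalizing u with
  | zero => simp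
  | succ k ih =>
    have := ih (h.comp 0)
    rw [Function.comp_assoc, ← Function.iterate_succ' (F 0) k] at this
    refine this.trans ?_
    rw [pow_succ ((7 / 15 : ℝ) ^ 2), mul_assoc]
    exact mul_le_mul_of_nonneg_left h.ext.tri_top (by positivity)

/-- A point has no energy. -/
theorem Harm.tendsto_topE (h0 : 0 < lam) (h1 : lam ≤ 1) (h : Harm lam u) :
    Tendsto (fun m => topE m lam u) atTop (𝓝 0) := by
  have hv : FullHarm (u ∘ (F 0)^[m1 lam]) := by
    rw [← headFun_comp_zero h0 h1]
    refine h.head_full h0 h1 ?_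
    rcases iota1_eq lam with hi | hi <;> rw [hi] <;> simp [dp]
  rw [← tendsto_add_atTop_iff_nat (m1 lam)]
  have hz : Tendsto (fun k : ℕ => (15 / 7 : ℝ) ^ m1 lam * tri (u ∘ (F 0)^[m1 lam]) * (7 / 15) ^ k)
      atTop (𝓝 0) := by
    simpa using (tendsto_pow_atTop_nhds_zero_of_lt_one (r := (7 / 15 : ℝ)) (by norm_num)
      (by norm_num)).const_mul ((15 / 7 : ℝ) ^ m1 lam * tri (u ∘ (F 0)^[m1 lam]))
  refine squeeze_zero (fun k => topE_nonneg _ _ _) (fun k => ?_) hz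
  have hk := hv.tri_iterate k
  rw [Function.comp_assoc, ← Function.iterate_add, add_comm (m1 lam)] at hk
  rw [topE]
  split_ifs with hc
  · refine (mul_le_mul_of_nonneg_left hk (by positivity)).trans (le_of_eq ?_)
    have e : (15 / 7 : ℝ) ^ k * ((7 / 15) ^ 2) ^ k = (7 / 15) ^ k := by
      rw [← mul_pow]; norm_num
    rw [pow_add]
    linear_combination ((15 / 7 : ℝ) ^ m1 lam * tri (u ∘ (F 0)^[m1 lam])) * e
  · have := tri_nonneg (u ∘ (F 0)^[m1 lam])
    positivity

/-- The energy is the sum of the energies of the stages. -/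
theorem energy_eq_stages (h0 : 0 < lam) (h1 : lam ≤ 1) {a : ℝ}
    (h : Harm lam (Function.update u (q 0) a)) : energy (Om lam) u
      = ⨆ n, ENNReal.ofReal (∑ k ∈ Finset.range n, stageE lam (Function.update u (q 0) a) k) := by
  rw [energy_eq h1 a]
  set v := Function.update u (q 0) a
  refine le_antisymm (iSup_le fun m => ?_) (iSup_le fun n => ?_)
  · refine le_iSup_of_le m (ENNReal.ofReal_le_ofReal ?_)
    rw [← h.graphE_mSeq h0 h1]
    have := h.graphE_mono ((mSeq_strictMono h0 h1).id_le m)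
    have h2 := topE_nonneg m lam v
    simp only [id] at this
    linarith
  · rw [← h.graphE_mSeq h0 h1]
    have hlim : Tendsto (fun m => (⨆ m, ENNReal.ofReal (graphE m lam v - topE m lam v))
        + ENNReal.ofReal (topE m lam v)) atTop
        (𝓝 ((⨆ m, ENNReal.ofReal (graphE m lam v - topE m lam v)) + ENNReal.ofReal 0)) :=
      (ENNReal.tendsto_ofReal (h.tendsto_topE h0 h1)).const_add _
    rw [ENNReal.ofReal_zero, add_zero] at hlim
    refine ge_of_tendsto hlim ?_
    filter_upwards [eventually_ge_atTop (mSeq lam n)] with m hm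
    calc ENNReal.ofReal (graphE (mSeq lam n) lam v)
        ≤ ENNReal.ofReal ((graphE m lam v - topE m lam v) + topE m lam v) :=
          ENNReal.ofReal_le_ofReal (by have := h.graphE_mono hm; simp only at this; linarith)
      _ ≤ _ := ENNReal.ofReal_add_le
      _ ≤ _ := by gcongr; exact le_iSup (fun m => ENNReal.ofReal (graphE m lam v - topE m lam v)) m

end

/-! ### Comparison of the energy with the Haar coefficients -/

section

variable {lam : ℝ} {u : Plane → ℝ}

/-- The contribution of the words of length `k` to the weighted sum of squares of coefficients. -/
noncomputable def coefE (lam : ℝ) (u : Plane → ℝ) (k : ℕ) : ℝ :=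
  ∑ w ∈ W lam k, (15 / 7) ^ mSeq lam (k + 1) * ∑ j ∈ Finset.Icc 1 (digit lam k),
    coef (lamSeq lam k) (SG3.part lam u w) j ^ 2

theorem coefE_nonneg (lam : ℝ) (u : Plane → ℝ) (k : ℕ) : 0 ≤ coefE lam u k :=
  Finset.sum_nonneg fun _ _ => mul_nonneg (by positivity) (Finset.sum_nonneg fun _ _ => sq_nonneg _)

theorem coefE_le (h0 : 0 < lam) (h1 : lam ≤ 1) (u : Plane → ℝ) (k : ℕ) :
    coefE lam u k ≤ 12 * (stageE lam u k + stageE lam u (k + 1)) := by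
  obtain ⟨g0, g1⟩ := lamSeq_mem h0 h1 k
  rw [stageE, stageE, sum_W_succ, ← Finset.sum_add_distrib, Finset.mul_sum]
  refine Finset.sum_le_sum fun w _ => ?_
  have hc := coef_sq_le g0 g1 (SG3.part lam u w)
  simp only [part_ext, lamSeq_succ]
  have hp : (15 / 7 : ℝ) ^ mSeq lam (k + 1) ≤ (15 / 7) ^ mSeq lam (k + 1 + 1) :=
    pow_le_pow_right₀ (by norm_num) ((mSeq_strictMono h0 h1).monotone (Nat.le_succ _))
  have hs : 0 ≤ ∑ i ∈ S (digit lam k),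
      netE (R (lamSeq lam k)) (branch (lamSeq lam k) (SG3.part lam u w) i) :=
    Finset.sum_nonneg fun _ _ => netE_nonneg _ _
  have h2 := mul_le_mul_of_nonneg_right hp hs
  have h3 := mul_le_mul_of_nonneg_left hc
    (by positivity : (0 : ℝ) ≤ (15 / 7) ^ mSeq lam (k + 1))
  rw [← Finset.mul_sum]
  simp only [digit] at h2 h3 ⊢
  nlinarith

/-- The coefficients of stage `k` are controlled by the energies of the stages `k` and `k + 1`. -/
theorem sum_coefE_le (h0 : 0 < lam) (h1 : lam ≤ 1) (u : Plane → ℝ) (n : ℕ) :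
    ∑ k ∈ Finset.range n, coefE lam u k ≤ 24 * ∑ k ∈ Finset.range (n + 1), stageE lam u k := by
  have h2 : ∑ k ∈ Finset.range n, coefE lam u k
      ≤ ∑ k ∈ Finset.range n, 12 * (stageE lam u k + stageE lam u (k + 1)) :=
    Finset.sum_le_sum fun k _ => coefE_le h0 h1 u k
  rw [← Finset.mul_sum, Finset.sum_add_distrib] at h2
  have h3 := Finset.sum_range_succ (stageE lam u) n
  have h4 := Finset.sum_range_succ' (stageE lam u) n
  have h5 := stageE_nonneg lam u n
  have h6 := stageE_nonneg lam u 0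
  linarith

theorem drop_sq_le_stageE (h0 : 0 < lam) (h1 : lam ≤ 1) (u : Plane → ℝ) :
    (15 / 7) ^ mSeq lam 1 * drop lam u ^ 2 ≤ 2 * stageE lam u 0 := by
  rw [stageE, W_zero, Finset.sum_singleton, part_zero]
  have := mul_le_mul_of_nonneg_left (drop_sq_le h0 h1 u)
    (by positivity : (0 : ℝ) ≤ (15 / 7) ^ mSeq lam 1)
  simp only [lamSeq, Function.iterate_zero, id, zero_add]
  linarith

/-- Summation of the estimates for the single networks: the boundary terms telescope. -/
theorem Harm.sum_stageE_le (h0 : 0 < lam) (h1 : lam ≤ 1) (h : Harm lam u) (n : ℕ) :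
    ∑ k ∈ Finset.range n, stageE lam u k
      + ∑ w ∈ W lam n, (15 / 7) ^ mSeq lam n
        * (etaT (lamSeq lam n) * drop (lamSeq lam n) (SG3.part lam u w) ^ 2)
      ≤ etaT lam * drop lam u ^ 2 + 6 * ∑ k ∈ Finset.range n, coefE lam u k := by
  induction n with
  | zero =>
    rw [W_zero, Finset.sum_singleton, part_zero]
    simp [mSeq, lamSeq]
  | succ n ih =>
    obtain ⟨g0, g1⟩ := lamSeq_mem h0 h1 n
    have key : stageE lam u n + ∑ w ∈ W lam (n + 1), (15 / 7) ^ mSeq lam (n + 1)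
          * (etaT (lamSeq lam (n + 1)) * drop (lamSeq lam (n + 1)) (SG3.part lam u w) ^ 2)
        ≤ ∑ w ∈ W lam n, (15 / 7) ^ mSeq lam n
          * (etaT (lamSeq lam n) * drop (lamSeq lam n) (SG3.part lam u w) ^ 2)
          + 6 * coefE lam u n := by
      rw [stageE, coefE, sum_W_succ, Finset.mul_sum, ← Finset.sum_add_distrib,
        ← Finset.sum_add_distrib]
      refine Finset.sum_le_sum fun w hw => ?_
      have hu := (h.part h0 h1 hw).netE_upper g0 g1
      have h3 := mul_le_mul_of_nonneg_left hu
        (by positivity : (0 : ℝ) ≤ (15 / 7) ^ mSeq lam (n + 1))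
      simp only [part_ext, lamSeq_succ, digit] at h3 ⊢
      rw [← Finset.mul_sum, ← Finset.mul_sum, etaT_eq g0 g1]
      rw [mSeq_succ, pow_add] at h3 ⊢
      linarith
    rw [Finset.sum_range_succ, Finset.sum_range_succ, mul_add]
    linarith

theorem Harm.sum_stageE_le' (h0 : 0 < lam) (h1 : lam ≤ 1) (h : Harm lam u) (n : ℕ) :
    ∑ k ∈ Finset.range n, stageE lam u k
      ≤ 6 * ((15 / 7) ^ mSeq lam 1 * drop lam u ^ 2 + ∑ k ∈ Finset.range n, coefE lam u k) := by
  have h2 := h.sum_stageE_le h0 h1 n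
  have h3 : 0 ≤ ∑ w ∈ W lam n, (15 / 7) ^ mSeq lam n
        * (etaT (lamSeq lam n) * drop (lamSeq lam n) (SG3.part lam u w) ^ 2) := by
    obtain ⟨g0, g1⟩ := lamSeq_mem h0 h1 n
    have := etaT_ge g0 g1
    exact Finset.sum_nonneg fun w _ => by positivity
  have h4 : etaT lam ≤ 2 * (15 / 7) ^ mSeq lam 1 := by
    have e : mSeq lam 1 = m1 lam := by simp [mSeq, lamSeq]
    rw [etaT_eq h0 h1, e, mul_comm]
    exact mul_le_mul_of_nonneg_right (theta_bounds h0 h1).2 (by positivity)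
  have h5 := mul_le_mul_of_nonneg_right h4 (sq_nonneg (drop lam u))
  have h6 : 0 ≤ (15 / 7 : ℝ) ^ mSeq lam 1 * drop lam u ^ 2 := by positivity
  linarith

/-- The energy is comparable to the weighted sum of the squares of the coefficients. -/
theorem energy_comparison (h0 : 0 < lam) (h1 : lam ≤ 1) {a : ℝ}
    (h : Harm lam (Function.update u (q 0) a)) {Q : ℝ≥0∞}
    (hQ : Q = ENNReal.ofReal ((15 / 7) ^ mSeq lam 1 * drop lam (Function.update u (q 0) a) ^ 2)
      + ∑' n, ENNReal.ofReal (coefE lam (Function.update u (q 0) a) n)) :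
    ENNReal.ofReal (1 / 26) * Q ≤ energy (Om lam) u ∧
      energy (Om lam) u ≤ ENNReal.ofReal 6 * Q := by
  rw [energy_eq_stages h0 h1 h]
  set v := Function.update u (q 0) a
  have hd : 0 ≤ (15 / 7 : ℝ) ^ mSeq lam 1 * drop lam v ^ 2 := by positivity
  have hQ' : Q = ⨆ n, ENNReal.ofReal ((15 / 7) ^ mSeq lam 1 * drop lam v ^ 2
      + ∑ k ∈ Finset.range n, coefE lam v k) := by
    rw [hQ, ENNReal.tsum_eq_iSup_nat, ENNReal.add_iSup]
    congr 1
    funext n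
    rw [ENNReal.ofReal_add hd (Finset.sum_nonneg fun k _ => coefE_nonneg _ _ _),
      ENNReal.ofReal_sum_of_nonneg fun k _ => coefE_nonneg _ _ _]
  rw [hQ', ENNReal.mul_iSup, ENNReal.mul_iSup]
  constructor
  · refine iSup_le fun n => le_iSup_of_le (n + 1) ?_
    rw [← ENNReal.ofReal_mul (by norm_num)]
    refine ENNReal.ofReal_le_ofReal ?_
    have h2 := sum_coefE_le h0 h1 v n
    have h3 := drop_sq_le_stageE h0 h1 v
    have h4 : stageE lam v 0 ≤ ∑ k ∈ Finset.range (n + 1), stageE lam v k :=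
      Finset.single_le_sum (fun k _ => stageE_nonneg lam v k) (by simp)
    linarith
  · refine iSup_mono fun n => ?_
    rw [← ENNReal.ofReal_mul (by norm_num)]
    exact ENNReal.ofReal_le_ofReal (h.sum_stageE_le' h0 h1 n)

end

/-! ### The measure on infinite words and the coding map -/

/-- The product measure on infinite words whose image under the coding map is `mu`. -/
noncomputable def wordMeasure (lam : ℝ) : Measure (ℕ → Fin 6) :=
  Measure.infinitePi fun k : ℕ => symbolMeasure (lamSeq lam k)

/-- The word formed by the first `n` letters of `s`. -/
abbrev pref (s : ℕ → Fin 6) (n : ℕ) : Fin n → Fin 6 := fun k => s k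

theorem pref_succ (s : ℕ → Fin 6) (n : ℕ) : pref s (n + 1) = ext (pref s n) (s n) :=
  (ext_init_last (pref s (n + 1))).symm

theorem ext_inj {n : ℕ} {v w : Fin n → Fin 6} {i j : Fin 6} :
    ext v i = ext w j ↔ v = w ∧ i = j := by
  constructor
  · intro h
    refine ⟨funext fun k => ?_, ?_⟩
    · simpa [ext] using congrFun h k.castSucc
    · simpa [ext] using congrFun h (Fin.last n)
  · rintro ⟨rfl, rfl⟩; rfl

section measure

variable {lam : ℝ}

theorem symbolMeasure_singleton (h0 : 0 < lam) (h1 : lam ≤ 1) (i : Fin 6) :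
    symbolMeasure lam {i} = if i ∈ S (iota1 lam) then ENNReal.ofReal (wT lam i) else 0 := by
  rw [symbolMeasure, Measure.finsetSum_apply]
  simp only [Measure.smul_apply, Measure.dirac_apply, smul_eq_mul, weight_eq h0 h1,
    Set.indicator_apply, Set.mem_singleton_iff, Pi.one_apply, mul_ite, mul_one, mul_zero]
  rw [Finset.sum_ite_eq']

theorem symbolMeasure_singleton_le (h0 : 0 < lam) (h1 : lam ≤ 1) (i : Fin 6) :
    symbolMeasure lam {i} ≤ ENNReal.ofReal (1 / 2) := by
  rw [symbolMeasure_singleton h0 h1]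
  split_ifs
  · exact ENNReal.ofReal_le_ofReal (wT_bounds h0 h1 i).2
  · exact zero_le

theorem symbolMeasure_isProbability (h0 : 0 < lam) (h1 : lam ≤ 1) :
    IsProbabilityMeasure (symbolMeasure lam) := by
  constructor
  rw [symbolMeasure, Measure.finsetSum_apply]
  simp only [Measure.smul_apply, smul_eq_mul, weight_eq h0 h1, measure_univ, mul_one]
  rw [← ENNReal.ofReal_sum_of_nonneg, sum_wT h0 h1, ENNReal.ofReal_one]
  intro i _
  linarith [(wT_bounds h0 h1 i).1]

theorem symbolMeasure_isProbability' (h0 : 0 < lam) (h1 : lam ≤ 1) (k : ℕ) :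
    IsProbabilityMeasure (symbolMeasure (lamSeq lam k)) :=
  symbolMeasure_isProbability (lamSeq_mem h0 h1 k).1 (lamSeq_mem h0 h1 k).2

theorem wordMeasure_isProbability (h0 : 0 < lam) (h1 : lam ≤ 1) :
    IsProbabilityMeasure (wordMeasure lam) := by
  have := symbolMeasure_isProbability' h0 h1
  unfold wordMeasure
  infer_instance

theorem wordMeasure_pref (h0 : 0 < lam) (h1 : lam ≤ 1) {n : ℕ} (w : Fin n → Fin 6) :
    wordMeasure lam {s | pref s n = w}
      = if w ∈ W lam n then ENNReal.ofReal (mass lam w) else 0 := by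
  have := symbolMeasure_isProbability' h0 h1
  have e : {s : ℕ → Fin 6 | pref s n = w}
      = Set.pi (Finset.range n) fun k => if h : k < n then {w ⟨k, h⟩} else Set.univ := by
    ext s
    simp only [Set.mem_ofPred_eq, Set.mem_pi, Finset.coe_range, Set.mem_Iio]
    constructor
    · rintro rfl k hk
      simp [hk]
    · intro h
      funext k
      have := h k k.2
      simpa using this
  rw [e, wordMeasure, Measure.infinitePi_pi _ fun _ _ => MeasurableSet.of_discrete,
    Finset.prod_range]
  simp only [Fin.is_lt, dite_true, Fin.eta]
  have e2 : ∀ k : Fin n, symbolMeasure (lamSeq lam k) {w k}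
      = if w k ∈ S (digit lam k) then ENNReal.ofReal (wT (lamSeq lam k) (w k)) else 0 := fun k =>
    symbolMeasure_singleton (lamSeq_mem h0 h1 k).1 (lamSeq_mem h0 h1 k).2 _
  simp only [e2]
  split_ifs with hw
  · rw [mass, ENNReal.ofReal_prod_of_nonneg]
    · refine Finset.prod_congr rfl fun k _ => ?_
      rw [if_pos (Fintype.mem_piFinset.1 hw k)]
    · intro k _
      linarith [(wT_bounds (lamSeq_mem h0 h1 k).1 (lamSeq_mem h0 h1 k).2 (w k)).1]
  · simp only [W, Fintype.mem_piFinset, not_forall] at hw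
    obtain ⟨k, hk⟩ := hw
    exact Finset.prod_eq_zero (Finset.mem_univ k) (if_neg hk)

theorem ae_mem_S (h0 : 0 < lam) (h1 : lam ≤ 1) :
    ∀ᵐ s ∂wordMeasure lam, ∀ k, s k ∈ S (digit lam k) := by
  have := symbolMeasure_isProbability' h0 h1
  rw [ae_all_iff]
  intro k
  have hk : ∀ᵐ i ∂symbolMeasure (lamSeq lam k), i ∈ S (digit lam k) := by
    rw [ae_iff_of_countable]
    intro i hi
    by_contra hc
    rw [digit] at hc
    rw [symbolMeasure_singleton (lamSeq_mem h0 h1 k).1 (lamSeq_mem h0 h1 k).2, if_neg hc] at hi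
    exact hi rfl
  exact (measurePreserving_eval_infinitePi (fun k => symbolMeasure (lamSeq lam k))
    k).quasiMeasurePreserving.ae hk

theorem ae_mem_W (h0 : 0 < lam) (h1 : lam ≤ 1) :
    ∀ᵐ s ∂wordMeasure lam, ∀ n, pref s n ∈ W lam n := by
  filter_upwards [ae_mem_S h0 h1] with s hs n
  exact Fintype.mem_piFinset.2 fun k => hs k

/-- Almost every word is not eventually constant, since no letter has weight more than `1 / 2`. -/
theorem ae_not_eventually_eq (h0 : 0 < lam) (h1 : lam ≤ 1) :
    ∀ᵐ s ∂wordMeasure lam, ∀ (n : ℕ) (i : Fin 6), ∃ k ≥ n, s k ≠ i := by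
  have := symbolMeasure_isProbability' h0 h1
  rw [ae_all_iff]
  intro n
  rw [ae_all_iff]
  intro i
  rw [ae_iff]
  have hle : ∀ N : ℕ, wordMeasure lam {s | ¬∃ k ≥ n, s k ≠ i} ≤ ENNReal.ofReal (1 / 2) ^ N := by
    intro N
    calc wordMeasure lam {s | ¬∃ k ≥ n, s k ≠ i}
        ≤ wordMeasure lam (Set.pi (Finset.Ico n (n + N)) fun _ => {i}) := by
          refine measure_mono fun s hs k hk => ?_
          by_contra hc
          exact hs ⟨k, (Finset.mem_Ico.1 hk).1, hc⟩
      _ = ∏ k ∈ Finset.Ico n (n + N), symbolMeasure (lamSeq lam k) {i} :=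
          Measure.infinitePi_pi _ fun _ _ => MeasurableSet.of_discrete
      _ ≤ ∏ k ∈ Finset.Ico n (n + N), ENNReal.ofReal (1 / 2) :=
          Finset.prod_le_prod' fun k _ =>
            symbolMeasure_singleton_le (lamSeq_mem h0 h1 k).1 (lamSeq_mem h0 h1 k).2 i
      _ = ENNReal.ofReal (1 / 2) ^ N := by simp
  refine le_antisymm (ge_of_tendsto' (ENNReal.tendsto_pow_atTop_nhds_zero_of_lt_one ?_) hle) zero_le
  rw [ENNReal.ofReal_lt_one]
  norm_num

theorem measurable_pref (n : ℕ) : Measurable fun s : ℕ → Fin 6 => pref s n :=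
  measurable_pi_lambda _ fun k => measurable_pi_apply (k : ℕ)

theorem measurable_step {n : ℕ} {Y : Type*} [MeasurableSpace Y] (g : (Fin n → Fin 6) → Y) :
    Measurable fun s : ℕ → Fin 6 => g (pref s n) :=
  (Measurable.of_discrete (f := g)).comp (measurable_pref n)

theorem integral_step (h0 : 0 < lam) (h1 : lam ≤ 1) {n : ℕ} (g : (Fin n → Fin 6) → ℝ) :
    ∫ s, g (pref s n) ∂wordMeasure lam = ∑ w ∈ W lam n, mass lam w * g w := by
  have := wordMeasure_isProbability h0 h1
  have hm : IsProbabilityMeasure ((wordMeasure lam).map fun s => pref s n) :=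
    Measure.isProbabilityMeasure_map (measurable_pref n).aemeasurable
  rw [← integral_map (f := g) (measurable_pref n).aemeasurable
    (Measurable.of_discrete (f := g)).aestronglyMeasurable, integral_fintype .of_finite,
    ← Finset.sum_subset (Finset.subset_univ (W lam n))]
  · refine Finset.sum_congr rfl fun w hw => ?_
    rw [Measure.real, Measure.map_apply (measurable_pref n) (MeasurableSet.singleton w)]
    have e := wordMeasure_pref h0 h1 w
    rw [if_pos hw] at e
    change (wordMeasure lam {s | pref s n = w}).toReal • g w = _
    rw [e, ENNReal.toReal_ofReal (mass_pos h0 h1 w).le, smul_eq_mul]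
  · intro w _ hw
    rw [Measure.real, Measure.map_apply (measurable_pref n) (MeasurableSet.singleton w)]
    have e := wordMeasure_pref h0 h1 w
    rw [if_neg hw] at e
    change (wordMeasure lam {s | pref s n = w}).toReal • g w = _
    rw [e]
    simp

theorem dist_F (i : Fin 6) (x y : Plane) : dist (F i x) (F i y) ≤ 1 / 3 * dist x y := by
  have := (F_lipschitz i).dist_le_mul x y
  simpa using this

theorem dist_iterate_F (k : ℕ) (x y : Plane) : dist ((F 0)^[k] x) ((F 0)^[k] y) ≤ dist x y := by
  induction k with
  | zero => rfl
  | succ k ih =>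
    rw [iterate_F_zero_succ, iterate_F_zero_succ]
    have := dist_F 0 ((F 0)^[k] x) ((F 0)^[k] y)
    have := dist_nonneg (x := (F 0)^[k] x) (y := (F 0)^[k] y)
    linarith

theorem dist_Flam {n : ℕ} (w : Fin n → Fin 6) (x y : Plane) :
    dist (Flam lam w x) (Flam lam w y) ≤ (1 / 3) ^ n * dist x y := by
  induction n generalizing x y with
  | zero => rw [Flam_zero, Flam_zero]; simp
  | succ n ih =>
    rw [← ext_init_last w, Flam_ext, Flam_ext]
    refine (ih _ _ _).trans ?_
    rw [pow_succ, mul_assoc]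
    exact mul_le_mul_of_nonneg_left ((dist_iterate_F _ _ _).trans (dist_F _ _ _)) (by positivity)

theorem dist_Flam_le {n : ℕ} (w : Fin n → Fin 6) {x y : Plane} (hx : x ∈ gasket) (hy : y ∈ gasket) :
    dist (Flam lam w x) (Flam lam w y) ≤ Metric.diam gasket * (1 / 3) ^ n := by
  refine (dist_Flam w x y).trans ?_
  rw [mul_comm]
  exact mul_le_mul_of_nonneg_right (Metric.dist_le_diam_of_mem gasket_isCompact.isBounded hx hy)
    (by positivity)

theorem image_Flam_succ (s : ℕ → Fin 6) (n : ℕ) :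
    Flam lam (pref s (n + 1)) '' gasket ⊆ Flam lam (pref s n) '' gasket := by
  rintro _ ⟨z, hz, rfl⟩
  rw [pref_succ, Flam_ext]
  exact ⟨_, iterate_mem _ (F_mem _ hz), rfl⟩

theorem image_Flam_anti (s : ℕ → Fin 6) : Antitone fun n => Flam lam (pref s n) '' gasket :=
  antitone_nat_of_succ_le (image_Flam_succ s)

theorem tendsto_coding (lam : ℝ) (s : ℕ → Fin 6) :
    Tendsto (fun n => Flam lam (pref s n) (q 0)) atTop (𝓝 (coding lam s)) := by
  refine CauchySeq.tendsto_limUnder (cauchySeq_of_le_geometric (1 / 3) (Metric.diam gasket)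
    (by norm_num) fun n => ?_)
  obtain ⟨z, hz, e⟩ := image_Flam_succ (lam := lam) s n ⟨q 0, q_mem 0, rfl⟩
  rw [← e]
  exact dist_Flam_le _ (q_mem 0) hz

theorem coding_mem (lam : ℝ) (s : ℕ → Fin 6) (n : ℕ) :
    coding lam s ∈ Flam lam (pref s n) '' gasket := by
  refine (cell_isClosed (fullWord lam (pref s n))).mem_of_tendsto (tendsto_coding lam s) ?_
  filter_upwards [eventually_ge_atTop n] with m hm
  exact image_Flam_anti s hm ⟨q 0, q_mem 0, rfl⟩

theorem dist_coding (lam : ℝ) (s : ℕ → Fin 6) (n : ℕ) :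
    dist (coding lam s) (Flam lam (pref s n) (q 0)) ≤ Metric.diam gasket * (1 / 3) ^ n := by
  obtain ⟨z, hz, e⟩ := coding_mem lam s n
  rw [← e]
  exact dist_Flam_le _ hz (q_mem 0)

theorem measurable_coding (lam : ℝ) : Measurable (coding lam) :=
  measurable_of_tendsto_metrizable (fun _ => measurable_step fun w => Flam lam w (q 0))
    (tendsto_pi_nhds.2 fun s => tendsto_coding lam s)

theorem tendsto_pow_mSeq (h0 : 0 < lam) (h1 : lam ≤ 1) :
    Tendsto (fun n => (1 / 3 : ℝ) ^ mSeq lam n) atTop (𝓝 0) :=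
  (tendsto_pow_atTop_nhds_zero_of_lt_one (by norm_num) (by norm_num)).comp
    (mSeq_strictMono h0 h1).tendsto_atTop

theorem coding_mem_X (h0 : 0 < lam) (h1 : lam ≤ 1) {s : ℕ → Fin 6}
    (hs : ∀ n, pref s n ∈ W lam n) : coding lam s ∈ X lam := by
  have hK : coding lam s ∈ gasket := by
    obtain ⟨z, hz, e⟩ := coding_mem lam s 0
    rw [← e]
    exact Fword_mem _ hz
  refine ⟨hK, ?_⟩
  have hlim : Tendsto (fun n => 1 - (Flam lam (pref s n) (q 0)).2) atTop
      (𝓝 (1 - (coding lam s).2)) :=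
    ((continuous_snd.tendsto _).comp (tendsto_coding lam s)).const_sub 1
  have hlim2 : Tendsto (fun n => 1 - (Flam lam (pref s n) (q 0)).2) atTop (𝓝 lam) := by
    have hz : Tendsto (fun n => (1 / 3 : ℝ) ^ mSeq lam n * lamSeq lam n) atTop (𝓝 0) :=
      squeeze_zero (fun n => by have := (lamSeq_mem h0 h1 n).1; positivity)
        (fun n => mul_le_of_le_one_right (by positivity) (lamSeq_mem h0 h1 n).2)
        (tendsto_pow_mSeq h0 h1)
    have h2 := hz.const_sub lam
    rw [sub_zero] at h2
    refine h2.congr fun n => ?_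
    rw [depth_Flam h0 h1 (hs n)]
    simp [q]
  have := tendsto_nhds_unique hlim hlim2
  linarith

theorem eq_of_iterate_eq_q {k : ℕ} {z : Plane} (hz : z ∈ gasket) {a : Fin 3}
    (h : (F 0)^[k] z = q a) : z = q a := by
  induction k with
  | zero => exact h
  | succ k ih =>
    rw [iterate_F_zero_succ] at h
    exact ih (eq_of_F_eq_q (iterate_mem k hz) h).2

/-- Two different cells of the same stage can only meet in corners. -/
theorem exists_corner_of_Flam_eq {n : ℕ} {v w : Fin n → Fin 6} (hvw : v ≠ w) {y y' : Plane}
    (hy : y ∈ gasket) (hy' : y' ∈ gasket) (h : Flam lam v y = Flam lam w y') : ∃ a, y = q a := by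
  induction n generalizing y y' with
  | zero => exact absurd (Subsingleton.elim v w) hvw
  | succ n ih =>
    rw [← ext_init_last v, ← ext_init_last w] at h hvw
    rw [Flam_ext, Flam_ext] at h
    by_cases he : (fun k : Fin n => v k.castSucc) = fun k => w k.castSucc
    · have hne : v (Fin.last n) ≠ w (Fin.last n) := fun hc => hvw (ext_inj.2 ⟨he, hc⟩)
      rw [he] at h
      have h2 := (F_injective 0).iterate _ (Fword_injective _ h)
      obtain ⟨a, b, e, -⟩ := exists_corner_of_F_eq hne hy hy' h2
      exact ⟨a, e⟩
    · obtain ⟨a, ha⟩ := ih he (iterate_mem _ (F_mem _ hy)) (iterate_mem _ (F_mem _ hy')) h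
      exact ⟨a, (eq_of_F_eq_q hy (eq_of_iterate_eq_q (F_mem _ hy) ha)).2⟩

/-- For almost every infinite word, its coded point lies in exactly those `X_w` whose word `w` is a
prefix. -/
theorem ae_coding_mem_Xw (h0 : 0 < lam) (h1 : lam ≤ 1) : ∀ᵐ s ∂wordMeasure lam,
    ∀ (n : ℕ) (w : Fin n → Fin 6), coding lam s ∈ Xw lam w ↔ pref s n = w := by
  filter_upwards [ae_mem_W h0 h1, ae_not_eventually_eq h0 h1] with s hs hs' n w
  constructor
  · rintro ⟨⟨y', hy', e'⟩, -⟩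
    by_contra hne
    obtain ⟨y, hy, e⟩ := coding_mem lam s n
    obtain ⟨a, rfl⟩ := exists_corner_of_Flam_eq hne hy hy' (e.trans e'.symm)
    -- once the coded point is a corner of a cell, the word continues with the letter of that corner
    have hall : ∀ k, Flam lam (pref s (n + k)) (q a) = coding lam s
        ∧ ∀ i < k, s (n + i) = cr a := by
      intro k
      induction k with
      | zero => exact ⟨e, fun i hi => absurd hi (Nat.not_lt_zero i)⟩
      | succ k ih =>
        obtain ⟨z, hz, ez⟩ := coding_mem lam s (n + k + 1)
        have ez' := ez
        rw [← ih.1, pref_succ, Flam_ext] at ez'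
        have h2 := eq_of_F_eq_q hz (eq_of_iterate_eq_q (F_mem _ hz) (Fword_injective _ ez'))
        rw [h2.2] at ez
        refine ⟨ez, fun i hi => ?_⟩
        rcases Nat.lt_succ_iff_lt_or_eq.1 hi with hi | rfl
        · exact ih.2 i hi
        · exact h2.1
    obtain ⟨k, hk, hk'⟩ := hs' n (cr a)
    have := (hall (k - n + 1)).2 (k - n) (Nat.lt_succ_self _)
    rw [Nat.add_sub_cancel' hk] at this
    exact hk' this
  · rintro rfl
    exact ⟨coding_mem lam s n, coding_mem_X h0 h1 hs⟩

theorem X_isClosed (lam : ℝ) : IsClosed (X lam) :=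
  gasket_isCompact.isClosed.inter (isClosed_eq continuous_snd continuous_const)

theorem measurableSet_Xw (lam : ℝ) {n : ℕ} (w : Fin n → Fin 6) : MeasurableSet (Xw lam w) :=
  ((cell_isClosed (fullWord lam w)).inter (X_isClosed lam)).measurableSet

theorem mu_eq (lam : ℝ) : mu lam = (wordMeasure lam).map (coding lam) := rfl

/-- A combination of indicator functions of the sets `X_w` is, in terms of infinite words, a
function of the first letters. -/
theorem ae_sum_indicator (h0 : 0 < lam) (h1 : lam ≤ 1) : ∀ᵐ s ∂wordMeasure lam,
    ∀ (n : ℕ) (g : (Fin n → Fin 6) → ℝ), ∑ w ∈ W lam n,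
      g w * (Xw lam w).indicator (fun _ => (1 : ℝ)) (coding lam s) = g (pref s n) := by
  filter_upwards [ae_mem_W h0 h1, ae_coding_mem_Xw h0 h1] with s hs hs' n g
  rw [Finset.sum_eq_single_of_mem (pref s n) (hs n)]
  · rw [Set.indicator_of_mem ((hs' n _).2 rfl), mul_one]
  · intro w _ hw
    rw [Set.indicator_of_notMem (fun hc => hw ((hs' n w).1 hc).symm), mul_zero]

theorem ae_haar (h0 : 0 < lam) (h1 : lam ≤ 1) : ∀ᵐ s ∂wordMeasure lam,
    ∀ (n : ℕ) (w : Fin n → Fin 6) (j : ℕ), haar lam w j (coding lam s)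
      = if pref s n = w then haarT (lamSeq lam n) j (s n) else 0 := by
  filter_upwards [ae_mem_S h0 h1, ae_coding_mem_Xw h0 h1] with s hs hs' n w j
  obtain ⟨g0, g1⟩ := lamSeq_mem h0 h1 n
  have e : ∀ i, (Xw lam (ext w i)).indicator (fun _ => (1 : ℝ)) (coding lam s)
      = if pref s n = w ∧ s n = i then 1 else 0 := by
    intro i
    classical
    rw [Set.indicator_apply]
    refine if_congr ?_ rfl rfl
    rw [hs', pref_succ, ext_inj]
  simp only [haar, e, haarValue_eq g0 g1]
  by_cases hw : pref s n = w
  · rw [if_pos hw, Finset.sum_eq_single_of_mem (s n) (hs n)]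
    · rw [if_pos ⟨hw, rfl⟩, mul_one]
    · intro i _ hi
      rw [if_neg fun hc => hi hc.2.symm, mul_zero]
  · rw [if_neg hw]
    exact Finset.sum_eq_zero fun i _ => by rw [if_neg fun hc => hw hc.1, mul_zero]

theorem measurable_indicator_Xw (lam : ℝ) {n : ℕ} (w : Fin n → Fin 6) :
    Measurable ((Xw lam w).indicator fun _ => (1 : ℝ)) :=
  measurable_const.indicator (measurableSet_Xw lam w)

theorem measurable_haar (lam : ℝ) {n : ℕ} (w : Fin n → Fin 6) (j : ℕ) :
    Measurable (haar lam w j) :=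
  Finset.measurable_fun_sum _ fun _ _ => (measurable_indicator_Xw lam _).const_mul _

end measure

/-! ### Boundary values in `L²` and the Haar expansion -/

/-- The boundary mean of `u` below `F_w^λ q₀`. -/
noncomputable abbrev partBeta (lam : ℝ) (u : Plane → ℝ) {n : ℕ} (w : Fin n → Fin 6) : ℝ :=
  beta (lamSeq lam n) (part lam u w)

section martingale

variable {lam : ℝ} {u : Plane → ℝ} {φ : (ℕ → Fin 6) → ℝ}

theorem memLp_step (h0 : 0 < lam) (h1 : lam ≤ 1) {n : ℕ} (g : (Fin n → Fin 6) → ℝ) (p : ℝ≥0∞) :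
    MemLp (fun s => g (pref s n)) p (wordMeasure lam) := by
  have := wordMeasure_isProbability h0 h1
  refine MemLp.of_bound (measurable_step g).aestronglyMeasurable (∑ w, |g w|)
    (ae_of_all _ fun s => ?_)
  exact Finset.single_le_sum (f := fun w => |g w|) (fun w _ => abs_nonneg _)
    (Finset.mem_univ (pref s n))

theorem eLpNorm_step_sq (h0 : 0 < lam) (h1 : lam ≤ 1) {n : ℕ} (g : (Fin n → Fin 6) → ℝ) :
    eLpNorm (fun s => g (pref s n)) 2 (wordMeasure lam)
      = ENNReal.ofReal (√(∑ w ∈ W lam n, mass lam w * g w ^ 2)) := by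
  rw [(memLp_step h0 h1 g 2).eLpNorm_eq_integral_rpow_norm (by norm_num) (by norm_num)]
  congr 1
  rw [← integral_step h0 h1 fun w => g w ^ 2, Real.sqrt_eq_rpow]
  simp

/-- The drops below the points `F_w^λ q₀` are controlled by the increments of the values of `u` at
these points. -/
theorem Harm.eLpNorm_drop_le (h0 : 0 < lam) (h1 : lam ≤ 1) (h : Harm lam u) (n : ℕ) :
    eLpNorm (fun s => drop (lamSeq lam n) (SG3.part lam u (pref s n))) 2 (wordMeasure lam)
      ≤ ENNReal.ofReal 3 * eLpNorm (fun s => u (Flam lam (pref s n) (q 0))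
        - u (Flam lam (pref s (n + 1)) (q 0))) 2 (wordMeasure lam) := by
  obtain ⟨g0, g1⟩ := lamSeq_mem h0 h1 n
  rw [eLpNorm_step_sq h0 h1 fun w => drop (lamSeq lam n) (SG3.part lam u w)]
  have e := eLpNorm_step_sq h0 h1 (n := n + 1) fun v =>
    u (Flam lam (fun k : Fin n => v k.castSucc) (q 0)) - u (Flam lam v (q 0))
  rw [show (fun s : ℕ → Fin 6 => u (Flam lam (pref s n) (q 0))
    - u (Flam lam (pref s (n + 1)) (q 0))) = fun s => u (Flam lam (fun k : Fin n =>
      pref s (n + 1) k.castSucc) (q 0)) - u (Flam lam (pref s (n + 1)) (q 0)) from rfl, e,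
    ← ENNReal.ofReal_mul (by norm_num)]
  refine ENNReal.ofReal_le_ofReal ?_
  rw [show (3 : ℝ) = √9 by rw [show (9 : ℝ) = 3 ^ 2 by norm_num, Real.sqrt_sq (by norm_num)],
    ← Real.sqrt_mul (by norm_num)]
  refine Real.sqrt_le_sqrt ?_
  rw [sum_W_succ, Finset.mul_sum]
  refine Finset.sum_le_sum fun w hw => ?_
  have hd := (h.part h0 h1 hw).drop_sq_le_diff g0 g1
  have e2 : ∀ i : Fin 6, (fun k : Fin n => ext w i k.castSucc) = w := fun i => by
    funext k; simp [ext]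
  have e3 : ∀ i : Fin 6, u (Flam lam w (q 0)) - u (Flam lam (ext w i) (q 0))
      = SG3.part lam u w (q 0) - SG3.branch (lamSeq lam n) (SG3.part lam u w) i (q 0) := by
    intro i
    rw [← part_ext]
    rfl
  have hm := mass_pos h0 h1 w
  simp only [e2, e3, mass_ext]
  have hle : ∀ i ∈ S (digit lam n), mass lam w * (1 / 4)
      * (SG3.part lam u w (q 0) - SG3.branch (lamSeq lam n) (SG3.part lam u w) i (q 0)) ^ 2
      ≤ mass lam w * wT (lamSeq lam n) i
      * (SG3.part lam u w (q 0) - SG3.branch (lamSeq lam n) (SG3.part lam u w) i (q 0)) ^ 2 :=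
    fun i _ => mul_le_mul_of_nonneg_right
      (mul_le_mul_of_nonneg_left (wT_bounds g0 g1 i).1 hm.le) (sq_nonneg _)
  have hs := Finset.sum_le_sum hle
  rw [← Finset.mul_sum] at hs
  have hd' := mul_le_mul_of_nonneg_left hd hm.le
  have hnn : 0 ≤ mass lam w * ∑ i ∈ S (digit lam n),
      (SG3.part lam u w (q 0) - SG3.branch (lamSeq lam n) (SG3.part lam u w) i (q 0)) ^ 2 :=
    mul_nonneg hm.le (Finset.sum_nonneg fun _ _ => sq_nonneg _)
  simp only [digit] at hs hnn ⊢
  linarith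

/-- If the values of `u` converge in `L²` towards the boundary, then so do the boundary means. -/
theorem Harm.tendsto_partBeta (h0 : 0 < lam) (h1 : lam ≤ 1) (h : Harm lam u)
    (hφ : MemLp φ 2 (wordMeasure lam))
    (hU : Tendsto (fun n => eLpNorm (fun s => φ s - u (Flam lam (pref s n) (q 0))) 2
      (wordMeasure lam)) atTop (𝓝 0)) :
    Tendsto (fun n => eLpNorm (fun s => φ s - partBeta lam u (pref s n)) 2
      (wordMeasure lam)) atTop (𝓝 0) := by
  have mU : ∀ n, AEStronglyMeasurable (fun s => φ s - u (Flam lam (pref s n) (q 0)))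
      (wordMeasure lam) := fun n =>
    hφ.1.sub (measurable_step fun w => u (Flam lam w (q 0))).aestronglyMeasurable
  have mD : ∀ n, AEStronglyMeasurable
      (fun s => drop (lamSeq lam n) (SG3.part lam u (pref s n))) (wordMeasure lam) := fun n =>
    (measurable_step fun w => drop (lamSeq lam n) (SG3.part lam u w)).aestronglyMeasurable
  set A := fun n => eLpNorm (fun s => φ s - u (Flam lam (pref s n) (q 0))) 2 (wordMeasure lam)
    with hA
  have hbound : ∀ n, eLpNorm (fun s => φ s - partBeta lam u (pref s n)) 2 (wordMeasure lam)
      ≤ A n + ENNReal.ofReal 3 * (A (n + 1) + A n) := by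
    intro n
    have e1 : (fun s => φ s - partBeta lam u (pref s n))
        = (fun s => φ s - u (Flam lam (pref s n) (q 0)))
          + fun s => drop (lamSeq lam n) (SG3.part lam u (pref s n)) := by
      funext s
      simp only [partBeta, beta, Pi.add_apply, SG3.part, Function.comp]
      ring
    have e2 : (fun s => u (Flam lam (pref s n) (q 0)) - u (Flam lam (pref s (n + 1)) (q 0)))
        = (fun s => φ s - u (Flam lam (pref s (n + 1)) (q 0)))
          - fun s => φ s - u (Flam lam (pref s n) (q 0)) := by
      funext s
      simp only [Pi.sub_apply]
      ring
    rw [e1]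
    refine (eLpNorm_add_le (mU n) (mD n) (by norm_num)).trans ?_
    have h3 := h.eLpNorm_drop_le h0 h1 n
    rw [e2] at h3
    gcongr
    refine h3.trans ?_
    gcongr
    exact eLpNorm_sub_le (mU (n + 1)) (mU n) (by norm_num)
  refine tendsto_of_tendsto_of_tendsto_of_le_of_le tendsto_const_nhds ?_ (fun _ => zero_le) hbound
  have hA1 : Tendsto (fun n => A (n + 1)) atTop (𝓝 0) := (tendsto_add_atTop_iff_nat 1).2 hU
  have h4 := hU.add (ENNReal.Tendsto.const_mul (hA1.add hU)
    (Or.inr (ENNReal.ofReal_ne_top (r := 3))))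
  simpa using h4

/-- The martingale property of the boundary means. -/
theorem Harm.integral_step_mul_succ (h0 : 0 < lam) (h1 : lam ≤ 1) (h : Harm lam u) {m : ℕ}
    (g : (Fin m → Fin 6) → ℝ) :
    ∫ s, g (pref s m) * partBeta lam u (pref s (m + 1)) ∂wordMeasure lam
      = ∫ s, g (pref s m) * partBeta lam u (pref s m) ∂wordMeasure lam := by
  rw [integral_step h0 h1 fun w => g w * partBeta lam u w]
  have e := integral_step h0 h1 (n := m + 1) fun v =>
    g (fun k : Fin m => v k.castSucc) * partBeta lam u v
  refine Eq.trans ?_ (e.trans ?_)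
  · rfl
  rw [sum_W_succ]
  refine Finset.sum_congr rfl fun w hw => ?_
  obtain ⟨g0, g1⟩ := lamSeq_mem h0 h1 m
  have e2 : ∀ i : Fin 6, (fun k : Fin m => ext w i k.castSucc) = w := fun i => by
    funext k; simp [ext]
  have e3 : ∀ i, partBeta lam u (ext w i)
      = beta (R (lamSeq lam m)) (SG3.branch (lamSeq lam m) (SG3.part lam u w) i) := fun i => by
    rw [partBeta, part_ext, lamSeq_succ]
  rw [partBeta, (h.part h0 h1 hw).beta_eq g0 g1, Finset.mul_sum, Finset.mul_sum]
  refine Finset.sum_congr rfl fun i _ => ?_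
  rw [e2, e3, mass_ext]
  ring

theorem Harm.integral_step_mul (h0 : 0 < lam) (h1 : lam ≤ 1) (h : Harm lam u) {n : ℕ}
    (g : (Fin n → Fin 6) → ℝ) {m : ℕ} (hm : n ≤ m) :
    ∫ s, g (pref s n) * partBeta lam u (pref s m) ∂wordMeasure lam
      = ∑ w ∈ W lam n, mass lam w * (g w * partBeta lam u w) := by
  induction m, hm using Nat.le_induction with
  | base => exact integral_step h0 h1 fun w => g w * partBeta lam u w
  | succ m hm ih =>
    rw [← ih]
    exact h.integral_step_mul_succ h0 h1 fun w : Fin m → Fin 6 =>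
      g fun k : Fin n => w (Fin.castLE hm k)

/-- The boundary means of `u`, which are computed from fluxes, are the means of its boundary values:
they form a martingale with limit `φ`. -/
theorem Harm.integral_step_mul_boundary (h0 : 0 < lam) (h1 : lam ≤ 1) (h : Harm lam u)
    (hφ : MemLp φ 2 (wordMeasure lam))
    (hM : Tendsto (fun n => eLpNorm (fun s => φ s - partBeta lam u (pref s n)) 2
      (wordMeasure lam)) atTop (𝓝 0)) {n : ℕ} (g : (Fin n → Fin 6) → ℝ) :
    ∫ s, g (pref s n) * φ s ∂wordMeasure lam
      = ∑ w ∈ W lam n, mass lam w * (g w * partBeta lam u w) := by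
  have := wordMeasure_isProbability h0 h1
  have hstep : ∀ m, MemLp (fun s => partBeta lam u (pref s m)) 2 (wordMeasure lam) := fun m =>
    memLp_step h0 h1 (fun w => partBeta lam u w) 2
  have hg := memLp_step h0 h1 g 2
  have hint : ∀ m, Integrable (fun s => g (pref s n) * partBeta lam u (pref s m))
      (wordMeasure lam) := fun m => hg.integrable_mul (hstep m)
  have hgφ : Integrable (fun s => g (pref s n) * φ s) (wordMeasure lam) := hg.integrable_mul hφ
  have hL1 : Tendsto (fun m => eLpNorm ((fun s => g (pref s n) * partBeta lam u (pref s m))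
      - fun s => g (pref s n) * φ s) 1 (wordMeasure lam)) atTop (𝓝 0) := by
    have hle : ∀ m, eLpNorm ((fun s => g (pref s n) * partBeta lam u (pref s m))
        - fun s => g (pref s n) * φ s) 1 (wordMeasure lam)
        ≤ ENNReal.ofReal (∑ w, |g w|)
          * eLpNorm (fun s => φ s - partBeta lam u (pref s m)) 2 (wordMeasure lam) := by
      intro m
      refine (eLpNorm_le_eLpNorm_of_exponent_le (p := 1) (q := 2) (by norm_num)
        ((hint m).1.sub hgφ.1)).trans ?_
      refine eLpNorm_le_mul_eLpNorm_of_ae_le_mul (ae_of_all _ fun s => ?_) 2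
      have e : ((fun s => g (pref s n) * partBeta lam u (pref s m)) - fun s => g (pref s n) * φ s) s
          = -(g (pref s n) * (φ s - partBeta lam u (pref s m))) := by
        simp only [Pi.sub_apply]; ring
      rw [e, norm_neg, norm_mul]
      refine mul_le_mul_of_nonneg_right ?_ (norm_nonneg _)
      exact Finset.single_le_sum (f := fun w => |g w|) (fun w _ => abs_nonneg _)
        (Finset.mem_univ (pref s n))
    refine tendsto_of_tendsto_of_tendsto_of_le_of_le tendsto_const_nhds ?_ (fun _ => zero_le) hle
    simpa using ENNReal.Tendsto.const_mul hM (Or.inr (ENNReal.ofReal_ne_top (r := ∑ w, |g w|)))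
  have hlim := tendsto_integral_of_L1' _ hgφ.1 (Eventually.of_forall hint) hL1
  refine tendsto_nhds_unique hlim (tendsto_const_nhds.congr' ?_)
  filter_upwards [eventually_ge_atTop n] with m hm
  exact (h.integral_step_mul h0 h1 g hm).symm

end martingale

section expansion

variable {lam : ℝ} {f u : Plane → ℝ}

theorem memLp_coding {p : ℝ≥0∞} (hf : MemLp f p (mu lam)) :
    MemLp (fun s => f (coding lam s)) p (wordMeasure lam) :=
  hf.comp_of_map (measurable_coding lam).aemeasurable

theorem eLpNorm_coding (hf : AEStronglyMeasurable f (mu lam)) (p : ℝ≥0∞) :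
    eLpNorm f p (mu lam) = eLpNorm (fun s => f (coding lam s)) p (wordMeasure lam) :=
  eLpNorm_map_measure hf (measurable_coding lam).aemeasurable

theorem integral_coding (hf : AEStronglyMeasurable f (mu lam)) :
    ∫ x, f x ∂mu lam = ∫ s, f (coding lam s) ∂wordMeasure lam :=
  integral_map (measurable_coding lam).aemeasurable hf

/-- `u` is harmonic, with the value at `q₀` included, and `f ∈ L²` is the limit of the boundary means
of `u` along infinite words. -/
structure HasBoundaryValues (lam : ℝ) (f u : Plane → ℝ) : Prop where
  memLp : MemLp f 2 (mu lam)
  harm : Harm lam u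
  tendsto : Tendsto (fun n => eLpNorm (fun s => f (coding lam s) - partBeta lam u (pref s n)) 2
      (wordMeasure lam)) atTop (𝓝 0)

namespace HasBoundaryValues

theorem integral_mul_step (h0 : 0 < lam) (h1 : lam ≤ 1) (h : HasBoundaryValues lam f u) {n : ℕ}
    (g : (Fin n → Fin 6) → ℝ) : ∫ s, g (pref s n) * f (coding lam s) ∂wordMeasure lam
      = ∑ w ∈ W lam n, mass lam w * (g w * partBeta lam u w) :=
  h.harm.integral_step_mul_boundary h0 h1 (memLp_coding h.memLp) h.tendsto g

theorem constTerm_eq (h0 : 0 < lam) (h1 : lam ≤ 1) (h : HasBoundaryValues lam f u) :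
    constTerm lam f = beta lam u := by
  have h2 := h.integral_mul_step h0 h1 (n := 0) fun _ => 1
  rw [W_zero, Finset.sum_singleton] at h2
  simp only [one_mul] at h2
  rw [constTerm, integral_coding h.memLp.1, h2, partBeta, part_zero]
  simp [mass, lamSeq]

/-- The Haar coefficients of `f` are the coefficients of the boundary means of `u`. -/
theorem haarCoeff_eq (h0 : 0 < lam) (h1 : lam ≤ 1) (h : HasBoundaryValues lam f u) {n : ℕ}
    {w : Fin n → Fin 6} (hw : w ∈ W lam n) {j : ℕ} (hj : j ∈ Finset.Icc 1 (digit lam n)) :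
    haarCoeff lam f w j = coef (lamSeq lam n) (part lam u w) j := by
  classical
  obtain ⟨g0, g1⟩ := lamSeq_mem h0 h1 n
  have hm := mass_pos h0 h1 w
  set H : (Fin (n + 1) → Fin 6) → ℝ := fun v =>
    if (fun k : Fin n => v k.castSucc) = w then haarT (lamSeq lam n) j (v (Fin.last n)) else 0
    with hH
  have hHae : ∀ᵐ s ∂wordMeasure lam, haar lam w j (coding lam s) = H (pref s (n + 1)) := by
    filter_upwards [ae_haar h0 h1] with s hs
    rw [hs n w j]
    rfl
  have hsum : ∀ K : (Fin (n + 1) → Fin 6) → ℝ,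
      (∀ v, (fun k : Fin n => v k.castSucc) ≠ w → K v = 0) →
      ∑ v ∈ W lam (n + 1), mass lam v * K v
        = mass lam w * ∑ i ∈ S (digit lam n), wT (lamSeq lam n) i * K (ext w i) := by
    intro K hK
    rw [sum_W_succ, Finset.sum_eq_single_of_mem w hw, Finset.mul_sum]
    · exact Finset.sum_congr rfl fun i _ => by rw [mass_ext, mul_assoc]
    · intro v _ hv
      refine Finset.sum_eq_zero fun i _ => ?_
      rw [hK, mul_zero]
      intro hc
      refine hv (hc ▸ ?_)
      funext k; simp [ext]
  have hHext : ∀ i, H (ext w i) = haarT (lamSeq lam n) j i := by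
    intro i
    have e : (fun k : Fin n => ext w i k.castSucc) = w := by funext k; simp [ext]
    rw [hH]
    simp only [e, if_true]
    simp [ext]
  have i1 : ∫ x, haar lam w j x ^ 2 ∂mu lam
      = mass lam w * ∑ i ∈ S (digit lam n),
        wT (lamSeq lam n) i * haarT (lamSeq lam n) j i ^ 2 := by
    rw [integral_coding ((measurable_haar lam w j).pow_const 2).aestronglyMeasurable,
      integral_congr_ae (g := fun s => (fun v => H v ^ 2) (pref s (n + 1)))
        (hHae.mono fun s hs => by simp only [hs]), integral_step h0 h1 fun v => H v ^ 2, hsum]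
    · simp only [hHext]
    · intro v hv
      simp [hH, if_neg hv]
  have i2 : ∫ x, f x * haar lam w j x ∂mu lam
      = mass lam w * ∑ i ∈ S (digit lam n), wT (lamSeq lam n) i * (haarT (lamSeq lam n) j i
        * beta (R (lamSeq lam n)) (branch (lamSeq lam n) (part lam u w) i)) := by
    rw [integral_coding (f := fun x => f x * haar lam w j x)
        (h.memLp.1.mul (measurable_haar lam w j).aestronglyMeasurable),
      integral_congr_ae (g := fun s => H (pref s (n + 1)) * f (coding lam s))
        (hHae.mono fun s hs => by simp only [hs, mul_comm]),
      h.integral_mul_step h0 h1, hsum fun v => H v * partBeta lam u v]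
    · simp only [hHext, partBeta, part_ext, lamSeq_succ]
    · intro v hv
      simp [hH, if_neg hv]
  rw [haarCoeff, i1, i2, coef_eq g0 g1 _ hj, mul_inv]
  have e3 : ∀ A B : ℝ, (mass lam w)⁻¹ * A * (mass lam w * B) = A * B := fun A B => by
    field_simp
  rw [e3]
  congr 1
  · rw [Finset.sum_congr rfl fun i _ => mul_comm _ _]
    rfl
  · exact Finset.sum_congr rfl fun i _ => by ring

/-- The partial sums of the Haar expansion are the boundary means of `u`. -/
theorem ae_haarPartialSum (h0 : 0 < lam) (h1 : lam ≤ 1) (h : HasBoundaryValues lam f u) (N : ℕ) :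
    ∀ᵐ s ∂wordMeasure lam, haarPartialSum lam f N (coding lam s) = partBeta lam u (pref s N) := by
  filter_upwards [ae_haar h0 h1, ae_mem_W h0 h1, ae_mem_S h0 h1] with s hs hW hS
  rw [haarPartialSum]
  induction N with
  | zero =>
    rw [Finset.sum_range_zero, add_zero, h.constTerm_eq h0 h1]
    rfl
  | succ N ih =>
    obtain ⟨g0, g1⟩ := lamSeq_mem h0 h1 N
    rw [Finset.sum_range_succ, ← add_assoc, ih, pref_succ, partBeta, partBeta, part_ext,
      lamSeq_succ, (h.harm.part h0 h1 (hW N)).beta_branch g0 g1 (hS N)]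
    congr 1
    rw [Finset.sum_eq_single_of_mem (pref s N) (hW N)]
    · refine Finset.sum_congr rfl fun j hj => ?_
      rw [h.haarCoeff_eq h0 h1 (hW N) hj, hs, if_pos rfl]
    · intro w _ hw
      refine Finset.sum_eq_zero fun j _ => ?_
      rw [hs, if_neg (Ne.symm hw), mul_zero]

theorem measurable_haarPartialSum (lam : ℝ) (f : Plane → ℝ) (N : ℕ) :
    Measurable (haarPartialSum lam f N) :=
  measurable_const.add (Finset.measurable_fun_sum _ fun _ _ =>
    Finset.measurable_fun_sum _ fun _ _ => Finset.measurable_fun_sum _ fun _ _ =>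
      (measurable_haar lam _ _).const_mul _)

theorem tendsto_haarPartialSum (h0 : 0 < lam) (h1 : lam ≤ 1) (h : HasBoundaryValues lam f u) :
    Tendsto (fun N => eLpNorm (fun x => f x - haarPartialSum lam f N x) 2 (mu lam)) atTop
      (𝓝 0) := by
  refine h.tendsto.congr fun N => ?_
  rw [eLpNorm_coding (f := fun x => f x - haarPartialSum lam f N x)
    (h.memLp.1.sub (measurable_haarPartialSum lam f N).aestronglyMeasurable)]
  refine eLpNorm_congr_ae ?_
  filter_upwards [h.ae_haarPartialSum h0 h1 N] with s hs
  simp only [hs]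

theorem haarEnergy_eq (h0 : 0 < lam) (h1 : lam ≤ 1) (h : HasBoundaryValues lam f u) :
    haarEnergy lam (u (q 0)) f = ENNReal.ofReal ((15 / 7) ^ mSeq lam 1 * drop lam u ^ 2)
      + ∑' n, ENNReal.ofReal (coefE lam u n) := by
  rw [haarEnergy, h.constTerm_eq h0 h1, show u (q 0) - beta lam u = drop lam u by rw [beta]; ring]
  congr 2
  funext n
  rw [coefE, ENNReal.ofReal_sum_of_nonneg fun w _ =>
    mul_nonneg (by positivity) (Finset.sum_nonneg fun _ _ => sq_nonneg _)]
  refine Finset.sum_congr rfl fun w hw => ?_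
  rw [Finset.mul_sum, ENNReal.ofReal_sum_of_nonneg fun j _ => by positivity]
  refine Finset.sum_congr rfl fun j hj => ?_
  rw [h.haarCoeff_eq h0 h1 hw hj, sq_abs]

end HasBoundaryValues

end expansion

/-! ### The two notions of solution -/

section solutions

variable {lam a : ℝ} {f u : Plane → ℝ}

theorem Flam_q_ne (h0 : 0 < lam) (h1 : lam ≤ 1) {n : ℕ} (hn : 1 ≤ n) {w : Fin n → Fin 6}
    (hw : w ∈ W lam n) : Flam lam w (q 0) ≠ q 0 := by
  intro hc
  have h2 := depth_Flam h0 h1 hw (q 0)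
  rw [hc] at h2
  simp only [q, Matrix.cons_val_zero, sub_self, sub_zero] at h2
  have h3 : (1 / 3 : ℝ) ^ mSeq lam n ≤ (1 / 3) ^ m1 lam :=
    pow_le_pow_of_le_one (by norm_num) (by norm_num) (by
      have := (mSeq_strictMono h0 h1).monotone hn
      simpa [mSeq, lamSeq] using this)
  have h4 : (1 / 3 : ℝ) ^ m1 lam < lam := by
    rw [one_div, inv_pow, inv_lt_iff_one_lt_mul₀ (by positivity)]
    have := (m1_spec h0 h1).2.1
    linarith
  have h5 : (1 / 3 : ℝ) ^ mSeq lam n * lamSeq lam n ≤ (1 / 3 : ℝ) ^ mSeq lam n :=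
    mul_le_of_le_one_right (by positivity) (lamSeq_mem h0 h1 n).2
  linarith

theorem eLpNorm_boundary (h0 : 0 < lam) (h1 : lam ≤ 1) (hf : AEStronglyMeasurable f (mu lam))
    (u : Plane → ℝ) (n : ℕ) : eLpNorm (fun x => f x - ∑ w ∈ W lam n,
        u (Flam lam w (q 0)) * (Xw lam w).indicator (fun _ => (1 : ℝ)) x) 2 (mu lam)
      = eLpNorm (fun s => f (coding lam s) - u (Flam lam (pref s n) (q 0))) 2
        (wordMeasure lam) := by
  have hm : Measurable fun x => ∑ w ∈ W lam n,
      u (Flam lam w (q 0)) * (Xw lam w).indicator (fun _ => (1 : ℝ)) x :=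
    Finset.measurable_fun_sum _ fun _ _ => (measurable_indicator_Xw lam _).const_mul _
  rw [eLpNorm_coding (f := fun x => f x - ∑ w ∈ W lam n,
    u (Flam lam w (q 0)) * (Xw lam w).indicator (fun _ => (1 : ℝ)) x)
    (hf.sub hm.aestronglyMeasurable)]
  refine eLpNorm_congr_ae ?_
  filter_upwards [ae_sum_indicator h0 h1] with s hs
  simp only [hs n fun w => u (Flam lam w (q 0))]

theorem IsL2Solution.hasBoundaryValues (h0 : 0 < lam) (h1 : lam ≤ 1) (h : IsL2Solution lam a f u) :
    HasBoundaryValues lam f (Function.update u (q 0) a) := by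
  have hH := h.harmonic.harm h0 h1 h.apex
  refine ⟨h.memLp, hH, hH.tendsto_partBeta h0 h1 (memLp_coding h.memLp) ?_⟩
  refine h.boundary.congr' ?_
  filter_upwards [eventually_ge_atTop 1] with n hn
  rw [eLpNorm_boundary h0 h1 h.memLp.1]
  refine eLpNorm_congr_ae ?_
  filter_upwards [ae_mem_W h0 h1] with s hs
  simp only [Function.update_of_ne (Flam_q_ne h0 h1 hn (hs n))]

/-- For continuous boundary values, convergence in `L²` follows from uniform continuity on the
compact closure of `Ω_λ`. -/
theorem IsDirichletSolution.isL2Solution (h0 : 0 < lam) (h1 : lam ≤ 1)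
    (h : IsDirichletSolution lam a f u) : IsL2Solution lam a f u := by
  have := wordMeasure_isProbability h0 h1
  have hmu : IsProbabilityMeasure (mu lam) := by
    rw [mu_eq]
    exact Measure.isProbabilityMeasure_map (measurable_coding lam).aemeasurable
  have hcomp := closure_isCompact h0 h1
  have hsub : X lam ⊆ Om lam ∪ ({q 0} ∪ X lam) := fun x hx => Or.inr (Or.inr hx)
  have hX : ∀ᵐ x ∂mu lam, x ∈ X lam := by
    rw [mu_eq]
    refine (ae_map_iff (p := fun x => x ∈ X lam) (measurable_coding lam).aemeasurable
      (X_isClosed lam).measurableSet).2 ?_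
    filter_upwards [ae_mem_W h0 h1] with s hs
    exact coding_mem_X h0 h1 hs
  have hf : AEStronglyMeasurable f (mu lam) := by
    have h2 : AEStronglyMeasurable u ((mu lam).restrict (X lam)) :=
      (h.continuousOn.mono hsub).aestronglyMeasurable (X_isClosed lam).measurableSet
    rw [Measure.restrict_eq_self_of_ae_mem hX] at h2
    exact h2.congr (hX.mono fun x hx => h.boundary x hx)
  obtain ⟨C, hC⟩ := hcomp.exists_bound_of_continuousOn h.continuousOn
  have hmem : MemLp f 2 (mu lam) := by
    refine MemLp.of_bound hf C (hX.mono fun x hx => ?_)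
    rw [← h.boundary x hx]
    exact hC x (hsub hx)
  refine ⟨hmem, h.harmonic, h.tendsto_apex, ?_⟩
  have hunif := hcomp.uniformContinuousOn_of_continuous h.continuousOn
  rw [Metric.uniformContinuousOn_iff] at hunif
  rw [ENNReal.tendsto_atTop_zero]
  intro ε hε
  obtain ⟨r, hr, hrε⟩ : ∃ r : ℝ, 0 < r ∧ ENNReal.ofReal r ≤ ε := by
    rcases eq_or_ne ε ⊤ with rfl | hne
    · exact ⟨1, one_pos, le_top⟩
    · exact ⟨ε.toReal, ENNReal.toReal_pos hε.ne' hne, (ENNReal.ofReal_toReal hne).le⟩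
  obtain ⟨δ, hδ, hu⟩ := hunif r hr
  have hz : Tendsto (fun n : ℕ => Metric.diam gasket * (1 / 3 : ℝ) ^ n) atTop (𝓝 0) := by
    simpa using (tendsto_pow_atTop_nhds_zero_of_lt_one (r := (1 / 3 : ℝ)) (by norm_num)
      (by norm_num)).const_mul (Metric.diam gasket)
  obtain ⟨N, hN⟩ := eventually_atTop.1 (hz.eventually_lt_const hδ)
  refine ⟨N, fun n hn => ?_⟩
  rw [eLpNorm_boundary h0 h1 hf]
  refine le_trans ?_ hrε
  have hb : ∀ᵐ s ∂wordMeasure lam,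
      ‖f (coding lam s) - u (Flam lam (pref s n) (q 0))‖ ≤ r := by
    filter_upwards [ae_mem_W h0 h1] with s hs
    have hcX := coding_mem_X h0 h1 hs
    rw [← h.boundary _ hcX, ← dist_eq_norm]
    refine (hu _ (hsub hcX) _ (Flam_mem_closure h0 h1 (hs n) (q_mem 0) ?_)
      ((dist_coding lam s n).trans_lt (hN n hn))).le
    simp only [q, Matrix.cons_val_zero, sub_self]
    exact (lamSeq_mem h0 h1 n).1.le
  refine (eLpNorm_le_of_ae_bound hb).trans ?_
  simp

end solutions

end SG3

/-- Two-sided energy estimate for harmonic functions on the upper domains of the level-3 gasket, for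
continuous boundary data and, more generally, for boundary data in `L²`. -/
theorem theorem3p10 :
    ∃ C₁ C₂ : ℝ, 0 < C₁ ∧ 0 < C₂ ∧
      ∀ lam : ℝ, 0 < lam → lam ≤ 1 → ∀ (a : ℝ) (f u : SG3.Plane → ℝ),
        (SG3.IsDirichletSolution lam a f u ∨ SG3.IsL2Solution lam a f u) →
          Tendsto (fun N : ℕ => eLpNorm (fun x => f x - SG3.haarPartialSum lam f N x) 2 (SG3.mu lam))
            atTop (𝓝 0) ∧
          ENNReal.ofReal C₁ * SG3.haarEnergy lam a f ≤ SG3.energy (SG3.Om lam) u ∧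
          SG3.energy (SG3.Om lam) u ≤ ENNReal.ofReal C₂ * SG3.haarEnergy lam a f ∧
          (SG3.energy (SG3.Om lam) u < ⊤ ↔ SG3.haarEnergy lam a f < ⊤) := by
  refine ⟨1 / 26, 6, by norm_num, by norm_num, fun lam h0 h1 a f u h => ?_⟩
  have hL : SG3.IsL2Solution lam a f u := h.elim (fun h => h.isL2Solution h0 h1) id
  have hB := hL.hasBoundaryValues h0 h1
  have hQ := hB.haarEnergy_eq h0 h1
  rw [Function.update_self] at hQ
  obtain ⟨hlow, hup⟩ := SG3.energy_comparison h0 h1 hB.harm hQ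
  refine ⟨hB.tendsto_haarPartialSum h0 h1, hlow, hup, fun hE => ?_, fun hfin => ?_⟩
  · by_contra hc
    rw [not_lt_top_iff.1 hc, ENNReal.mul_top (by simp)] at hlow
    exact hE.ne (top_le_iff.1 hlow)
  · exact hup.trans_lt (ENNReal.mul_lt_top ENNReal.ofReal_lt_top hfin)
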